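/- For $n\ge 1$ let $W_n$ be a random Hermitian $2n\times 2n$ matrix, with rows and columns indexed by $\{-n,\dots,-1,1,\dots,n\}$, taken from the Gaussian Unitary Ensemble with one of the two additional symmetries $$\text{(1)}\quad (W_n)_{xy}=(W_n)_{-y\,-x}\quad\text{(flip matrix model)},\qquad\qquad \text{(2)}\quad (W_n)_{xy}=(W_n)_{-x\,-y}.$$ That is, $(W_n)_{xy}=(2n)^{-1/2}(\xi_{xy}+i\eta_{xy})$, where $\xi_{xy},\eta_{xy}$ are centred real Gaussian variables of variance $1/2$, except at the positions where Hermitian symmetry and the additional symmetry force the entry to be real (the diagonal; in case (2) also the antidiagonal $y=-x$), where $\eta_{xy}=0$ and $\xi_{xy}$ has variance $1$; all these variables are independent, up to the identities between entries imposed by $W_n=W_n^\dagger$ and by the additional symmetry. The matrices $W_n$, $n\ge1$, are defined on one probability space, with an arbitrary joint distribution. Let $N_n(\Delta)=\#\{i:\lambda_i\in\Delta\}/(2n)$ be the normalized eigenvalue counting measure of $W_n$, let $g_n(z)=\int (\lambda-z)^{-1}N_n(d\lambda)$, $\operatorname{Im} z>0$, be its Stieltjes transform, let $N_{sc}(d\lambda)=(2\pi)^{-1}\sqrt{4-\lambda^2}\,\chi_{[-2,2]}(\lambda)\,d\lambda$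 be the semicircle law, and let $f_{sc}(z)=\int(\lambda-z)^{-1}N_{sc}(d\lambda)$. Then, in each of the cases (1) and (2): (a) with probability $1$, $N_n$ converges weakly to $N_{sc}$ as $n\to\infty$; (b) for all $z_1,z_2$ with $\operatorname{Im}z_1>0$ and $\operatorname{Im}z_2>0$, as $n\to\infty$, $$\mathbb E\{(g_n(z_1)-\mathbb E g_n(z_1))(g_n(z_2)-\mathbb E g_n(z_2))\}=(2n)^{-2}S(z_1,z_2)+o(n^{-2}),$$ $$S(z_1,z_2)=\frac{2}{(1-f_{sc}^2(z_1))(1-f_{sc}^2(z_2))}\left(\frac{f_{sc}(z_1)-f_{sc}(z_2)}{z_1-z_2}\right)^2,$$ where for $z_1=z_2$ the difference quotient is read as $f_{sc}'(z_1)$. (This is the asymptotic form known for the $2n\times2n$ Gaussian Orthogonal Ensemble.) -/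

import Mathlib

open MeasureTheory ProbabilityTheory Filter Topology Asymptotics
open scoped NNReal ENNReal BoundedContinuousFunction

noncomputable section

/-- The index set `{-n, …, -1, 1, …, n}`. -/
abbrev SymIdx (n : ℕ) : Type := {x : ℤ // x ∈ (Finset.Icc (-(n : ℤ)) n).erase 0}

instance (n : ℕ) : Neg (SymIdx n) where
  neg x := ⟨-x.1, by
    have h := x.2
    simp only [Finset.mem_erase, Finset.mem_Icc] at h ⊢
    omega⟩

/-- The two additional symmetries. -/
inductive AddSymm : Type
  | /-- `W x y = W (-y) (-x)` (flip matrix model) -/ flip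
  | /-- `W x y = W (-x) (-y)` -/ central

/-- The involution on matrix positions that belongs to a symmetry. -/
def AddSymm.act (s : AddSymm) {n : ℕ} (p : SymIdx n × SymIdx n) : SymIdx n × SymIdx n :=
  match s with
  | .flip => (-p.2, -p.1)
  | .central => (-p.1, -p.2)

/-- Hermitian symmetry together with the additional symmetry forces the entry at position `(x, y)`
to be real: `(y, x)` is `(x, y)` or its image. This happens on the diagonal and, for the central
symmetry only, on the antidiagonal. -/
def AddSymm.ForcedReal (s : AddSymm) {n : ℕ} (x y : SymIdx n) : Prop :=
  (y, x) = (x, y) ∨ (y, x) = s.act (x, y)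

/-- A set of representatives of the positions: under the group generated by the
transposition `(x, y) ↦ (y, x)` and by either of the two involutions `AddSymm.act`, each position
is equivalent to exactly one position `(x, y)` with `|x| ≤ y`. -/
abbrev FreePos (n : ℕ) : Type := {p : SymIdx n × SymIdx n // |(p.1 : ℤ)| ≤ p.2}

/-- `W` is a random matrix from the `2n × 2n` Gaussian Unitary Ensemble with the additional
symmetry `s`: it is Hermitian, `W x y = W (s.act (x, y))`, and `W x y = (2n)^(-1/2) (ξ x y + i η x y)`
with centred real Gaussian `ξ x y`, `η x y` of variance `1/2` (for the entries forced to be real,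
as on the diagonal of the standard GUE, `η x y = 0` and `ξ x y` has variance `1`, so that
`E |W x y|² = 1/(2n)` for every entry); all the `ξ`, `η` at non-equivalent positions are
independent. -/
structure IsSymmetricGUE {Ω : Type*} [MeasurableSpace Ω] (P : Measure Ω) (s : AddSymm) (n : ℕ)
    (W : Ω → Matrix (SymIdx n) (SymIdx n) ℂ) : Prop where
  isHermitian : ∀ ω, (W ω).IsHermitian
  symm : ∀ ω x y, W ω x y = W ω (s.act (x, y)).1 (s.act (x, y)).2
  law_real : ∀ x y, s.ForcedReal x y →
    HasLaw (fun ω => Real.sqrt (2 * n) * (W ω x y).re) (gaussianReal 0 1) P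
  law_re : ∀ x y, ¬ s.ForcedReal x y →
    HasLaw (fun ω => Real.sqrt (2 * n) * (W ω x y).re) (gaussianReal 0 (1 / 2)) P
  law_im : ∀ x y, ¬ s.ForcedReal x y →
    HasLaw (fun ω => Real.sqrt (2 * n) * (W ω x y).im) (gaussianReal 0 (1 / 2)) P
  indep : iIndepFun (fun (k : FreePos n × Bool) (ω : Ω) =>
    if k.2 then (W ω k.1.1.1 k.1.1.2).re else (W ω k.1.1.1 k.1.1.2).im) P

/-- The normalized eigenvalue counting measure `N(Δ) = #{i : λ_i ∈ Δ} / (2n)` of a `2n × 2n`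
Hermitian matrix (eigenvalues counted with multiplicity). -/
def ncm {n : ℕ} {A : Matrix (SymIdx n) (SymIdx n) ℂ} (hA : A.IsHermitian) : Measure ℝ :=
  ((2 * n : ℕ) : ℝ≥0∞)⁻¹ • ∑ i, Measure.dirac (hA.eigenvalues i)

/-- The semicircle law `(2π)⁻¹ √(4 - λ²) 1_{[-2,2]}(λ) dλ`. -/
def semicircleLaw : Measure ℝ :=
  volume.withDensity fun l =>
    ENNReal.ofReal ((Set.Icc (-2 : ℝ) 2).indicator (fun l => (2 * Real.pi)⁻¹ * √(4 - l ^ 2)) l)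

/-- The Stieltjes transform `∫ (λ - z)⁻¹ μ(dλ)`. -/
def stieltjes (μ : Measure ℝ) (z : ℂ) : ℂ := resolventTransform μ z

lemma stieltjes_eq (μ : Measure ℝ) (z : ℂ) : stieltjes μ z = ∫ l : ℝ, ((l : ℂ) - z)⁻¹ ∂μ := by
  simp [stieltjes, resolventTransform_def, resolvent, Ring.inverse_eq_inv']

/-- The Stieltjes transform `f_sc` of the semicircle law. -/
def fsc (z : ℂ) : ℂ := stieltjes semicircleLaw z

/-- The difference quotient `(f_sc(z₁) - f_sc(z₂)) / (z₁ - z₂)`, extended by continuity to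
`z₁ = z₂`. -/
def fscQuot (z₁ z₂ : ℂ) : ℂ :=
  open scoped Classical in
  if z₁ = z₂ then deriv fsc z₁ else (fsc z₁ - fsc z₂) / (z₁ - z₂)

/-- The function `S(z₁, z₂)`. -/
def goeS (z₁ z₂ : ℂ) : ℂ :=
  2 / ((1 - fsc z₁ ^ 2) * (1 - fsc z₂ ^ 2)) * fscQuot z₁ z₂ ^ 2

/-- The correlation function `E {(g(z₁) - E g(z₁)) (g(z₂) - E g(z₂))}` of a random function `g`. -/
def corr {Ω : Type*} [MeasurableSpace Ω] (P : Measure Ω) (g : Ω → ℂ → ℂ) (z₁ z₂ : ℂ) : ℂ :=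
  ∫ ω, (g ω z₁ - ∫ ω', g ω' z₁ ∂P) * (g ω z₂ - ∫ ω', g ω' z₂ ∂P) ∂P

end

/-! The matrix has the law of W = ∑ Y_k B_k with independent standard Gaussian Y_k and fixed
Hermitian B_k (`basisMat`). E[W_q W_r] is 1/(2n) when r is the transpose of q or the image of that
transpose under the extra symmetry, and 0 otherwise. So every Gaussian contraction is the GUE one,
plus a second pairing, minus a double count where the two pairings coincide. Two tools handle the
resolvents: integration by parts (`integral_coord_mul`) and the Poincaré inequality
(`poincare_gaussPi`), which bounds the variance of the trace of any product of resolvents uniformly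
in n.

Mean. Integrating tr(W G_a G_b ⋯) by parts gives loop equations (`mean_one`, `mean_two`,
`mean_three`). After normalization, covariances of traces and the extra pairing are O(1/n)
(`exists_norm_pairMean_sub_le`), so the limits solve closed algebraic equations, beginning with 1 +
zf + f² = 0. An explicit integral shows that `fsc` is the root of modulus less than 1.

Covariance. Testing the loop equation against a centred trace (`trCov_loop`) brings in ∑ tr(B_k G_a)
tr(B_k G_b²). Resolvents inherit the extra symmetry, so both pairings contribute equally and give 2
tr(G_a G_b²) instead of the single term of the GUE: this is the factor of the orthogonal ensemble
(`sum_trace_mul_trace_of_inv`). The remaining terms carry a factor 1/(2n) and have to be o(n). Third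
moments of centred traces are O(1), and the contraction error against a centred trace is O(√n). In
the central case that error is a product of two antidiagonal sums, with no useful pointwise bound.
Conjugation by the diagonal matrix of signs preserves the law and flips these entries, so the sums
have mean zero, and their variance is O(1).

Almost sure convergence. The variance of g_n(z) is O(n⁻²), hence summable, and g_n(z) converges
almost surely for all z in a countable dense set, whatever the joint law. Convergence of Stieltjes
transforms on a dense set gives weak convergence (`tendsto_of_tendsto_stieltjes`). -/

noncomputable section

/-! ### Analysis of the standard Gaussian product measure -/

/-- The standard Gaussian measure on `K → ℝ`. -/
abbrev gaussPi (K : Type*) [Fintype K] : Measure (K → ℝ) := Measure.pi fun _ : K => gaussianReal 0 1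

/-- Continuously differentiable, bounded and with bounded derivative. -/
structure BddC1 {E V : Type*} [NormedAddCommGroup E] [NormedSpace ℝ E] [NormedAddCommGroup V]
    [NormedSpace ℝ V] (F : E → V) : Prop where
  contDiff : ContDiff ℝ 1 F
  bdd : ∃ C, ∀ x, ‖F x‖ ≤ C
  bdd_fderiv : ∃ C, ∀ x, ‖fderiv ℝ F x‖ ≤ C

namespace BddC1

variable {E V V' : Type*} [NormedAddCommGroup E] [NormedSpace ℝ E] [NormedAddCommGroup V]
  [NormedSpace ℝ V] [NormedAddCommGroup V'] [NormedSpace ℝ V'] {F G : E → V}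

lemma differentiable (hF : BddC1 F) : Differentiable ℝ F := hF.contDiff.differentiable one_ne_zero

lemma continuous (hF : BddC1 F) : Continuous F := hF.contDiff.continuous

lemma continuous_fderiv (hF : BddC1 F) : Continuous (fderiv ℝ F) :=
  hF.contDiff.continuous_fderiv one_ne_zero

lemma hasFDerivAt (hF : BddC1 F) (x : E) : HasFDerivAt F (fderiv ℝ F x) x :=
  (hF.differentiable x).hasFDerivAt

lemma const (c : V) : BddC1 (fun _ : E => c) where
  contDiff := contDiff_const
  bdd := ⟨‖c‖, fun _ => le_rfl⟩
  bdd_fderiv := ⟨0, fun x => by simp⟩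

lemma add (hF : BddC1 F) (hG : BddC1 G) : BddC1 (fun x => F x + G x) where
  contDiff := hF.contDiff.add hG.contDiff
  bdd := by
    obtain ⟨C, hC⟩ := hF.bdd
    obtain ⟨D, hD⟩ := hG.bdd
    exact ⟨C + D, fun x => (norm_add_le _ _).trans (add_le_add (hC x) (hD x))⟩
  bdd_fderiv := by
    obtain ⟨C, hC⟩ := hF.bdd_fderiv
    obtain ⟨D, hD⟩ := hG.bdd_fderiv
    refine ⟨C + D, fun x => ?_⟩
    rw [show fderiv ℝ (fun x => F x + G x) x = _ from
      ((hF.hasFDerivAt x).add (hG.hasFDerivAt x)).fderiv]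
    exact (norm_add_le _ _).trans (add_le_add (hC x) (hD x))

lemma clm_comp (hF : BddC1 F) (L : V →L[ℝ] V') : BddC1 (fun x => L (F x)) where
  contDiff := L.contDiff.comp hF.contDiff
  bdd := by
    obtain ⟨C, hC⟩ := hF.bdd
    exact ⟨‖L‖ * C, fun x => (L.le_opNorm _).trans (by gcongr; exact hC x)⟩
  bdd_fderiv := by
    obtain ⟨C, hC⟩ := hF.bdd_fderiv
    refine ⟨‖L‖ * C, fun x => ?_⟩
    rw [show fderiv ℝ (fun x => L (F x)) x = _ from
      (L.hasFDerivAt.comp x (hF.hasFDerivAt x)).fderiv]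
    exact (L.opNorm_comp_le _).trans (by gcongr; exact hC x)

lemma fderiv_clm_comp (hF : BddC1 F) (L : V →L[ℝ] V') (x v : E) :
    fderiv ℝ (fun x => L (F x)) x v = L (fderiv ℝ F x v) := by
  change fderiv ℝ (L ∘ F) x v = _
  rw [(L.hasFDerivAt.comp x (hF.hasFDerivAt x)).fderiv]
  rfl

lemma sub (hF : BddC1 F) (hG : BddC1 G) : BddC1 (fun x => F x - G x) := by
  simpa [sub_eq_add_neg] using hF.add (hG.clm_comp (-ContinuousLinearMap.id ℝ V))

section Mul

variable {A : Type*} [NormedRing A] [NormedAlgebra ℝ A] {F G : E → A}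

lemma fderiv_mul (hF : BddC1 F) (hG : BddC1 G) (x v : E) :
    fderiv ℝ (fun x => F x * G x) x v = F x * fderiv ℝ G x v + fderiv ℝ F x v * G x := by
  rw [show fderiv ℝ (fun x => F x * G x) x = _ from
    ((hF.hasFDerivAt x).mul' (hG.hasFDerivAt x)).fderiv]
  simp

lemma mul (hF : BddC1 F) (hG : BddC1 G) : BddC1 (fun x => F x * G x) where
  contDiff := hF.contDiff.mul hG.contDiff
  bdd := by
    obtain ⟨C, hC⟩ := hF.bdd
    obtain ⟨D, hD⟩ := hG.bdd
    exact ⟨C * D, fun x => (norm_mul_le _ _).trans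
      (mul_le_mul (hC x) (hD x) (norm_nonneg _) ((norm_nonneg _).trans (hC x)))⟩
  bdd_fderiv := by
    obtain ⟨C, hC⟩ := hF.bdd
    obtain ⟨D, hD⟩ := hG.bdd
    obtain ⟨C', hC'⟩ := hF.bdd_fderiv
    obtain ⟨D', hD'⟩ := hG.bdd_fderiv
    refine ⟨C * D' + C' * D, fun x => ContinuousLinearMap.opNorm_le_bound _ ?_ fun v => ?_⟩
    · have := (norm_nonneg _).trans (hC x)
      have := (norm_nonneg _).trans (hD x)
      have := (norm_nonneg _).trans (hC' x)
      have := (norm_nonneg _).trans (hD' x)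
      positivity
    · rw [fderiv_mul hF hG]
      have h1 : ‖F x * fderiv ℝ G x v‖ ≤ C * (D' * ‖v‖) :=
        (norm_mul_le _ _).trans (mul_le_mul (hC x) (((fderiv ℝ G x).le_opNorm v).trans
          (by gcongr; exact hD' x)) (norm_nonneg _) ((norm_nonneg _).trans (hC x)))
      have h2 : ‖fderiv ℝ F x v * G x‖ ≤ C' * ‖v‖ * D :=
        (norm_mul_le _ _).trans (mul_le_mul (((fderiv ℝ F x).le_opNorm v).trans
          (by gcongr; exact hC' x)) (hD x) (norm_nonneg _)
          (mul_nonneg ((norm_nonneg _).trans (hC' x)) (norm_nonneg _)))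
      calc _ ≤ _ := norm_add_le _ _
        _ ≤ _ := add_le_add h1 h2
        _ = _ := by ring

end Mul

lemma integrable [MeasurableSpace E] [BorelSpace E] [SecondCountableTopology E]
    (hF : BddC1 F) (μ : Measure E) [IsFiniteMeasure μ] : Integrable F μ := by
  obtain ⟨C, hC⟩ := hF.bdd
  exact Integrable.of_bound hF.continuous.aestronglyMeasurable C (ae_of_all _ hC)

lemma integrable_fderiv [MeasurableSpace E] [BorelSpace E] [SecondCountableTopology E]
    (hF : BddC1 F) (μ : Measure E) [IsFiniteMeasure μ] (v : E) :
    Integrable (fun x => fderiv ℝ F x v) μ := by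
  obtain ⟨C, hC⟩ := hF.bdd_fderiv
  refine Integrable.of_bound (hF.continuous_fderiv.clm_apply continuous_const).aestronglyMeasurable
    (C * ‖v‖) (ae_of_all _ fun x => ((fderiv ℝ F x).le_opNorm v).trans ?_)
  gcongr
  exact hC x

end BddC1

/-- Stein's identity for the standard Gaussian law on the line. -/
lemma stein_gaussianReal {f f' : ℝ → ℂ} (hf : ∀ t, HasDerivAt f (f' t) t) (hc : Continuous f')
    {C C' : ℝ} (hC : ∀ t, ‖f t‖ ≤ C) (hC' : ∀ t, ‖f' t‖ ≤ C') :
    ∫ t, (t : ℂ) * f t ∂(gaussianReal 0 1) = ∫ t, f' t ∂(gaussianReal 0 1) := by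
  have hd : ∀ t, HasDerivAt (gaussianPDFReal 0 1) (-t * gaussianPDFReal 0 1 t) t := by
    intro t
    have h1 : HasDerivAt (fun x : ℝ => -(x - 0) ^ 2 / (2 * ((1 : ℝ≥0) : ℝ))) (-t) t := by
      have := (((hasDerivAt_id t).sub_const 0).pow 2).neg.div_const (2 * ((1 : ℝ≥0) : ℝ))
      convert! this using 1
      simp
      ring
    have h2 := (h1.exp).const_mul ((√(2 * Real.pi * ((1 : ℝ≥0) : ℝ)))⁻¹)
    convert! h2 using 1
    rw [gaussianPDFReal]
    ring
  have hfc : Continuous f := continuous_iff_continuousAt.2 fun t => (hf t).continuousAt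
  have hpi : Integrable (gaussianPDFReal 0 1) := integrable_gaussianPDFReal 0 1
  have hpc : Continuous (gaussianPDFReal 0 1) :=
    continuous_iff_continuousAt.2 fun t => (hd t).continuousAt
  have hpi2 : Integrable fun t : ℝ => t * gaussianPDFReal 0 1 t := by
    have h := (memLp_id_gaussianReal (μ := 0) (v := 1) 1).integrable (by simp)
    rw [gaussianReal_of_var_ne_zero 0 one_ne_zero,
      integrable_withDensity_iff_integrable_smul' (by fun_prop) (by simp [gaussianPDF])] at h
    refine h.congr (ae_of_all _ fun t => ?_)
    simp [mul_comm]
  -- The Gaussian density φ satisfies φ' = -tφ, so this is integration by parts on the whole line;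
  -- integrability removes the boundary terms.
  have key := integral_mul_deriv_eq_deriv_mul_of_integrable (A := ℂ) (u := f) (u' := f')
    (v := fun t => (gaussianPDFReal 0 1 t : ℂ))
    (v' := fun t => ((-t * gaussianPDFReal 0 1 t : ℝ) : ℂ))
    (fun x _ => hf x) (fun x _ => (hd x).ofReal_comp) ?_ ?_ ?_
  · rw [integral_gaussianReal_eq_integral_smul one_ne_zero,
      integral_gaussianReal_eq_integral_smul one_ne_zero]
    have e1 : ∀ t : ℝ, gaussianPDFReal 0 1 t • ((t : ℂ) * f t)
        = -(f t * ((-t * gaussianPDFReal 0 1 t : ℝ) : ℂ)) := by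
      intro t; rw [Complex.real_smul]; push_cast; ring
    have e2 : ∀ t : ℝ, gaussianPDFReal 0 1 t • f' t = f' t * (gaussianPDFReal 0 1 t : ℂ) := by
      intro t; rw [Complex.real_smul]; ring
    simp_rw [e1, e2]
    rw [integral_neg, key, neg_neg]
  · refine Integrable.bdd_mul (c := C) ?_ hfc.aestronglyMeasurable (ae_of_all _ hC)
    exact Integrable.ofReal (hpi2.neg.congr (ae_of_all _ fun t => (neg_mul t _).symm))
  · exact Integrable.bdd_mul (c := C') hpi.ofReal hc.aestronglyMeasurable (ae_of_all _ hC')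
  · exact Integrable.bdd_mul (c := C) hpi.ofReal hfc.aestronglyMeasurable (ae_of_all _ hC)

section Pi

set_option linter.unusedSectionVars false

variable {K : Type*} [Fintype K] [DecidableEq K]

/-- Resampling one coordinate preserves a product of probability measures. -/
lemma measurePreserving_update {X : K → Type*} [∀ k, MeasurableSpace (X k)]
    (ν : ∀ k, Measure (X k)) [∀ k, IsProbabilityMeasure (ν k)] (k : K) :
    MeasurePreserving (fun p : (∀ k, X k) × X k => Function.update p.1 k p.2)
      ((Measure.pi ν).prod (ν k)) (Measure.pi ν) := by
  have hm : Measurable (fun p : (∀ k, X k) × X k => Function.update p.1 k p.2) := by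
    refine measurable_pi_iff.2 fun j => ?_
    by_cases h : j = k
    · subst h
      simpa using measurable_snd
    · simpa [Function.update_of_ne h] using! (measurable_pi_apply j).comp measurable_fst
  refine ⟨hm, (Measure.pi_eq fun s hs => ?_).symm⟩
  rw [Measure.map_apply hm (MeasurableSet.univ_pi hs)]
  have : (fun p : (∀ k, X k) × X k => Function.update p.1 k p.2) ⁻¹' (Set.univ.pi s)
      = (Set.univ.pi (Function.update s k Set.univ)) ×ˢ s k := by
    ext p
    simp only [Set.mem_preimage, Set.mem_univ_pi, Set.mem_prod]
    constructor
    · intro h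
      refine ⟨fun j => ?_, by simpa using h k⟩
      by_cases hj : j = k
      · subst hj; simp
      · simpa [Function.update_of_ne hj] using h j
    · rintro ⟨h1, h2⟩ j
      by_cases hj : j = k
      · subst hj; simpa using h2
      · simpa [Function.update_of_ne hj] using h1 j
  rw [this, Measure.prod_prod, Measure.pi_pi, ← Finset.mul_prod_erase Finset.univ _ (Finset.mem_univ k),
    ← Finset.mul_prod_erase Finset.univ (fun i => ν i (s i)) (Finset.mem_univ k)]
  simp only [Function.update_self, measure_univ, one_mul]
  rw [mul_comm]
  congr 1
  refine Finset.prod_congr rfl fun j hj => ?_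
  rw [Function.update_of_ne (Finset.ne_of_mem_erase hj)]

lemma integrable_coord_mul {F : (K → ℝ) → ℂ} (hF : BddC1 F) (k : K) :
    Integrable (fun y => (y k : ℂ) * F y) (gaussPi K) := by
  obtain ⟨C, hC⟩ := hF.bdd
  refine Integrable.mul_bdd (c := C) ?_ hF.continuous.aestronglyMeasurable (ae_of_all _ hC)
  refine Integrable.ofReal ?_
  exact integrable_eval (μ := fun _ : K => gaussianReal 0 1) (i := k)
    ((memLp_id_gaussianReal (μ := 0) (v := 1) 1).integrable (by simp))

/-- Gaussian integration by parts. -/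
lemma integral_coord_mul {F : (K → ℝ) → ℂ} (hF : BddC1 F) (k : K) :
    ∫ y, (y k : ℂ) * F y ∂(gaussPi K) = ∫ y, fderiv ℝ F y (Pi.single k 1) ∂(gaussPi K) := by
  -- Resampling coordinate `k` keeps the law, so both sides can be integrated first over a fresh
  -- value of that coordinate, with the others frozen.
  have mp := measurePreserving_update (fun _ : K => gaussianReal 0 1) k
  have hi := integrable_coord_mul hF k
  have hi' := hF.integrable_fderiv (gaussPi K) (Pi.single k 1)
  rw [gaussPi, ← mp.map_eq, integral_map mp.measurable.aemeasurable (by rw [mp.map_eq]; exact hi.1),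
    integral_map mp.measurable.aemeasurable (by rw [mp.map_eq]; exact hi'.1),
    show ∫ p : (K → ℝ) × ℝ, (Function.update p.1 k p.2 k : ℂ) * F (Function.update p.1 k p.2)
      ∂((gaussPi K).prod (gaussianReal 0 1)) = _ from
      integral_prod _ (mp.integrable_comp_of_integrable hi),
    show ∫ p : (K → ℝ) × ℝ, fderiv ℝ F (Function.update p.1 k p.2) (Pi.single k 1)
      ∂((gaussPi K).prod (gaussianReal 0 1)) = _ from
      integral_prod _ (mp.integrable_comp_of_integrable hi')]
  refine integral_congr_ae (ae_of_all _ fun y => ?_)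
  obtain ⟨C, hC⟩ := hF.bdd
  obtain ⟨C', hC'⟩ := hF.bdd_fderiv
  have hu : Continuous fun t : ℝ => Function.update y k t := continuous_const.update k continuous_id
  simp only [Function.update_self]
  refine stein_gaussianReal (f := fun t => F (Function.update y k t))
    (f' := fun t => fderiv ℝ F (Function.update y k t) (Pi.single k 1)) (fun t => ?_) ?_
    (fun t => hC _) (C' := C' * ‖(Pi.single k 1 : K → ℝ)‖) fun t => ?_
  · exact (hF.hasFDerivAt _).comp_hasDerivAt t (hasDerivAt_update y k t)
  · exact (hF.continuous_fderiv.comp hu).clm_apply continuous_const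
  · exact (ContinuousLinearMap.le_opNorm _ _).trans (by gcongr; exact hC' _)

/-- Transport from the standard Gaussian on Euclidean space; only the norm changes. Gaussianity
supplies the moments of linear forms and the rotation invariance of two independent copies. -/
instance isGaussian_gaussPi : IsGaussian (gaussPi K) := by
  have h := map_pi_eq_stdGaussian (ι := K)
  have h2 : gaussPi K = (stdGaussian (EuclideanSpace ℝ K)).map (EuclideanSpace.equiv K ℝ) := by
    rw [← h, Measure.map_map (by fun_prop) (by fun_prop)]
    symm
    exact Measure.map_id
  rw [h2]
  infer_instance

lemma integral_id_gaussPi : ∫ y, id y ∂(gaussPi K) = 0 := by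
  ext k
  have hi : Integrable (fun y : K → ℝ => id y) (gaussPi K) := IsGaussian.integrable_id
  have := (ContinuousLinearMap.proj (R := ℝ) (φ := fun _ : K => ℝ) k).integral_comp_comm hi
  simp only [ContinuousLinearMap.proj_apply, id] at this ⊢
  rw [← this, integral_eval]
  simp

lemma integral_dual_sq_gaussPi (l : (K → ℝ) →L[ℝ] ℝ) :
    ∫ y, l y ^ 2 ∂(gaussPi K) = ∑ k, l (Pi.single k 1) ^ 2 := by
  have h0 : ∫ y, l y ∂(gaussPi K) = 0 := by
    have := l.integral_comp_comm (IsGaussian.integrable_id (μ := gaussPi K))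
    simp only [id] at this
    rw [this]
    have h := integral_id_gaussPi (K := K)
    simp only [id] at h
    rw [h, map_zero]
  have h1 : Var[l; gaussPi K] = ∫ y, l y ^ 2 ∂(gaussPi K) :=
    variance_of_integral_eq_zero l.continuous.aemeasurable h0
  have h2 : (l : (K → ℝ) → ℝ) = ∑ k, fun y : K → ℝ => l (Pi.single k 1) * y k := by
    ext y
    conv_lhs => rw [← Finset.univ_sum_single y, map_sum]
    rw [Finset.sum_apply]
    refine Finset.sum_congr rfl fun k _ => ?_
    have : (Pi.single k (y k) : K → ℝ) = y k • Pi.single k 1 := by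
      rw [← Pi.single_smul]; simp
    rw [this, map_smul, smul_eq_mul, mul_comm]
  rw [← h1]
  conv_lhs => rw [h2]
  rw [variance_sum_pi]
  · change ∑ i, Var[fun x ↦ _ * (id x); gaussianReal 0 1] = _
    simp_rw [variance_const_mul, variance_id_gaussianReal]
    simp
  · exact fun i ↦ IsGaussian.memLp_two_id.const_mul _

lemma integral_norm_sq_linear_gaussPi (L : (K → ℝ) →L[ℝ] ℂ) :
    ∫ y, ‖L y‖ ^ 2 ∂(gaussPi K) = ∑ k, ‖L (Pi.single k 1)‖ ^ 2 := by
  have h : ∀ z : ℂ, ‖z‖ ^ 2 = (Complex.reCLM z) ^ 2 + (Complex.imCLM z) ^ 2 := by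
    intro z
    rw [Complex.sq_norm, Complex.normSq_apply]
    simp [sq]
  simp_rw [h]
  have hint : ∀ l : (K → ℝ) →L[ℝ] ℝ, Integrable (fun y => l y ^ 2) (gaussPi K) := fun l =>
    (IsGaussian.memLp_dual (gaussPi K) l 2 (by simp)).integrable_sq
  rw [Finset.sum_add_distrib]
  refine (integral_add (hint (Complex.reCLM.comp L)) (hint (Complex.imCLM.comp L))).trans ?_
  exact congrArg₂ _ (integral_dual_sq_gaussPi (Complex.reCLM.comp L))
    (integral_dual_sq_gaussPi (Complex.imCLM.comp L))

end Pi

lemma sq_lintegral_le {α : Type*} [MeasurableSpace α] (ν : Measure α) {f : α → ℝ≥0∞}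
    (hf : AEMeasurable f ν) : (∫⁻ x, f x ∂ν) ^ 2 ≤ ν Set.univ * ∫⁻ x, f x ^ 2 ∂ν := by
  have h := ENNReal.lintegral_mul_le_Lp_mul_Lq ν Real.HolderConjugate.two_two hf
    (aemeasurable_const (b := (1 : ℝ≥0∞)))
  simp only [Pi.mul_apply, mul_one, ENNReal.rpow_two, one_pow, lintegral_one] at h
  calc (∫⁻ x, f x ∂ν) ^ 2 ≤ ((∫⁻ x, f x ^ 2 ∂ν) ^ (1 / 2 : ℝ) * (ν Set.univ) ^ (1 / 2 : ℝ)) ^ 2 := by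
        gcongr
    _ = _ := by
        rw [mul_pow, ← ENNReal.rpow_two, ← ENNReal.rpow_two, ← ENNReal.rpow_mul,
          ← ENNReal.rpow_mul]
        norm_num [mul_comm]

section Pi

set_option linter.unusedSectionVars false

variable {K : Type*} [Fintype K] [DecidableEq K]

/-- Fundamental theorem of calculus along the arc cos θ · x + sin θ · y from x to y, whose velocity
is the second component of the rotated pair. An arc is preferred to a segment because position and
velocity are again two independent Gaussian vectors at every θ. -/
lemma sub_eq_integral_rotation {F : (K → ℝ) → ℂ} (hF : BddC1 F) (p : (K → ℝ) × (K → ℝ)) :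
    F p.2 - F p.1 = ∫ θ in (0 : ℝ)..(Real.pi / 2),
      fderiv ℝ F (ContinuousLinearMap.rotation θ p).1 (ContinuousLinearMap.rotation θ p).2 := by
  have hu : ∀ θ : ℝ, HasDerivAt (fun θ : ℝ => (ContinuousLinearMap.rotation θ p).1)
      (ContinuousLinearMap.rotation θ p).2 θ := by
    intro θ
    simp only [ContinuousLinearMap.rotation_apply]
    exact ((Real.hasDerivAt_cos θ).smul_const p.1).add ((Real.hasDerivAt_sin θ).smul_const p.2)
  have hd : ∀ θ : ℝ, HasDerivAt (fun θ : ℝ => F (ContinuousLinearMap.rotation θ p).1)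
      (fderiv ℝ F (ContinuousLinearMap.rotation θ p).1 (ContinuousLinearMap.rotation θ p).2) θ :=
    fun θ => (hF.hasFDerivAt _).comp_hasDerivAt θ (hu θ)
  rw [intervalIntegral.integral_eq_sub_of_hasDerivAt (fun θ _ => hd θ)]
  · simp [ContinuousLinearMap.rotation_apply]
  · refine Continuous.intervalIntegrable ?_ _ _
    refine (hF.continuous_fderiv.comp ?_).clm_apply ?_ <;>
    · simp only [ContinuousLinearMap.rotation_apply]
      fun_prop

lemma enorm_intervalIntegral_sq_le {b : ℝ} (hb : 0 ≤ b) {h : ℝ → ℂ} (hh : Continuous h) :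
    ‖∫ θ in (0 : ℝ)..b, h θ‖ₑ ^ 2 ≤ ENNReal.ofReal b * ∫⁻ θ in Set.Ioc 0 b, ‖h θ‖ₑ ^ 2 := by
  rw [intervalIntegral.integral_of_le hb]
  calc _ ≤ (∫⁻ θ in Set.Ioc 0 b, ‖h θ‖ₑ) ^ 2 := by
        gcongr; exact enorm_integral_le_lintegral_enorm _
    _ ≤ _ := by
        refine (sq_lintegral_le _ hh.enorm.measurable.aemeasurable).trans (le_of_eq ?_)
        simp

/-- Jensen's inequality, replacing the mean by an independent copy. -/
lemma enorm_integral_sq_le {G : (K → ℝ) → ℂ} (hG : BddC1 G) (x : K → ℝ) :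
    ‖G x - ∫ y, G y ∂(gaussPi K)‖ₑ ^ 2 ≤ ∫⁻ y, ‖G y - G x‖ₑ ^ 2 ∂(gaussPi K) := by
  have h1 : G x - ∫ y, G y ∂(gaussPi K) = - ∫ y, (G y - G x) ∂(gaussPi K) := by
    rw [integral_sub (hG.integrable _) (integrable_const _)]
    simp
  rw [h1, enorm_neg]
  calc _ ≤ (∫⁻ y, ‖G y - G x‖ₑ ∂(gaussPi K)) ^ 2 := by
        gcongr; exact enorm_integral_le_lintegral_enorm _
    _ ≤ _ := by
        refine (sq_lintegral_le _ ?_).trans ?_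
        · exact (hG.continuous.sub continuous_const).enorm.measurable.aemeasurable
        · simp

/-- Compare F at two independent points, join them by an arc of rotations, and use that the pair
(position, velocity) has the same law for every angle. One factor π/2 comes from Cauchy–Schwarz in
the angle, the other from the length of the arc; the constant is not sharp. -/
lemma poincare_gaussPi_lintegral {F : (K → ℝ) → ℂ} (hF : BddC1 F) :
    ∫⁻ x, ‖F x - ∫ y, F y ∂(gaussPi K)‖ₑ ^ 2 ∂(gaussPi K) ≤
      ENNReal.ofReal (Real.pi / 2) ^ 2 *
        ∫⁻ x, ENNReal.ofReal (∑ k, ‖fderiv ℝ F x (Pi.single k 1)‖ ^ 2) ∂(gaussPi K) := by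
  set μ := gaussPi K
  set L := ENNReal.ofReal (Real.pi / 2) with hL
  let D : (K → ℝ) × (K → ℝ) → ℝ≥0∞ := fun p => ‖fderiv ℝ F p.1 p.2‖ₑ ^ 2
  have hDc : Continuous fun p : (K → ℝ) × (K → ℝ) => fderiv ℝ F p.1 p.2 :=
    (hF.continuous_fderiv.comp continuous_fst).clm_apply continuous_snd
  have hD : Measurable D := (hDc.enorm.measurable).pow_const 2
  have hrc : Continuous fun q : ((K → ℝ) × (K → ℝ)) × ℝ =>
      ContinuousLinearMap.rotation q.2 q.1 := by
    simp only [ContinuousLinearMap.rotation_apply]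
    fun_prop
  have step1 : ∀ p : (K → ℝ) × (K → ℝ), ‖F p.2 - F p.1‖ₑ ^ 2 ≤
      L * ∫⁻ θ in Set.Ioc 0 (Real.pi / 2), D (ContinuousLinearMap.rotation θ p) := by
    intro p
    rw [sub_eq_integral_rotation hF p]
    have h1 : Continuous fun θ : ℝ => ContinuousLinearMap.rotation θ p := by
      simp only [ContinuousLinearMap.rotation_apply]
      fun_prop
    exact enorm_intervalIntegral_sq_le (by positivity) (hDc.comp h1)
  have step2 : ∀ θ : ℝ, ∫⁻ p, D (ContinuousLinearMap.rotation θ p) ∂(μ.prod μ)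
      = ∫⁻ p, D p ∂(μ.prod μ) := by
    intro θ
    conv_rhs => rw [← IsGaussian.map_rotation_eq_self (μ := μ) integral_id_gaussPi θ]
    rw [lintegral_map hD (by fun_prop)]
  -- For fixed x the map y ↦ DF(x) y is linear, and its second moment is the sum of the squared
  -- coefficients.
  have step3 : ∫⁻ p, D p ∂(μ.prod μ)
      = ∫⁻ x, ENNReal.ofReal (∑ k, ‖fderiv ℝ F x (Pi.single k 1)‖ ^ 2) ∂μ := by
    rw [lintegral_prod _ hD.aemeasurable]
    refine lintegral_congr fun x => ?_
    rw [← integral_norm_sq_linear_gaussPi, ofReal_integral_eq_lintegral_ofReal]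
    · refine lintegral_congr fun y => ?_
      simp only [D]
      rw [ENNReal.ofReal_pow (norm_nonneg _), ofReal_norm]
    · have h2 : MemLp (fun y : K → ℝ => fderiv ℝ F x y) 2 μ := by
        have := (IsGaussian.memLp_id μ 2 (by simp)).continuousLinearMap_comp (fderiv ℝ F x)
        exact this
      exact h2.integrable_norm_pow (by norm_num)
    · exact ae_of_all _ fun y => by positivity
  calc ∫⁻ x, ‖F x - ∫ y, F y ∂μ‖ₑ ^ 2 ∂μ ≤ ∫⁻ x, ∫⁻ y, ‖F y - F x‖ₑ ^ 2 ∂μ ∂μ :=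
        lintegral_mono fun x => enorm_integral_sq_le hF x
    _ = ∫⁻ p, ‖F p.2 - F p.1‖ₑ ^ 2 ∂(μ.prod μ) := by
        rw [lintegral_prod]
        exact (((hF.continuous.comp continuous_snd).sub
          (hF.continuous.comp continuous_fst)).enorm.measurable.pow_const 2).aemeasurable
    _ ≤ ∫⁻ p, (L * ∫⁻ θ in Set.Ioc 0 (Real.pi / 2), D (ContinuousLinearMap.rotation θ p))
          ∂(μ.prod μ) := lintegral_mono step1
    _ = L * ∫⁻ θ in Set.Ioc 0 (Real.pi / 2), (∫⁻ p, D (ContinuousLinearMap.rotation θ p)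
          ∂(μ.prod μ)) := by
        have hm : Measurable fun q : ((K → ℝ) × (K → ℝ)) × ℝ =>
            D (ContinuousLinearMap.rotation q.2 q.1) := hD.comp hrc.measurable
        rw [lintegral_const_mul _ hm.lintegral_prod_right', lintegral_lintegral_swap hm.aemeasurable]
    _ = _ := by
        simp_rw [step2, step3]
        simp only [lintegral_const, MeasurableSet.univ, Measure.restrict_apply, Set.univ_inter,
          Real.volume_Ioc, sub_zero]
        rw [← hL]
        ring

/-- A Poincaré inequality for the standard Gaussian product measure. -/
lemma poincare_gaussPi {F : (K → ℝ) → ℂ} (hF : BddC1 F) :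
    ∫ x, ‖F x - ∫ y, F y ∂(gaussPi K)‖ ^ 2 ∂(gaussPi K) ≤
      (Real.pi / 2) ^ 2 * ∫ x, ∑ k, ‖fderiv ℝ F x (Pi.single k 1)‖ ^ 2 ∂(gaussPi K) := by
  have hc : Continuous fun x => ∑ k, ‖fderiv ℝ F x (Pi.single k 1)‖ ^ 2 :=
    continuous_finsetSum _ fun k _ =>
      ((hF.continuous_fderiv.clm_apply continuous_const).norm.pow 2)
  have h := poincare_gaussPi_lintegral hF
  have hi : Integrable (fun x => ∑ k, ‖fderiv ℝ F x (Pi.single k 1)‖ ^ 2) (gaussPi K) := by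
    refine integrable_finsetSum _ fun k _ => ?_
    obtain ⟨C, hC⟩ := hF.bdd_fderiv
    refine Integrable.of_bound ((hF.continuous_fderiv.clm_apply
      continuous_const).norm.pow 2).aestronglyMeasurable
      ((C * ‖(Pi.single k 1 : K → ℝ)‖) ^ 2) (ae_of_all _ fun x => ?_)
    rw [Real.norm_of_nonneg (by positivity)]
    gcongr
    exact (ContinuousLinearMap.le_opNorm _ _).trans (by gcongr; exact hC _)
  rw [← ofReal_integral_eq_lintegral_ofReal hi (ae_of_all _ fun x => by positivity)] at h
  have h2 : ∫ x, ‖F x - ∫ y, F y ∂(gaussPi K)‖ ^ 2 ∂(gaussPi K)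
      = (∫⁻ x, ‖F x - ∫ y, F y ∂(gaussPi K)‖ₑ ^ 2 ∂(gaussPi K)).toReal := by
    rw [integral_eq_lintegral_of_nonneg_ae (ae_of_all _ fun x => by positivity)
      (show Continuous fun x => ‖F x - ∫ y, F y ∂(gaussPi K)‖ ^ 2 from
        (hF.continuous.sub continuous_const).norm.pow 2).aestronglyMeasurable]
    congr 1
    refine lintegral_congr fun y => ?_
    rw [ENNReal.ofReal_pow (norm_nonneg _), ofReal_norm]
  rw [h2]
  refine ENNReal.toReal_le_of_le_ofReal ?_ (h.trans (le_of_eq ?_))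
  · exact mul_nonneg (by positivity) (integral_nonneg fun x => by positivity)
  · rw [ENNReal.ofReal_mul (by positivity), ENNReal.ofReal_pow (by positivity)]

/-- The variance of a complex function under the standard Gaussian product measure. -/
def gaussVar (F : (K → ℝ) → ℂ) : ℝ := ∫ x, ‖F x - ∫ y, F y ∂(gaussPi K)‖ ^ 2 ∂(gaussPi K)

lemma gaussVar_nonneg (F : (K → ℝ) → ℂ) : 0 ≤ gaussVar F := integral_nonneg fun _ => by positivity

/-- The 4 bounds (π/2)², using π ≤ 4. -/
lemma gaussVar_le {F : (K → ℝ) → ℂ} (hF : BddC1 F) {c : ℝ}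
    (h : ∀ x, ∑ k, ‖fderiv ℝ F x (Pi.single k 1)‖ ^ 2 ≤ c) : gaussVar F ≤ 4 * c := by
  have hc : 0 ≤ c := (Finset.sum_nonneg fun k _ => by positivity).trans (h 0)
  have h1 : ∫ x, ∑ k, ‖fderiv ℝ F x (Pi.single k 1)‖ ^ 2 ∂(gaussPi K) ≤ c := by
    refine (integral_mono_of_nonneg (ae_of_all _ fun x => Finset.sum_nonneg fun k _ => by positivity)
      (integrable_const c) (ae_of_all _ h)).trans ?_
    simp
  refine (poincare_gaussPi hF).trans (mul_le_mul ?_ h1 ?_ (by norm_num))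
  · nlinarith [Real.pi_le_four, Real.pi_pos]
  · exact integral_nonneg fun x => Finset.sum_nonneg fun k _ => by positivity

/-- Cauchy–Schwarz inequality for integrals of bounded continuous functions. -/
lemma norm_integral_mul_le {E : Type*} [TopologicalSpace E] [MeasurableSpace E]
    [OpensMeasurableSpace E] [SecondCountableTopology E] (μ : Measure E) [IsFiniteMeasure μ]
    {F G : E → ℂ} (hF : Continuous F) (hG : Continuous G) {C D : ℝ} (hC : ∀ x, ‖F x‖ ≤ C)
    (hD : ∀ x, ‖G x‖ ≤ D) :
    ‖∫ x, F x * G x ∂μ‖ ≤ √(∫ x, ‖F x‖ ^ 2 ∂μ) * √(∫ x, ‖G x‖ ^ 2 ∂μ) := by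
  have h := integral_mul_norm_le_Lp_mul_Lq (μ := μ) (f := F) (g := G) Real.HolderConjugate.two_two
    (by simpa using MemLp.of_bound hF.aestronglyMeasurable C (ae_of_all _ hC))
    (by simpa using MemLp.of_bound hG.aestronglyMeasurable D (ae_of_all _ hD))
  simp only [Real.rpow_two, ← Real.sqrt_eq_rpow] at h
  refine (norm_integral_le_integral_norm _).trans ?_
  simpa only [norm_mul] using h

/-- Centring one factor suffices: its integral vanishes, so the mean of the other factor can be
subtracted for free. Hence the expectation of a product with one centred factor is controlled by
standard deviations. -/
lemma norm_gaussCov_le {F G : (K → ℝ) → ℂ} (hF : BddC1 F) (hG : BddC1 G) :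
    ‖∫ x, F x * (G x - ∫ y, G y ∂(gaussPi K)) ∂(gaussPi K)‖ ≤ √(gaussVar F) * √(gaussVar G) := by
  have hF' := hF.sub (BddC1.const (∫ y, F y ∂(gaussPi K)))
  have hG' := hG.sub (BddC1.const (∫ y, G y ∂(gaussPi K)))
  obtain ⟨C, hC⟩ := hF'.bdd
  obtain ⟨D, hD⟩ := hG'.bdd
  have h := norm_integral_mul_le (gaussPi K) hF'.continuous hG'.continuous hC hD
  have h0 : ∫ x, (G x - ∫ y, G y ∂(gaussPi K)) ∂(gaussPi K) = 0 := by
    rw [integral_sub (hG.integrable _) (integrable_const _)]; simp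
  have h1 : ∫ x, F x * (G x - ∫ y, G y ∂(gaussPi K)) ∂(gaussPi K)
      = ∫ x, (F x - ∫ y, F y ∂(gaussPi K)) * (G x - ∫ y, G y ∂(gaussPi K)) ∂(gaussPi K) := by
    simp_rw [sub_mul _ _ (G _ - _)]
    rw [integral_sub ((hF.mul hG').integrable _) ((hG'.integrable _).const_mul _),
      integral_const_mul, h0, mul_zero, sub_zero]
  rw [h1]
  exact h

/-- Invariance of the standard Gaussian product measure under sign changes of the coordinates. -/
lemma integral_gaussPi_sign {V : Type*} [NormedAddCommGroup V] [NormedSpace ℝ V]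
    (ε : K → ℝ) (hε : ∀ k, ε k = 1 ∨ ε k = -1) {F : (K → ℝ) → V} (hF : Continuous F) :
    ∫ y, F (fun k => ε k * y k) ∂(gaussPi K) = ∫ y, F y ∂(gaussPi K) := by
  have hp : MeasurePreserving (fun (y : K → ℝ) k => ε k * y k) (gaussPi K) (gaussPi K) := by
    refine measurePreserving_pi (fun _ : K => gaussianReal 0 1) (fun _ : K => gaussianReal 0 1)
      (f := fun k t => ε k * t) fun k => ⟨by fun_prop, ?_⟩
    rcases hε k with h | h
    · rw [h, gaussianReal_map_const_mul]
      simp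
    · rw [h, gaussianReal_map_const_mul]
      congr 1
      · simp
      · ext; simp
  conv_rhs => rw [← hp.map_eq]
  rw [integral_map hp.measurable.aemeasurable hF.aestronglyMeasurable]

end Pi

/-! ### The Gaussian parametrization of the ensembles -/

section Positions

variable {n : ℕ}

lemma SymIdx.coe_neg (x : SymIdx n) : ((-x : SymIdx n) : ℤ) = -(x : ℤ) := rfl

lemma SymIdx.coe_ne_zero (x : SymIdx n) : (x : ℤ) ≠ 0 := (Finset.mem_erase.1 x.2).1

instance : InvolutiveNeg (SymIdx n) where
  neg_neg x := Subtype.ext (neg_neg (x : ℤ))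

lemma card_symIdx (n : ℕ) : Fintype.card (SymIdx n) = 2 * n := by
  rw [Fintype.card_coe, Finset.card_erase_of_mem (by simp), Int.card_Icc]
  omega

/-- The sign of an index. -/
def SymIdx.sgn (x : SymIdx n) : ℝ := if 0 < (x : ℤ) then 1 else -1

lemma SymIdx.sgn_neg (x : SymIdx n) : (-x).sgn = -x.sgn := by
  have := x.coe_ne_zero
  simp only [SymIdx.sgn, SymIdx.coe_neg]
  split_ifs <;> first | omega | simp

lemma SymIdx.sgn_mul_self (x : SymIdx n) : x.sgn * x.sgn = 1 := by
  simp only [SymIdx.sgn]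
  split_ifs <;> simp

lemma SymIdx.sgn_eq (x : SymIdx n) : x.sgn = 1 ∨ x.sgn = -1 := by
  simp only [SymIdx.sgn]
  split_ifs <;> simp

lemma SymIdx.neg_ne (x : SymIdx n) : -x ≠ x := by
  intro h
  have := congrArg (fun y : SymIdx n => (y : ℤ)) h
  have h0 := x.coe_ne_zero
  simp only [SymIdx.coe_neg] at this
  omega

namespace AddSymm

variable (s : AddSymm)

lemma act_act (p : SymIdx n × SymIdx n) : s.act (s.act p) = p := by
  cases s <;> simp [act]

lemma act_swap (p : SymIdx n × SymIdx n) : s.act p.swap = (s.act p).swap := by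
  cases s <;> simp [act]

lemma act_eq_iff (p q : SymIdx n × SymIdx n) : s.act p = q ↔ p = s.act q :=
  ⟨fun h => by rw [← h, act_act], fun h => by rw [h, act_act]⟩

/-- The additional symmetry identifies the entries at `p` and `q`. -/
def Same (p q : SymIdx n × SymIdx n) : Prop := q = p ∨ q = s.act p

/-- Hermitian symmetry and the additional symmetry make the entries at `p` and `q` conjugate. -/
def Opp (p q : SymIdx n × SymIdx n) : Prop := q = p.swap ∨ q = s.act p.swap

variable {s}

/-- `Same` and `Opp` compose like the signs + and -; this lemma and the next three are the
multiplication table. -/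
lemma Same.same_iff {p q r : SymIdx n × SymIdx n} (h : s.Same p q) :
    s.Same q r ↔ s.Same p r := by
  rcases h with rfl | rfl
  · rfl
  · simp only [Same, act_act]; exact Or.comm

lemma Same.opp_iff {p q r : SymIdx n × SymIdx n} (h : s.Same p q) :
    s.Opp q r ↔ s.Opp p r := by
  rcases h with rfl | rfl
  · rfl
  · simp only [Opp, ← act_swap, act_act]; exact Or.comm

lemma Opp.opp_iff {p q r : SymIdx n × SymIdx n} (h : s.Opp p q) :
    s.Opp q r ↔ s.Same p r := by
  rcases h with rfl | rfl
  · simp only [Opp, Same, Prod.swap_swap]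
  · simp only [Opp, Same, ← act_swap, act_act, Prod.swap_swap]; exact Or.comm

lemma Opp.same_iff {p q r : SymIdx n × SymIdx n} (h : s.Opp p q) :
    s.Same q r ↔ s.Opp p r := by
  rcases h with rfl | rfl
  · rfl
  · simp only [Opp, Same, act_act]; exact Or.comm

lemma forcedReal_iff_opp (p : SymIdx n × SymIdx n) : s.ForcedReal p.1 p.2 ↔ s.Opp p p := by
  simp only [ForcedReal, Opp]
  constructor
  · rintro (h | h)
    · exact Or.inl h.symm
    · refine Or.inr ?_
      rw [eq_comm, act_eq_iff]
      exact h
  · rintro (h | h)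
    · exact Or.inl h.symm
    · refine Or.inr ?_
      rw [eq_comm, act_eq_iff] at h
      exact h

lemma Same.forced {p q : SymIdx n × SymIdx n} (h : s.Same p q) (h' : s.Opp p q) :
    s.ForcedReal p.1 p.2 := by
  rw [forcedReal_iff_opp, ← h.opp_iff, h'.opp_iff]
  exact Or.inl rfl

lemma same_iff_opp_of_forced {p q : SymIdx n × SymIdx n} (h : s.ForcedReal p.1 p.2) :
    s.Same p q ↔ s.Opp p q := by
  rw [forcedReal_iff_opp] at h
  exact h.opp_iff.symm

-- The sector |a| ≤ b, its transpose and the negatives of both cover all positions. Whether a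
-- negated position is `Same` or `Opp` is the only place where the two symmetries differ.
variable (s) in
lemma exists_freePos (q : SymIdx n × SymIdx n) :
    ∃ p : FreePos n, s.Same p.1 q ∨ s.Opp p.1 q := by
  have key : |(q.1 : ℤ)| ≤ q.2 ∨ |(q.2 : ℤ)| ≤ q.1 ∨ |((-q.1 : SymIdx n) : ℤ)| ≤ (-q.2 : SymIdx n) ∨
      |((-q.2 : SymIdx n) : ℤ)| ≤ (-q.1 : SymIdx n) := by
    simp only [SymIdx.coe_neg, abs_neg]
    rcases abs_cases (q.1 : ℤ) with h | h <;> rcases abs_cases (q.2 : ℤ) with h' | h' <;> omega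
  rcases key with h | h | h | h
  · exact ⟨⟨q, h⟩, Or.inl (Or.inl rfl)⟩
  · exact ⟨⟨q.swap, h⟩, Or.inr (Or.inl (by simp))⟩
  · refine ⟨⟨(-q.1, -q.2), h⟩, ?_⟩
    cases s
    · exact Or.inr (Or.inr (by simp [act]))
    · exact Or.inl (Or.inr (by simp [act]))
  · refine ⟨⟨(-q.2, -q.1), h⟩, ?_⟩
    cases s
    · exact Or.inl (Or.inr (by simp [act]))
    · exact Or.inr (Or.inr (by simp [act]))

/-- With either symmetry the orbit of (a, b) is {(a, b), (b, a), (-a, -b), (-b, -a)}, and the sector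
|a| ≤ b meets it once. -/
lemma freePos_unique {p p' : FreePos n} (h : s.Same p.1 p'.1 ∨ s.Opp p.1 p'.1) : p = p' := by
  obtain ⟨⟨a, b⟩, hp⟩ := p
  obtain ⟨⟨c, d⟩, hp'⟩ := p'
  simp only at hp hp'
  have ha := a.coe_ne_zero
  have hb := b.coe_ne_zero
  have key : ((c : ℤ) = a ∧ (d : ℤ) = b) ∨ ((c : ℤ) = b ∧ (d : ℤ) = a) ∨
      ((c : ℤ) = -a ∧ (d : ℤ) = -b) ∨ ((c : ℤ) = -b ∧ (d : ℤ) = -a) := by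
    have hc : ∀ x y : SymIdx n, x = y → (x : ℤ) = y := fun _ _ h => congrArg _ h
    cases s <;> simp only [Same, Opp, act, Prod.swap_prod_mk, Prod.mk.injEq] at h <;>
      rcases h with (⟨h1, h2⟩ | ⟨h1, h2⟩) | (⟨h1, h2⟩ | ⟨h1, h2⟩) <;>
      · have h1' := hc _ _ h1
        have h2' := hc _ _ h2
        try simp only [SymIdx.coe_neg] at h1' h2'
        omega
  have : (a : ℤ) = c ∧ (b : ℤ) = d := by
    rcases abs_cases (a : ℤ) with h | h <;> rcases abs_cases (c : ℤ) with h' | h' <;> omega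
  exact Subtype.ext (Prod.ext (Subtype.ext this.1) (Subtype.ext this.2))

lemma same_or_opp_trans {p p' q : SymIdx n × SymIdx n} (h : s.Same p q ∨ s.Opp p q)
    (h' : s.Same p' q ∨ s.Opp p' q) : s.Same p p' ∨ s.Opp p p' := by
  have symm : s.Same q p' ∨ s.Opp q p' := by
    rcases h' with h' | h'
    · exact Or.inl (h'.same_iff.2 (Or.inl rfl))
    · exact Or.inr (h'.opp_iff.2 (Or.inl rfl))
  rcases h with h | h
  · exact symm.imp h.same_iff.1 h.opp_iff.1
  · exact (symm.imp h.same_iff.1 h.opp_iff.1).symm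

open scoped Classical in
/-- The coefficient of the real (`b = true`) or imaginary (`b = false`) part of the entry at `p`
in the entry at `q`. -/
def coeff (s : AddSymm) (p : SymIdx n × SymIdx n) (b : Bool) (q : SymIdx n × SymIdx n) : ℝ :=
  if s.Same p q then 1 else if s.Opp p q then (if b then 1 else -1) else 0

open scoped Classical in
/-- The variance of the real or imaginary part of `√(2n) W p`. -/
def entryVar (s : AddSymm) (p : SymIdx n × SymIdx n) (b : Bool) : ℝ≥0 :=
  if s.ForcedReal p.1 p.2 then (if b then 1 else 0) else 1 / 2

-- This is 2n E[W_q W_r]. The imaginary part enters with i² = -1, so the halves from the real and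
-- imaginary parts add up at opposite positions and cancel at equivalent ones. At a forced real
-- position both notions agree and the real part alone contributes 1.
open scoped Classical in
lemma sum_entryVar_coeff (s : AddSymm) (q r : SymIdx n × SymIdx n) :
    ∑ p : FreePos n, ((s.entryVar p.1 true : ℝ) * (s.coeff p.1 true q * s.coeff p.1 true r)
      - (s.entryVar p.1 false : ℝ) * (s.coeff p.1 false q * s.coeff p.1 false r))
      = if s.Opp q r then 1 else 0 := by
  obtain ⟨p, hp⟩ := exists_freePos s q
  rw [Fintype.sum_eq_single p]
  · by_cases hf : s.ForcedReal p.1.1 p.1.2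
    · have h1 := fun q => same_iff_opp_of_forced (q := q) hf
      have hp' : s.Same p.1 q := hp.elim id (h1 q).2
      simp only [entryVar, coeff, hf, hp'.opp_iff, ← h1]
      by_cases hr : s.Same p.1 r <;> simp [hp', hr]
    · have hex : ∀ q, s.Same p.1 q → ¬ s.Opp p.1 q := fun q h h' => hf (h.forced h')
      rcases hp with hp | hp
      · rw [hp.opp_iff]
        by_cases hr : s.Same p.1 r
        · simp [entryVar, coeff, hf, hp, hr, hex r hr]
        · by_cases hr' : s.Opp p.1 r <;> simp [entryVar, coeff, hf, hp, hr, hr']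
          norm_num
      · have hp0 : ¬ s.Same p.1 q := fun h => hex q h hp
        rw [hp.opp_iff]
        by_cases hr : s.Same p.1 r
        · simp [entryVar, coeff, hf, hp, hp0, hr]
          norm_num
        · by_cases hr' : s.Opp p.1 r <;> simp [entryVar, coeff, hf, hp, hp0, hr, hr']
  · intro p' hp'
    have h1 : ¬ (s.Same p'.1 q ∨ s.Opp p'.1 q) := fun h =>
      hp' (freePos_unique (same_or_opp_trans h hp))
    have h2 := not_or.1 h1
    simp [coeff, h2.1, h2.2]

lemma coeff_act (s : AddSymm) (p : SymIdx n × SymIdx n) (b : Bool) (q : SymIdx n × SymIdx n) :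
    s.coeff p b (s.act q) = s.coeff p b q := by
  have h1 : s.Same p (s.act q) ↔ s.Same p q := by
    simp only [Same, act_eq_iff, act_act]; exact Or.comm
  have h2 : s.Opp p (s.act q) ↔ s.Opp p q := by
    simp only [Opp, act_eq_iff, act_act]; exact Or.comm
  unfold coeff
  split_ifs <;> tauto

lemma opp_swap {p q : SymIdx n × SymIdx n} : s.Opp p q.swap ↔ s.Same p q := by
  simp only [Opp, Same, Prod.swap_inj, act_swap]

lemma same_swap {p q : SymIdx n × SymIdx n} : s.Same p q.swap ↔ s.Opp p q := by
  rw [← opp_swap, Prod.swap_swap]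

lemma coeff_true_swap (s : AddSymm) (p q : SymIdx n × SymIdx n) :
    s.coeff p true q.swap = s.coeff p true q := by
  have h1 := opp_swap (s := s) (p := p) (q := q)
  have h2 := same_swap (s := s) (p := p) (q := q)
  unfold coeff
  split_ifs <;> tauto

lemma coeff_false_swap (s : AddSymm) {p : SymIdx n × SymIdx n} (hp : ¬ s.ForcedReal p.1 p.2)
    (q : SymIdx n × SymIdx n) : s.coeff p false q.swap = -s.coeff p false q := by
  have hex : s.Same p q → ¬ s.Opp p q := fun h h' => hp (h.forced h')
  have h1 := opp_swap (s := s) (p := p) (q := q)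
  have h2 := same_swap (s := s) (p := p) (q := q)
  unfold coeff
  split_ifs <;> first | tauto | simp

/-- The symmetries permute the two indices or negate both, so the product of their signs is constant
on equivalence classes. -/
lemma coeff_sgn (s : AddSymm) (p : SymIdx n × SymIdx n) (b : Bool) (q : SymIdx n × SymIdx n) :
    q.1.sgn * q.2.sgn * s.coeff p b q = p.1.sgn * p.2.sgn * s.coeff p b q := by
  by_cases h : s.Same p q ∨ s.Opp p q
  · congr 1
    obtain ⟨a, b⟩ := p
    cases s <;> rcases h with (rfl | rfl) | (rfl | rfl) <;>
      simp [act, SymIdx.sgn_neg, mul_comm]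
  · have h2 := not_or.1 h
    simp [coeff, h2.1, h2.2]

/-- The matrices `B k` with `W = ∑ k, Y k • B k`, where the `Y k` are independent standard Gaussian
variables. -/
def basisMat (s : AddSymm) (n : ℕ) (k : FreePos n × Bool) : Matrix (SymIdx n) (SymIdx n) ℂ :=
  Matrix.of fun x y => ((√(2 * n))⁻¹ * √(s.entryVar k.1.1 k.2) * s.coeff k.1.1 k.2 (x, y) : ℝ) *
    (if k.2 then 1 else Complex.I)

/-- The left side is E[W_xy W_zt], the coefficients Y_k being independent with unit variance. -/
lemma sum_basisMat (s : AddSymm) (n : ℕ) (x y z t : SymIdx n) :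
    ∑ k, s.basisMat n k x y * s.basisMat n k z t =
      (2 * n : ℂ)⁻¹ * (open scoped Classical in if s.Opp (x, y) (z, t) then 1 else 0) := by
  classical
  have h := sum_entryVar_coeff s (x, y) (z, t)
  rw [Fintype.sum_prod_type]
  have h2 : (2 * n : ℂ)⁻¹ * (if s.Opp (x, y) (z, t) then 1 else 0)
      = (((2 * n : ℝ)⁻¹ * (if s.Opp (x, y) (z, t) then 1 else 0) : ℝ) : ℂ) := by
    split_ifs <;> simp
  rw [h2, ← h, Finset.mul_sum, Complex.ofReal_sum]
  refine Finset.sum_congr rfl fun p _ => ?_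
  rw [Fintype.sum_bool]
  simp only [basisMat, Matrix.of_apply]
  have e1 : (√(2 * n : ℝ))⁻¹ * (√(2 * n : ℝ))⁻¹ = (2 * n : ℝ)⁻¹ := by
    rw [← mul_inv, Real.mul_self_sqrt (by positivity)]
  have e2 : ∀ b, ((√(s.entryVar p.1 b : ℝ) : ℝ) : ℂ) * ((√(s.entryVar p.1 b : ℝ) : ℝ) : ℂ)
      = ((s.entryVar p.1 b : ℝ) : ℂ) := fun b => by
    rw [← Complex.ofReal_mul, Real.mul_self_sqrt (NNReal.coe_nonneg _)]
  rw [← e1]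
  push_cast
  linear_combination ((√(2 * n : ℝ) : ℂ))⁻¹ ^ 2 * (√(s.entryVar p.1 false : ℝ) : ℂ) ^ 2 *
    (s.coeff p.1 false (x, y) : ℂ) * (s.coeff p.1 false (z, t) : ℂ) * Complex.I_sq +
    ((√(2 * n : ℝ) : ℂ))⁻¹ ^ 2 * (s.coeff p.1 true (x, y) : ℂ) * (s.coeff p.1 true (z, t) : ℂ) *
      e2 true - ((√(2 * n : ℝ) : ℂ))⁻¹ ^ 2 *
      (s.coeff p.1 false (x, y) : ℂ) * (s.coeff p.1 false (z, t) : ℂ) * e2 false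

lemma basisMat_isHermitian (s : AddSymm) (n : ℕ) (k : FreePos n × Bool) :
    (s.basisMat n k).IsHermitian := by
  obtain ⟨p, b⟩ := k
  refine Matrix.IsHermitian.ext fun x y => ?_
  simp only [basisMat, Matrix.of_apply, star_mul', Complex.star_def, Complex.conj_ofReal]
  cases b
  · by_cases hf : s.ForcedReal p.1.1 p.1.2
    · simp [entryVar, hf]
    · have := coeff_false_swap s hf (x, y)
      simp only [Prod.swap_prod_mk] at this
      rw [this]
      simp
  · have := coeff_true_swap s p.1 (x, y)
    simp only [Prod.swap_prod_mk] at this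
    rw [this]
    simp

lemma basisMat_act (s : AddSymm) (n : ℕ) (k : FreePos n × Bool) (x y : SymIdx n) :
    s.basisMat n k (s.act (x, y)).1 (s.act (x, y)).2 = s.basisMat n k x y := by
  simp only [basisMat, Matrix.of_apply, Prod.mk.eta, coeff_act]

/-- The factor of `basisMat` under conjugation by the diagonal matrix of signs. -/
def basisSign {n : ℕ} (k : FreePos n × Bool) : ℝ := k.1.1.1.sgn * k.1.1.2.sgn

lemma basisSign_eq (k : FreePos n × Bool) : basisSign k = 1 ∨ basisSign k = -1 := by
  rcases k.1.1.1.sgn_eq with h | h <;> rcases k.1.1.2.sgn_eq with h' | h' <;>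
    simp [basisSign, h, h']

lemma basisMat_sgn (s : AddSymm) (n : ℕ) (k : FreePos n × Bool) (x y : SymIdx n) :
    (x.sgn * y.sgn : ℝ) * s.basisMat n k x y = (basisSign k : ℝ) * s.basisMat n k x y := by
  have h := coeff_sgn s k.1.1 k.2 (x, y)
  simp only [basisMat, Matrix.of_apply, basisSign]
  have h' : ∀ a b : ℝ, ((x.sgn * y.sgn : ℝ) : ℂ) * (((a * b * s.coeff k.1.1 k.2 (x, y) : ℝ) : ℂ))
    = ((k.1.1.1.sgn * k.1.1.2.sgn : ℝ) : ℂ) * (((a * b * s.coeff k.1.1 k.2 (x, y) : ℝ) : ℂ)) := by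
    intro a b
    norm_cast
    linear_combination (a * b) * h
  rw [← mul_assoc, h', mul_assoc]

end AddSymm

end Positions

/-! ### Covariance contractions -/

/-- The squared Hilbert–Schmidt norm. -/
def hsNormSq {ι : Type*} [Fintype ι] (M : Matrix ι ι ℂ) : ℝ := ∑ x, ∑ y, ‖M x y‖ ^ 2

lemma hsNormSq_nonneg {ι : Type*} [Fintype ι] (M : Matrix ι ι ℂ) : 0 ≤ hsNormSq M := by
  unfold hsNormSq; positivity

namespace AddSymm

variable {n : ℕ} (s : AddSymm)

lemma trace_mul_eq_sum (B P : Matrix (SymIdx n) (SymIdx n) ℂ) :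
    (B * P).trace = ∑ q : SymIdx n × SymIdx n, B q.1 q.2 * P q.2 q.1 := by
  simp only [Matrix.trace, Matrix.diag, Matrix.mul_apply, Fintype.sum_prod_type]

-- The positions opposite to q are its transpose and the image of its transpose. They coincide
-- exactly when `s.act q = q`; the last sum removes this double count.
open scoped Classical in
lemma sum_basisMat_mul (X : SymIdx n × SymIdx n → SymIdx n × SymIdx n → ℂ) :
    ∑ k, ∑ q : SymIdx n × SymIdx n, ∑ r : SymIdx n × SymIdx n,
        s.basisMat n k q.1 q.2 * s.basisMat n k r.1 r.2 * X q r =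
      (2 * n : ℂ)⁻¹ * (∑ q, X q q.swap + ∑ q, X q (s.act q.swap)
        - ∑ q, if s.act q = q then X q q.swap else 0) := by
  rw [Finset.sum_comm]
  simp_rw [Finset.sum_comm (s := (Finset.univ : Finset (FreePos n × Bool))), ← Finset.sum_mul,
    sum_basisMat]
  rw [← Finset.sum_add_distrib, ← Finset.sum_sub_distrib, Finset.mul_sum]
  refine Finset.sum_congr rfl fun q _ => ?_
  have h : ∀ r, (2 * n : ℂ)⁻¹ * (if s.Opp (q.1, q.2) (r.1, r.2) then 1 else 0) * X q r
      = (2 * n : ℂ)⁻¹ * ((if r = q.swap then X q r else 0) + (if r = s.act q.swap then X q r else 0)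
        - if r = q.swap then (if s.act q = q then X q r else 0) else 0) := by
    intro r
    rw [mul_assoc]
    congr 1
    simp only [Prod.mk.eta]
    by_cases h1 : r = q.swap
    · by_cases h3 : s.act q = q
      · have h2 : r = s.act q.swap := by rw [act_swap, h3, h1]
        rw [if_pos (show s.Opp q r from Or.inl h1), if_pos h1, if_pos h2, if_pos h1, if_pos h3]
        ring
      · have h2 : r ≠ s.act q.swap := by
          rw [act_swap, h1]
          exact fun h => h3 (Prod.swap_injective h).symm
        rw [if_pos (show s.Opp q r from Or.inl h1), if_pos h1, if_neg h2, if_pos h1, if_neg h3]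
        ring
    · by_cases h2 : r = s.act q.swap
      · rw [if_pos (show s.Opp q r from Or.inr h2), if_neg h1, if_pos h2, if_neg h1]
        ring
      · rw [if_neg (show ¬ s.Opp q r from not_or.2 ⟨h1, h2⟩), if_neg h1, if_neg h2, if_neg h1]
        ring
  simp_rw [h]
  rw [← Finset.mul_sum, Finset.sum_sub_distrib, Finset.sum_add_distrib]
  simp

open scoped Classical in
/-- The deviation of the contraction `∑ k, tr (B k * P * B k * R)` from its leading term. -/
def contractErr (P R : Matrix (SymIdx n) (SymIdx n) ℂ) : ℂ :=
  ∑ q : SymIdx n × SymIdx n, P q.2 (s.act q.swap).1 * R (s.act q.swap).2 q.1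
    - ∑ q : SymIdx n × SymIdx n, if s.act q = q then P q.2 q.2 * R q.1 q.1 else 0

/-- The pairing of q with its transpose gives the GUE term tr P · tr R; the second pairing and the
double count form `contractErr`. -/
lemma sum_trace_basisMat_mul_mul (P R : Matrix (SymIdx n) (SymIdx n) ℂ) :
    ∑ k, (s.basisMat n k * P * s.basisMat n k * R).trace =
      (2 * n : ℂ)⁻¹ * (P.trace * R.trace + s.contractErr P R) := by
  classical
  have h := s.sum_basisMat_mul (fun q r => P q.2 r.1 * R r.2 q.1)
  have h1 : ∀ B : Matrix (SymIdx n) (SymIdx n) ℂ, (B * P * B * R).trace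
      = ∑ q : SymIdx n × SymIdx n, ∑ r : SymIdx n × SymIdx n,
        B q.1 q.2 * B r.1 r.2 * (P q.2 r.1 * R r.2 q.1) := by
    intro B
    rw [mul_assoc, mul_assoc, trace_mul_eq_sum]
    refine Finset.sum_congr rfl fun q _ => ?_
    rw [← mul_assoc, Matrix.mul_apply, Fintype.sum_prod_type, Finset.sum_comm, Finset.mul_sum]
    refine Finset.sum_congr rfl fun d _ => ?_
    rw [Matrix.mul_apply, Finset.sum_mul, Finset.mul_sum]
    exact Finset.sum_congr rfl fun c _ => by ring
  simp_rw [h1]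
  rw [h]
  have h2 : ∑ q : SymIdx n × SymIdx n, P q.2 q.2 * R q.1 q.1 = P.trace * R.trace := by
    rw [Fintype.sum_prod_type, Matrix.trace, Matrix.trace, Finset.sum_mul_sum, Finset.sum_comm]
    rfl
  rw [← h2]
  simp only [contractErr, Prod.fst_swap, Prod.snd_swap]
  ring

open scoped Classical in
/-- The deviation of the contraction `∑ k, tr (B k * P) * tr (B k * R)` from its leading term. -/
def contractErr' (P R : Matrix (SymIdx n) (SymIdx n) ℂ) : ℂ :=
  ∑ q : SymIdx n × SymIdx n, if s.act q = q then P q.2 q.1 * R q.1 q.2 else 0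

/-- Invariance of a matrix under the additional symmetry. -/
def Inv (M : Matrix (SymIdx n) (SymIdx n) ℂ) : Prop :=
  ∀ x y, M (s.act (x, y)).1 (s.act (x, y)).2 = M x y


lemma sum_trace_mul_trace (P R : Matrix (SymIdx n) (SymIdx n) ℂ) :
    ∑ k, (s.basisMat n k * P).trace * (s.basisMat n k * R).trace =
      (2 * n : ℂ)⁻¹ * ((P * R).trace
        + ∑ q : SymIdx n × SymIdx n, P q.2 q.1 * R (s.act q).1 (s.act q).2
        - s.contractErr' P R) := by
  classical
  have h := s.sum_basisMat_mul (fun q r => P q.2 q.1 * R r.2 r.1)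
  have h1 : ∀ k, (s.basisMat n k * P).trace * (s.basisMat n k * R).trace
      = ∑ q : SymIdx n × SymIdx n, ∑ r : SymIdx n × SymIdx n,
        s.basisMat n k q.1 q.2 * s.basisMat n k r.1 r.2 * (P q.2 q.1 * R r.2 r.1) := by
    intro k
    rw [trace_mul_eq_sum, trace_mul_eq_sum, Finset.sum_mul_sum]
    refine Finset.sum_congr rfl fun q _ => Finset.sum_congr rfl fun r _ => by ring
  simp_rw [h1]
  rw [h, Matrix.trace_mul_comm P R, trace_mul_eq_sum]
  simp only [act_swap, Prod.fst_swap, Prod.snd_swap, contractErr', mul_comm (R _ _)]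

/-- Source of the factor 2 in `goeS`: invariance of R makes the second pairing equal to the first.
-/
lemma sum_trace_mul_trace_of_inv (P : Matrix (SymIdx n) (SymIdx n) ℂ)
    {R : Matrix (SymIdx n) (SymIdx n) ℂ} (hR : s.Inv R) :
    ∑ k, (s.basisMat n k * P).trace * (s.basisMat n k * R).trace =
      (2 * n : ℂ)⁻¹ * (2 * (P * R).trace - s.contractErr' P R) := by
  rw [sum_trace_mul_trace]
  have : ∑ q : SymIdx n × SymIdx n, P q.2 q.1 * R (s.act q).1 (s.act q).2 = (P * R).trace := by
    rw [Matrix.trace_mul_comm, trace_mul_eq_sum]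
    refine Finset.sum_congr rfl fun q _ => ?_
    rw [mul_comm, ← hR q.1 q.2]
  rw [this]
  ring

lemma sum_norm_sq_swap (M : Matrix (SymIdx n) (SymIdx n) ℂ) :
    ∑ q : SymIdx n × SymIdx n, ‖M q.2 q.1‖ ^ 2 = hsNormSq M := by
  rw [Fintype.sum_prod_type, Finset.sum_comm]
  rfl

lemma sum_norm_sq_act (M : Matrix (SymIdx n) (SymIdx n) ℂ) :
    ∑ q : SymIdx n × SymIdx n, ‖M (s.act q).1 (s.act q).2‖ ^ 2 = hsNormSq M := by
  have h : ∑ q : SymIdx n × SymIdx n, ‖M (s.act q).1 (s.act q).2‖ ^ 2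
      = ∑ q : SymIdx n × SymIdx n, ‖M q.1 q.2‖ ^ 2 :=
    Equiv.sum_comp (Function.Involutive.toPerm s.act s.act_act) (fun q => ‖M q.1 q.2‖ ^ 2)
  rw [h, Fintype.sum_prod_type]
  rfl

/-- The covariance of the ensemble is bounded by twice that of the Gaussian unitary ensemble. -/
lemma sum_norm_trace_sq_le (M : Matrix (SymIdx n) (SymIdx n) ℂ) :
    ∑ k, ‖(s.basisMat n k * M).trace‖ ^ 2 ≤ (2 * n : ℝ)⁻¹ * (2 * hsNormSq M) := by
  classical
  have h := s.sum_trace_mul_trace M M.conjTranspose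
  have h1 : ∀ k, (s.basisMat n k * M).trace * (s.basisMat n k * M.conjTranspose).trace
      = ((‖(s.basisMat n k * M).trace‖ ^ 2 : ℝ) : ℂ) := by
    intro k
    have : (s.basisMat n k * M.conjTranspose).trace = star (s.basisMat n k * M).trace := by
      rw [← Matrix.trace_conjTranspose, Matrix.conjTranspose_mul, (s.basisMat_isHermitian n k).eq,
        Matrix.trace_mul_comm]
    rw [this, Complex.star_def, Complex.mul_conj, Complex.normSq_eq_norm_sq]
  simp_rw [h1] at h
  rw [← Complex.ofReal_sum] at h
  have h2 := congrArg Complex.re h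
  rw [Complex.ofReal_re, show (2 * n : ℂ)⁻¹ = ((2 * n : ℝ)⁻¹ : ℝ) by push_cast; rfl,
    Complex.re_ofReal_mul] at h2
  rw [h2]
  gcongr
  rw [Complex.sub_re, Complex.add_re]
  have e1 : (M * M.conjTranspose).trace.re = hsNormSq M := by
    rw [Matrix.trace_mul_comm, trace_mul_eq_sum, ← sum_norm_sq_swap, Complex.re_sum]
    refine Finset.sum_congr rfl fun q _ => ?_
    rw [Matrix.conjTranspose_apply, mul_comm, Complex.star_def, Complex.mul_conj,
      Complex.ofReal_re, Complex.normSq_eq_norm_sq]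
  -- The second pairing is at most the first by Cauchy–Schwarz; the double count is a subtracted
  -- nonnegative term.
  have e2 : (∑ q : SymIdx n × SymIdx n,
      M q.2 q.1 * M.conjTranspose (s.act q).1 (s.act q).2).re ≤ hsNormSq M := by
    have h3 : ∀ q : SymIdx n × SymIdx n, (M q.2 q.1 * M.conjTranspose (s.act q).1 (s.act q).2).re
        ≤ (‖M q.2 q.1‖ ^ 2 + ‖M.conjTranspose (s.act q).1 (s.act q).2‖ ^ 2) / 2 := by
      intro q
      refine (Complex.re_le_norm _).trans ?_
      rw [norm_mul]
      nlinarith [sq_nonneg (‖M q.2 q.1‖ - ‖M.conjTranspose (s.act q).1 (s.act q).2‖)]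
    rw [Complex.re_sum]
    refine (Finset.sum_le_sum fun q _ => h3 q).trans (le_of_eq ?_)
    rw [← Finset.sum_div, Finset.sum_add_distrib, sum_norm_sq_swap, sum_norm_sq_act]
    have : hsNormSq M.conjTranspose = hsNormSq M := by
      unfold hsNormSq
      rw [Finset.sum_comm]
      simp
    rw [this]
    ring
  have e3 : 0 ≤ (s.contractErr' M M.conjTranspose).re := by
    rw [contractErr', Complex.re_sum]
    refine Finset.sum_nonneg fun q _ => ?_
    split_ifs
    · rw [Matrix.conjTranspose_apply, Complex.star_def, Complex.mul_conj, Complex.ofReal_re]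
      exact Complex.normSq_nonneg _
    · simp
  linarith

/-! Explicit forms of the error terms -/

/-- No position is fixed, so nothing is counted twice, and the second pairing decouples into two
antidiagonal sums. Each is a sum of 2n entries, so a bound on the product must come from its
expectation. -/
lemma contractErr_central (P R : Matrix (SymIdx n) (SymIdx n) ℂ) :
    central.contractErr P R = (∑ x, P x (-x)) * ∑ x, R x (-x) := by
  classical
  have h0 : ∀ q : SymIdx n × SymIdx n, central.act q ≠ q := fun q h =>
    q.1.neg_ne (congrArg Prod.fst h)
  rw [contractErr, Finset.sum_eq_zero (fun q _ => if_neg (h0 q)), sub_zero]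
  simp only [act, Prod.fst_swap, Prod.snd_swap]
  rw [Fintype.sum_prod_type, Finset.sum_comm, Finset.sum_mul_sum]
  refine Finset.sum_congr rfl fun x _ => ?_
  rw [← Equiv.sum_comp (Equiv.neg (SymIdx n))]
  simp

lemma contractErr'_central (P R : Matrix (SymIdx n) (SymIdx n) ℂ) :
    central.contractErr' P R = 0 := by
  have h0 : ∀ q : SymIdx n × SymIdx n, central.act q ≠ q := fun q h =>
    q.1.neg_ne (congrArg Prod.fst h)
  simp [contractErr', h0]

lemma sum_act_flip_eq (f : SymIdx n × SymIdx n → ℂ) :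
    (open scoped Classical in ∑ q, if flip.act q = q then f q else 0) = ∑ x, f (x, -x) := by
  classical
  rw [Fintype.sum_prod_type]
  refine Finset.sum_congr rfl fun x _ => ?_
  rw [Fintype.sum_eq_single (-x)]
  · rw [if_pos]
    simp [act]
  · intro y hy
    rw [if_neg]
    intro h
    apply hy
    have := congrArg Prod.snd h
    exact this.symm

/-- Invariance of R turns the second pairing into a matrix product, so for bounded P and R the error
is O(n) pointwise. The diagonal sum is the double count at the antidiagonal positions. -/
lemma contractErr_flip (P : Matrix (SymIdx n) (SymIdx n) ℂ)
    {R : Matrix (SymIdx n) (SymIdx n) ℂ} (hR : flip.Inv R) :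
    flip.contractErr P R = (P * R).trace - ∑ x, P x x * R x x := by
  classical
  rw [contractErr, sum_act_flip_eq]
  congr 1
  · rw [trace_mul_eq_sum, Fintype.sum_prod_type, Fintype.sum_prod_type, Finset.sum_comm]
    refine Finset.sum_congr rfl fun x _ => ?_
    rw [← Equiv.sum_comp (Equiv.neg (SymIdx n))]
    refine Finset.sum_congr rfl fun y _ => ?_
    have := hR (-x) (-y)
    simp only [act, Prod.swap_prod_mk, neg_neg, Equiv.neg_apply] at this ⊢
    rw [this]
  · rw [← Equiv.sum_comp (Equiv.neg (SymIdx n))]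
    refine Finset.sum_congr rfl fun x _ => ?_
    have := hR x x
    simp only [act, neg_neg, Equiv.neg_apply] at this ⊢
    rw [this]

lemma contractErr'_flip (P R : Matrix (SymIdx n) (SymIdx n) ℂ) :
    flip.contractErr' P R = ∑ x, P (-x) x * R x (-x) := by
  classical
  rw [contractErr', sum_act_flip_eq]

end AddSymm

/-! ### Resolvents -/

section Resolvent

open scoped Matrix.Norms.L2Operator

variable {ι : Type*} [Fintype ι] [DecidableEq ι]

/-- The resolvent `(A - z)⁻¹` of a matrix. -/
def resolv (A : Matrix ι ι ℂ) (z : ℂ) : Matrix ι ι ℂ := (A - z • 1)⁻¹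

lemma ofReal_sub_ne_zero {z : ℂ} (hz : 0 < z.im) (l : ℝ) : (l : ℂ) - z ≠ 0 := by
  intro h
  have := congrArg Complex.im h
  simp at this
  exact hz.ne' this

lemma norm_inv_ofReal_sub_le {z : ℂ} (hz : 0 < z.im) (l : ℝ) : ‖((l : ℂ) - z)⁻¹‖ ≤ z.im⁻¹ := by
  rw [norm_inv]
  refine inv_anti₀ hz ?_
  calc z.im = |((l : ℂ) - z).im| := by simp [abs_of_pos hz]
    _ ≤ _ := Complex.abs_im_le_norm _

lemma sub_smul_one_eq {A : Matrix ι ι ℂ} (hA : A.IsHermitian) (z : ℂ) :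
    A - z • 1 = (hA.eigenvectorUnitary : Matrix ι ι ℂ) *
      Matrix.diagonal (fun i => (hA.eigenvalues i : ℂ) - z) *
      star (hA.eigenvectorUnitary : Matrix ι ι ℂ) := by
  have h : Matrix.diagonal (fun i => (hA.eigenvalues i : ℂ) - z)
      = Matrix.diagonal (RCLike.ofReal ∘ hA.eigenvalues) - z • (1 : Matrix ι ι ℂ) := by
    rw [← Matrix.diagonal_one, ← Matrix.diagonal_smul, Matrix.diagonal_sub]
    congr 1
    ext i
    simp
  conv_lhs => rw [hA.spectral_theorem]
  have hU : (hA.eigenvectorUnitary : Matrix ι ι ℂ) * star (hA.eigenvectorUnitary : Matrix ι ι ℂ)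
    = 1 := Unitary.coe_mul_star_self _
  rw [h, Unitary.conjStarAlgAut_apply, mul_sub, sub_mul, mul_smul_comm, mul_one, smul_mul_assoc, hU]

lemma resolv_eq {A : Matrix ι ι ℂ} (hA : A.IsHermitian) {z : ℂ} (hz : 0 < z.im) :
    resolv A z = (hA.eigenvectorUnitary : Matrix ι ι ℂ) *
      Matrix.diagonal (fun i => ((hA.eigenvalues i : ℂ) - z)⁻¹) *
      star (hA.eigenvectorUnitary : Matrix ι ι ℂ) := by
  rw [resolv]
  refine Matrix.inv_eq_right_inv ?_
  rw [sub_smul_one_eq hA z]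
  set U := (hA.eigenvectorUnitary : Matrix ι ι ℂ)
  have hU : star U * U = 1 := Unitary.coe_star_mul_self _
  have hU' : U * star U = 1 := Unitary.coe_mul_star_self _
  calc U * _ * star U * (U * _ * star U) = U * Matrix.diagonal (fun i => (hA.eigenvalues i : ℂ) - z)
        * (star U * U) * Matrix.diagonal (fun i => ((hA.eigenvalues i : ℂ) - z)⁻¹) * star U := by
        simp only [mul_assoc]
    _ = 1 := by
        rw [hU, mul_one, mul_assoc U, Matrix.diagonal_mul_diagonal]
        simp only [mul_inv_cancel₀ (ofReal_sub_ne_zero hz _), Matrix.diagonal_one, mul_one, hU']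

lemma isUnit_sub_smul_one {A : Matrix ι ι ℂ} (hA : A.IsHermitian) {z : ℂ} (hz : 0 < z.im) :
    IsUnit (A - z • 1) := by
  rw [sub_smul_one_eq hA z]
  refine ((Unitary.isUnit_coe (U := hA.eigenvectorUnitary)).mul ?_).mul
    (Unitary.isUnit_coe (U := star hA.eigenvectorUnitary))
  rw [Matrix.isUnit_diagonal, Pi.isUnit_iff]
  exact fun i => (ofReal_sub_ne_zero hz _).isUnit

lemma mul_resolv {A : Matrix ι ι ℂ} (hA : A.IsHermitian) {z : ℂ} (hz : 0 < z.im) :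
    A * resolv A z = 1 + z • resolv A z := by
  have h : (A - z • 1) * resolv A z = 1 :=
    Matrix.mul_nonsing_inv _ ((Matrix.isUnit_iff_isUnit_det _).1 (isUnit_sub_smul_one hA hz))
  rw [sub_mul, smul_mul_assoc, one_mul] at h
  rw [← h, sub_add_cancel]

lemma norm_resolv_le {A : Matrix ι ι ℂ} (hA : A.IsHermitian) {z : ℂ} (hz : 0 < z.im) :
    ‖resolv A z‖ ≤ z.im⁻¹ := by
  rw [resolv_eq hA hz, CStarRing.norm_mul_mem_unitary _ (Unitary.star_mem hA.eigenvectorUnitary.2),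
    CStarRing.norm_mem_unitary_mul _ hA.eigenvectorUnitary.2, Matrix.l2_opNorm_diagonal]
  exact (pi_norm_le_iff_of_nonneg (inv_nonneg.2 hz.le)).2 fun i => norm_inv_ofReal_sub_le hz _

lemma trace_resolv {A : Matrix ι ι ℂ} (hA : A.IsHermitian) {z : ℂ} (hz : 0 < z.im) :
    (resolv A z).trace = ∑ i, ((hA.eigenvalues i : ℂ) - z)⁻¹ := by
  rw [resolv_eq hA hz, Matrix.trace_mul_comm, ← mul_assoc, Unitary.coe_star_mul_self, one_mul,
    Matrix.trace_diagonal]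

lemma commute_resolv (A : Matrix ι ι ℂ) (z w : ℂ) : Commute (resolv A z) (resolv A w) := by
  simp only [resolv, Matrix.nonsing_inv_eq_ringInverse]
  refine Commute.ringInverse_ringInverse ?_
  refine Commute.sub_left (Commute.sub_right (Commute.refl A) ?_) (Commute.sub_right ?_ ?_)
  · exact (Commute.one_right A).smul_right w
  · exact (Commute.one_left A).smul_left z
  · exact ((Commute.one_left 1).smul_left z).smul_right w

section Norms

/-- The columns of A * B are A applied to the columns of B. -/
lemma hsNormSq_mul_le_left (A B : Matrix ι ι ℂ) : hsNormSq (A * B) ≤ ‖A‖ ^ 2 * hsNormSq B := by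
  unfold hsNormSq
  rw [Finset.sum_comm, Finset.sum_comm (f := fun x y => ‖B x y‖ ^ 2), Finset.mul_sum]
  refine Finset.sum_le_sum fun j _ => ?_
  have h := Matrix.l2_opNorm_mulVec A (WithLp.toLp 2 (fun i => B i j))
  have h2 := pow_le_pow_left₀ (norm_nonneg _) h 2
  rw [mul_pow, EuclideanSpace.norm_sq_eq, EuclideanSpace.norm_sq_eq] at h2
  simpa [Matrix.mul_apply, Matrix.mulVec, dotProduct] using h2

omit [DecidableEq ι] in
lemma norm_sq_le_hsNormSq (M : Matrix ι ι ℂ) (i j : ι) : ‖M i j‖ ^ 2 ≤ hsNormSq M :=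
  calc ‖M i j‖ ^ 2 ≤ ∑ y, ‖M i y‖ ^ 2 :=
        Finset.single_le_sum (f := fun y => ‖M i y‖ ^ 2)
          (fun _ _ => by positivity) (Finset.mem_univ j)
    _ ≤ _ := Finset.single_le_sum (f := fun x => ∑ y, ‖M x y‖ ^ 2)
          (fun _ _ => by positivity) (Finset.mem_univ i)

omit [DecidableEq ι] in
lemma hsNormSq_conjTranspose (M : Matrix ι ι ℂ) : hsNormSq M.conjTranspose = hsNormSq M := by
  unfold hsNormSq
  rw [Finset.sum_comm]
  simp

lemma hsNormSq_mul_le_right (A B : Matrix ι ι ℂ) : hsNormSq (A * B) ≤ ‖B‖ ^ 2 * hsNormSq A := by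
  rw [← hsNormSq_conjTranspose, Matrix.conjTranspose_mul, ← hsNormSq_conjTranspose A,
    ← Matrix.l2_opNorm_conjTranspose B]
  exact hsNormSq_mul_le_left _ _

lemma hsNormSq_one : hsNormSq (1 : Matrix ι ι ℂ) = Fintype.card ι := by
  unfold hsNormSq
  simp [Matrix.one_apply, apply_ite norm, ite_pow]

lemma norm_entry_le (A : Matrix ι ι ℂ) (i j : ι) : ‖A i j‖ ≤ ‖A‖ := by
  have h := hsNormSq_mul_le_left A (Matrix.single j j 1)
  have h1 : hsNormSq (Matrix.single j j (1 : ℂ)) = 1 := by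
    unfold hsNormSq
    rw [Fintype.sum_eq_single j, Fintype.sum_eq_single j]
    · simp
    · intro k hk; simp [hk.symm]
    · intro k hk
      exact Finset.sum_eq_zero fun l _ => by simp [Matrix.single_apply_of_row_ne hk.symm]
  have h2 : ‖A i j‖ ^ 2 ≤ hsNormSq (A * Matrix.single j j 1) := by
    have := norm_sq_le_hsNormSq (A * Matrix.single j j 1) i j
    simpa using this
  rw [h1, mul_one] at h
  exact (pow_le_pow_iff_left₀ (norm_nonneg _) (norm_nonneg _) two_ne_zero).1 (h2.trans h)

end Norms

end Resolvent

/-! ### The resolvent of the Gaussian model -/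

namespace AddSymm

open scoped Matrix.Norms.L2Operator

variable {n : ℕ} (s : AddSymm)

/-- The random matrix as a linear function of standard Gaussian variables. -/
def model (n : ℕ) : (FreePos n × Bool → ℝ) →L[ℝ] Matrix (SymIdx n) (SymIdx n) ℂ :=
  ∑ k, (ContinuousLinearMap.proj (R := ℝ) (φ := fun _ : FreePos n × Bool => ℝ) k).smulRight
    (s.basisMat n k)

lemma model_apply (y : FreePos n × Bool → ℝ) : s.model n y = ∑ k, y k • s.basisMat n k := by
  simp [model]

lemma model_single [DecidableEq (FreePos n × Bool)] (k : FreePos n × Bool) :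
    s.model n (Pi.single k 1) = s.basisMat n k := by
  rw [model_apply, Fintype.sum_eq_single k]
  · simp
  · intro j hj; simp [hj]

lemma model_isHermitian (y : FreePos n × Bool → ℝ) : (s.model n y).IsHermitian := by
  rw [model_apply, Matrix.IsHermitian, Matrix.conjTranspose_sum]
  refine Finset.sum_congr rfl fun k _ => ?_
  rw [Matrix.conjTranspose_smul, (s.basisMat_isHermitian n k).eq, star_trivial]

/-- The resolvent of the Gaussian model. -/
def res (z : ℂ) (y : FreePos n × Bool → ℝ) : Matrix (SymIdx n) (SymIdx n) ℂ :=
  resolv (s.model n y) z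

lemma norm_res_le {z : ℂ} (hz : 0 < z.im) (y : FreePos n × Bool → ℝ) : ‖s.res z y‖ ≤ z.im⁻¹ :=
  norm_resolv_le (s.model_isHermitian y) hz

lemma hasFDerivAt_res {z : ℂ} (hz : 0 < z.im) (y : FreePos n × Bool → ℝ) :
    HasFDerivAt (s.res z) (-(ContinuousLinearMap.mulLeftRight ℝ _ (s.res z y) (s.res z y)) ∘L
      s.model n) y := by
  obtain ⟨u, hu⟩ := isUnit_sub_smul_one (s.model_isHermitian y) hz
  have h1 := hasFDerivAt_ringInverse (𝕜 := ℝ) u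
  rw [hu] at h1
  have h2 : HasFDerivAt (fun y => s.model n y - z • (1 : Matrix (SymIdx n) (SymIdx n) ℂ))
      (s.model n) y := (s.model n).hasFDerivAt.sub_const _
  have h3 := h1.comp y h2
  have h4 : (↑u⁻¹ : Matrix (SymIdx n) (SymIdx n) ℂ) = s.res z y := by
    rw [res, resolv, ← hu, Matrix.coe_units_inv]
  rw [h4] at h3
  refine h3.congr_of_eventuallyEq (Eventually.of_forall fun x => ?_)
  simp only [res, resolv, Matrix.nonsing_inv_eq_ringInverse, Function.comp_apply]

lemma fderiv_res {z : ℂ} (hz : 0 < z.im) (y v : FreePos n × Bool → ℝ) :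
    fderiv ℝ (s.res z) y v = -(s.res z y * s.model n v * s.res z y) := by
  rw [(s.hasFDerivAt_res hz y).fderiv]
  simp

lemma bddC1_res {z : ℂ} (hz : 0 < z.im) : BddC1 (s.res z (n := n)) where
  contDiff := by
    rw [contDiff_one_iff_fderiv]
    refine ⟨fun y => (s.hasFDerivAt_res hz y).differentiableAt, ?_⟩
    have hc : Continuous (s.res z (n := n)) := continuous_iff_continuousAt.2 fun y =>
      (s.hasFDerivAt_res hz y).continuousAt
    have : fderiv ℝ (s.res z (n := n)) = fun y =>
        (-(ContinuousLinearMap.mulLeftRight ℝ _ (s.res z y) (s.res z y)) ∘L s.model n) :=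
      funext fun y => (s.hasFDerivAt_res hz y).fderiv
    rw [this]
    fun_prop
  bdd := ⟨z.im⁻¹, s.norm_res_le hz⟩
  bdd_fderiv := by
    refine ⟨z.im⁻¹ * ‖s.model n‖ * z.im⁻¹, fun y => ContinuousLinearMap.opNorm_le_bound _ ?_
      fun v => ?_⟩
    · have := inv_nonneg.2 hz.le
      positivity
    · have h0 := inv_nonneg.2 hz.le
      rw [fderiv_res s hz, norm_neg]
      calc _ ≤ ‖s.res z y‖ * ‖s.model n v‖ * ‖s.res z y‖ :=
            (norm_mul_le _ _).trans (by gcongr; exact norm_mul_le _ _)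
        _ ≤ z.im⁻¹ * (‖s.model n‖ * ‖v‖) * z.im⁻¹ := by
            gcongr
            · exact s.norm_res_le hz y
            · exact (s.model n).le_opNorm v
            · exact s.norm_res_le hz y
        _ = _ := by ring

end AddSymm

/-! ### Products of resolvents -/

namespace AddSymm

section Words

open scoped Matrix.Norms.L2Operator

variable {n : ℕ} (s : AddSymm)

/-- A product of resolvents of the Gaussian model. -/
def word (zs : List ℂ) (y : FreePos n × Bool → ℝ) : Matrix (SymIdx n) (SymIdx n) ℂ :=
  (zs.map fun z => s.res z y).prod

lemma word_nil (y : FreePos n × Bool → ℝ) : s.word [] y = 1 := rfl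

lemma word_cons (z : ℂ) (zs : List ℂ) (y : FreePos n × Bool → ℝ) :
    s.word (z :: zs) y = s.res z y * s.word zs y := by simp [word]

lemma word_append (us zs : List ℂ) (y : FreePos n × Bool → ℝ) :
    s.word (us ++ zs) y = s.word us y * s.word zs y := by simp [word]

lemma commute_res_word (z : ℂ) (zs : List ℂ) (y : FreePos n × Bool → ℝ) :
    Commute (s.res z y) (s.word zs y) := by
  induction zs with
  | nil => exact Commute.one_right _
  | cons w zs ih => rw [word_cons]; exact (commute_resolv _ z w).mul_right ih

/-- The order of quantifiers matters, here and in the bounds below: the constant depends on the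
spectral parameters only, not on the symmetry or the size. -/
lemma exists_norm_word_le {zs : List ℂ} (hzs : ∀ z ∈ zs, 0 < z.im) :
    ∃ C, 0 ≤ C ∧ ∀ (s : AddSymm) (n : ℕ) (y : FreePos n × Bool → ℝ), ‖s.word zs y‖ ≤ C := by
  induction zs with
  | nil =>
    refine ⟨1, zero_le_one, fun s n y => ?_⟩
    rw [word_nil]
    -- For n = 0 the matrix algebra is trivial and the identity has norm 0.
    rcases subsingleton_or_nontrivial (Matrix (SymIdx n) (SymIdx n) ℂ) with h | h
    · rw [Subsingleton.elim (1 : Matrix (SymIdx n) (SymIdx n) ℂ) 0]; simp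
    · exact CStarRing.norm_one.le
  | cons z zs ih =>
    obtain ⟨C, hC0, hC⟩ := ih fun w hw => hzs w (List.mem_cons_of_mem _ hw)
    have hz := hzs z List.mem_cons_self
    have h0 := inv_nonneg.2 hz.le
    refine ⟨z.im⁻¹ * C, by positivity, fun s n y => ?_⟩
    rw [word_cons]
    exact (norm_mul_le _ _).trans (by gcongr; exacts [s.norm_res_le hz y, hC s n y])

lemma bddC1_word {zs : List ℂ} (hzs : ∀ z ∈ zs, 0 < z.im) : BddC1 (s.word zs (n := n)) := by
  induction zs with
  | nil => exact BddC1.const _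
  | cons z zs ih =>
    have h := (s.bddC1_res (n := n) (hzs z List.mem_cons_self)).mul
      (ih fun w hw => hzs w (List.mem_cons_of_mem _ hw))
    have e : s.word (z :: zs) (n := n) = fun y => s.res z y * s.word zs y :=
      funext fun y => s.word_cons z zs y
    rwa [e]

lemma fderiv_word_cons {z : ℂ} {zs : List ℂ} (hz : 0 < z.im) (hzs : ∀ z ∈ zs, 0 < z.im)
    (y v : FreePos n × Bool → ℝ) :
    fderiv ℝ (s.word (z :: zs)) y v = s.res z y * fderiv ℝ (s.word zs) y v
      - s.res z y * s.model n v * s.res z y * s.word zs y := by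
  have e : s.word (z :: zs) (n := n) = fun y => s.res z y * s.word zs y :=
    funext fun y => s.word_cons z zs y
  rw [e, BddC1.fderiv_mul (s.bddC1_res hz) (s.bddC1_word hzs), fderiv_res s hz]
  noncomm_ring

lemma fderiv_word_nil (y v : FreePos n × Bool → ℝ) : fderiv ℝ (s.word [] (n := n)) y v = 0 := by
  have e : s.word [] (n := n) = fun _ => 1 := rfl
  rw [e]
  simp

/-- The functional `M ↦ tr (M * T)`. -/
def traceMul {ι : Type*} [Fintype ι] [DecidableEq ι] (T : Matrix ι ι ℂ) :
    Matrix ι ι ℂ →L[ℝ] ℂ :=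
  LinearMap.toContinuousLinearMap ((Matrix.traceLinearMap ι ℝ ℂ).comp (LinearMap.mulRight ℝ T))

lemma traceMul_apply {ι : Type*} [Fintype ι] [DecidableEq ι] (T M : Matrix ι ι ℂ) :
    traceMul T M = (M * T).trace := rfl

/-- Behind all variance estimates. By cyclicity, the resolvent to the left of the derivative moves
into `T`, which is why the induction needs arbitrary `T`; the term where the first resolvent is
differentiated is bounded by `sum_norm_trace_sq_le`. With T the identity, the antidiagonal
permutation or a matrix unit, the squared gradient is O(1), O(1) or O(1/n). -/
lemma exists_sum_norm_trace_fderiv_word_le {zs : List ℂ} (hzs : ∀ z ∈ zs, 0 < z.im) :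
    ∃ C, 0 ≤ C ∧ ∀ (s : AddSymm) (n : ℕ) (y : FreePos n × Bool → ℝ)
      (T : Matrix (SymIdx n) (SymIdx n) ℂ),
      ∑ k, ‖(fderiv ℝ (s.word zs) y (Pi.single k 1) * T).trace‖ ^ 2
        ≤ C * ((2 * n : ℝ)⁻¹ * hsNormSq T) := by
  induction zs with
  | nil => exact ⟨0, le_rfl, fun s n y T => by simp [fderiv_word_nil]⟩
  | cons z zs ih =>
    have hz := hzs z List.mem_cons_self
    have hzs' : ∀ w ∈ zs, 0 < w.im := fun w hw => hzs w (List.mem_cons_of_mem _ hw)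
    obtain ⟨C, hC0, hC⟩ := ih hzs'
    obtain ⟨D, hD0, hD⟩ := exists_norm_word_le hzs'
    set η := z.im⁻¹ with hη
    have h0 : 0 ≤ η := inv_nonneg.2 hz.le
    refine ⟨2 * (C * η ^ 2) + 2 * (2 * (η ^ 2 * (D ^ 2 * η ^ 2))), by positivity,
      fun s n y T => ?_⟩
    have hG : ‖s.res z y‖ ^ 2 ≤ η ^ 2 := by gcongr; exact s.norm_res_le hz y
    have hW : ‖s.word zs y‖ ^ 2 ≤ D ^ 2 := by gcongr; exact hD s n y
    have hT := hsNormSq_nonneg T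
    have h1 : hsNormSq (T * s.res z y) ≤ η ^ 2 * hsNormSq T :=
      (hsNormSq_mul_le_right _ _).trans (by gcongr)
    have h2 : hsNormSq (s.res z y * (s.word zs y * (T * s.res z y)))
        ≤ η ^ 2 * (D ^ 2 * (η ^ 2 * hsNormSq T)) := by
      refine (hsNormSq_mul_le_left _ _).trans ?_
      have := hsNormSq_nonneg (s.word zs y * (T * s.res z y))
      gcongr
      refine (hsNormSq_mul_le_left _ _).trans ?_
      have := hsNormSq_nonneg (T * s.res z y)
      gcongr
    have h3 : ∀ k : FreePos n × Bool,
        ‖(fderiv ℝ (s.word (z :: zs)) y (Pi.single k 1) * T).trace‖ ^ 2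
        ≤ 2 * ‖(fderiv ℝ (s.word zs) y (Pi.single k 1) * (T * s.res z y)).trace‖ ^ 2
        + 2 * ‖(s.basisMat n k * (s.res z y * (s.word zs y * (T * s.res z y)))).trace‖ ^ 2 := by
      intro k
      rw [s.fderiv_word_cons hz hzs', sub_mul, Matrix.trace_sub, model_single]
      have e1 : (s.res z y * fderiv ℝ (s.word zs) y (Pi.single k 1) * T).trace
          = (fderiv ℝ (s.word zs) y (Pi.single k 1) * (T * s.res z y)).trace := by
        rw [mul_assoc, Matrix.trace_mul_comm, mul_assoc]
      have e2 : (s.res z y * s.basisMat n k * s.res z y * s.word zs y * T).trace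
          = (s.basisMat n k * (s.res z y * (s.word zs y * (T * s.res z y)))).trace := by
        rw [mul_assoc, mul_assoc, mul_assoc, Matrix.trace_mul_comm]
        simp only [mul_assoc]
      rw [e1, e2]
      generalize (fderiv ℝ (s.word zs) y (Pi.single k 1) * (T * s.res z y)).trace = a
      generalize (s.basisMat n k * (s.res z y * (s.word zs y * (T * s.res z y)))).trace = b
      nlinarith [norm_sub_le a b, norm_nonneg (a - b), norm_nonneg a, norm_nonneg b,
        sq_nonneg (‖a‖ - ‖b‖)]
    refine (Finset.sum_le_sum fun k _ => h3 k).trans ?_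
    rw [Finset.sum_add_distrib, ← Finset.mul_sum, ← Finset.mul_sum]
    have h4 := hC s n y (T * s.res z y)
    have h5 := s.sum_norm_trace_sq_le (s.res z y * (s.word zs y * (T * s.res z y)))
    have hn : (0 : ℝ) ≤ (2 * n : ℝ)⁻¹ := by positivity
    calc _ ≤ 2 * (C * ((2 * n : ℝ)⁻¹ * (η ^ 2 * hsNormSq T)))
          + 2 * ((2 * n : ℝ)⁻¹ * (2 * (η ^ 2 * (D ^ 2 * (η ^ 2 * hsNormSq T))))) := by
          gcongr
          · exact h4.trans (by gcongr)
          · exact h5.trans (by gcongr)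
      _ = _ := by ring

/-! Symmetries of the model -/

lemma inv_one : s.Inv (1 : Matrix (SymIdx n) (SymIdx n) ℂ) := by
  intro x y
  cases s <;> simp [act, Matrix.one_apply, eq_comm]

lemma inv_model (y : FreePos n × Bool → ℝ) : s.Inv (s.model n y) := by
  intro a b
  rw [model_apply]
  simp only [Matrix.sum_apply, Matrix.smul_apply, basisMat_act]

/-- The action of the additional symmetry on matrices. -/
def actMat (M : Matrix (SymIdx n) (SymIdx n) ℂ) : Matrix (SymIdx n) (SymIdx n) ℂ :=
  Matrix.of fun x y => M (s.act (x, y)).1 (s.act (x, y)).2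

lemma inv_iff {M : Matrix (SymIdx n) (SymIdx n) ℂ} : s.Inv M ↔ s.actMat M = M :=
  ⟨fun h => Matrix.ext h, fun h x y => congrFun (congrFun h x) y⟩

/-- The central symmetry is an automorphism, the flip an anti-automorphism; for commuting factors
the order is irrelevant. -/
lemma actMat_mul {M M' : Matrix (SymIdx n) (SymIdx n) ℂ} (h : Commute M M') :
    s.actMat (M * M') = s.actMat M * s.actMat M' := by
  cases s
  · rw [h.eq]
    ext x y
    simp only [actMat, act, Matrix.of_apply, Matrix.mul_apply]
    rw [← Equiv.sum_comp (Equiv.neg (SymIdx n))]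
    refine Finset.sum_congr rfl fun z _ => ?_
    simp [mul_comm]
  · ext x y
    simp only [actMat, act, Matrix.of_apply, Matrix.mul_apply]
    rw [← Equiv.sum_comp (Equiv.neg (SymIdx n))]
    rfl

/-- Applying the symmetry to (W - z) G = 1 shows that the image of G is again an inverse of W - z,
hence equals G. -/
lemma inv_res {z : ℂ} (hz : 0 < z.im) (y : FreePos n × Bool → ℝ) : s.Inv (s.res z y) := by
  have hu := isUnit_sub_smul_one (s.model_isHermitian y) hz
  have hd := (Matrix.isUnit_iff_isUnit_det _).1 hu
  have h1 : (s.model n y - z • 1) * s.res z y = 1 := Matrix.mul_nonsing_inv _ hd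
  have h2 : s.res z y * (s.model n y - z • 1) = 1 := Matrix.nonsing_inv_mul _ hd
  have h3 : s.actMat (s.model n y - z • 1) = s.model n y - z • 1 := by
    rw [← inv_iff]
    intro a b
    simp only [Matrix.sub_apply, Matrix.smul_apply, s.inv_model y a b, s.inv_one a b]
  have h4 := s.actMat_mul (show Commute (s.model n y - z • 1) (s.res z y) from h1.trans h2.symm)
  rw [h1, h3, s.inv_iff.1 s.inv_one] at h4
  rw [inv_iff]
  calc s.actMat (s.res z y) = s.res z y * (s.model n y - z • 1) * s.actMat (s.res z y) := by
        rw [h2, one_mul]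
    _ = s.res z y := by rw [mul_assoc, ← h4, mul_one]

lemma inv_word {zs : List ℂ} (hzs : ∀ z ∈ zs, 0 < z.im) (y : FreePos n × Bool → ℝ) :
    s.Inv (s.word zs y) := by
  induction zs with
  | nil => exact s.inv_one
  | cons z zs ih =>
    rw [inv_iff, word_cons, s.actMat_mul (s.commute_res_word z zs y),
      s.inv_iff.1 (s.inv_res (hzs z List.mem_cons_self) y),
      s.inv_iff.1 (ih fun w hw => hzs w (List.mem_cons_of_mem _ hw))]

/-- The diagonal matrix of signs. -/
def sgnMat (n : ℕ) : Matrix (SymIdx n) (SymIdx n) ℂ := Matrix.diagonal fun x => (x.sgn : ℂ)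

lemma sgnMat_mul_self (n : ℕ) : sgnMat n * sgnMat n = 1 := by
  rw [sgnMat, Matrix.diagonal_mul_diagonal, ← Matrix.diagonal_one]
  congr 1
  ext x
  rw [← Complex.ofReal_mul, SymIdx.sgn_mul_self, Complex.ofReal_one]

/-- Conjugation by the diagonal signs only changes signs of the Gaussian coefficients, so it
preserves the law of the matrix. -/
lemma model_sign (y : FreePos n × Bool → ℝ) :
    s.model n (fun k => basisSign k * y k) = sgnMat n * s.model n y * sgnMat n := by
  rw [model_apply, model_apply, Finset.mul_sum, Finset.sum_mul]
  refine Finset.sum_congr rfl fun k _ => ?_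
  ext a b
  have := s.basisMat_sgn n k a b
  rw [sgnMat, Matrix.mul_diagonal, Matrix.diagonal_mul]
  simp only [Matrix.smul_apply, Complex.real_smul]
  push_cast at this ⊢
  linear_combination -(y k : ℂ) * this

lemma res_sign {z : ℂ} (hz : 0 < z.im) (y : FreePos n × Bool → ℝ) :
    s.res z (fun k => basisSign k * y k) = sgnMat n * s.res z y * sgnMat n := by
  have hu := isUnit_sub_smul_one (s.model_isHermitian y) hz
  have hd := (Matrix.isUnit_iff_isUnit_det _).1 hu
  have h1 : (s.model n y - z • 1) * s.res z y = 1 := Matrix.mul_nonsing_inv _ hd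
  rw [res, resolv]
  refine Matrix.inv_eq_right_inv ?_
  have e : s.model n (fun k => basisSign k * y k) - z • 1
      = sgnMat n * (s.model n y - z • 1) * sgnMat n := by
    rw [model_sign, mul_sub, sub_mul, mul_smul_comm, mul_one, smul_mul_assoc, sgnMat_mul_self]
  rw [e]
  calc _ = sgnMat n * (s.model n y - z • 1) * (sgnMat n * sgnMat n) * s.res z y * sgnMat n := by
        simp only [mul_assoc]
    _ = 1 := by rw [sgnMat_mul_self, mul_one, mul_assoc (sgnMat n), h1, mul_one, sgnMat_mul_self]

lemma word_sign {zs : List ℂ} (hzs : ∀ z ∈ zs, 0 < z.im) (y : FreePos n × Bool → ℝ) :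
    s.word zs (fun k => basisSign k * y k) = sgnMat n * s.word zs y * sgnMat n := by
  induction zs with
  | nil => rw [word_nil, word_nil, mul_one, sgnMat_mul_self]
  | cons z zs ih =>
    rw [word_cons, word_cons, s.res_sign (hzs z List.mem_cons_self),
      ih fun w hw => hzs w (List.mem_cons_of_mem _ hw)]
    calc _ = sgnMat n * s.res z y * (sgnMat n * sgnMat n) * s.word zs y * sgnMat n := by
          simp only [mul_assoc]
      _ = _ := by rw [sgnMat_mul_self, mul_one]; simp only [mul_assoc]

end Words

end AddSymm

/-! ### Expectations of products of resolvents -/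

namespace AddSymm

section Expectations

open scoped Matrix.Norms.L2Operator

variable {n : ℕ} (s : AddSymm)

lemma bddC1_trace_word_mul {zs : List ℂ} (hzs : ∀ z ∈ zs, 0 < z.im)
    (T : Matrix (SymIdx n) (SymIdx n) ℂ) : BddC1 fun y => (s.word zs y * T).trace :=
  (s.bddC1_word hzs).clm_comp (traceMul T)

lemma bddC1_trace_word {zs : List ℂ} (hzs : ∀ z ∈ zs, 0 < z.im) :
    BddC1 fun y : FreePos n × Bool → ℝ => (s.word zs y).trace := by
  simpa using s.bddC1_trace_word_mul (n := n) hzs 1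

lemma exists_grad_trace_word_mul_le {zs : List ℂ} (hzs : ∀ z ∈ zs, 0 < z.im) :
    ∃ C, 0 ≤ C ∧ ∀ (s : AddSymm) (n : ℕ) (T : Matrix (SymIdx n) (SymIdx n) ℂ)
      (y : FreePos n × Bool → ℝ),
      ∑ k, ‖fderiv ℝ (fun y => (s.word zs y * T).trace) y (Pi.single k 1)‖ ^ 2
        ≤ C * ((2 * n : ℝ)⁻¹ * hsNormSq T) := by
  obtain ⟨C, hC0, hC⟩ := exists_sum_norm_trace_fderiv_word_le hzs
  refine ⟨C, hC0, fun s n T y => (le_of_eq ?_).trans (hC s n y T)⟩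
  refine Finset.sum_congr rfl fun k _ => ?_
  rw [show fderiv ℝ (fun y => (s.word zs y * T).trace) y (Pi.single k 1)
    = (fderiv ℝ (s.word zs) y (Pi.single k 1) * T).trace from
      (s.bddC1_word hzs).fderiv_clm_comp (traceMul T) y _]

lemma two_mul_inv_mul_le (n : ℕ) : (2 * n : ℝ)⁻¹ * (2 * n : ℝ) ≤ 1 := inv_mul_le_one

/-- The identity has squared Hilbert–Schmidt norm 2n, which cancels the variance 1/(2n) of the
entries; hence traces fluctuate by O(1) only. -/
lemma exists_grad_trace_word_le {zs : List ℂ} (hzs : ∀ z ∈ zs, 0 < z.im) :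
    ∃ C, 0 ≤ C ∧ ∀ (s : AddSymm) (n : ℕ) (y : FreePos n × Bool → ℝ),
      ∑ k, ‖fderiv ℝ (fun y => (s.word zs y).trace) y (Pi.single k 1)‖ ^ 2 ≤ C := by
  obtain ⟨C, hC0, hC⟩ := exists_grad_trace_word_mul_le hzs
  refine ⟨C, hC0, fun s n y => ?_⟩
  have h := hC s n 1 y
  rw [hsNormSq_one, card_symIdx] at h
  simp only [mul_one] at h
  refine h.trans (mul_le_of_le_one_right hC0 ?_)
  push_cast
  exact two_mul_inv_mul_le n

/-- The permutation matrix of `x ↦ -x`. -/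
def antiMat (n : ℕ) : Matrix (SymIdx n) (SymIdx n) ℂ := Matrix.of fun x y => if x = -y then 1 else 0

lemma trace_mul_antiMat (M : Matrix (SymIdx n) (SymIdx n) ℂ) :
    (M * antiMat n).trace = ∑ x, M x (-x) := by
  simp [Matrix.trace, Matrix.mul_apply, antiMat]

lemma hsNormSq_antiMat (n : ℕ) : hsNormSq (antiMat n) = 2 * n := by
  have h : ∀ x y : SymIdx n, ‖antiMat n x y‖ ^ 2 = if y = -x then 1 else 0 := by
    intro x y
    by_cases h : x = -y
    · simp [antiMat, h]
    · have h' : ¬ y = -x := fun h' => h (by rw [h', neg_neg])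
      simp [antiMat, h, h']
  simp only [hsNormSq, h, Finset.sum_ite_eq', Finset.mem_univ, if_true, Finset.sum_const,
    Finset.card_univ, card_symIdx]
  simp

lemma bddC1_anti_word {zs : List ℂ} (hzs : ∀ z ∈ zs, 0 < z.im) :
    BddC1 fun y : FreePos n × Bool → ℝ => ∑ x, s.word zs y x (-x) := by
  simpa only [trace_mul_antiMat] using s.bddC1_trace_word_mul hzs (antiMat n)

lemma exists_grad_anti_word_le {zs : List ℂ} (hzs : ∀ z ∈ zs, 0 < z.im) :
    ∃ C, 0 ≤ C ∧ ∀ (s : AddSymm) (n : ℕ) (y : FreePos n × Bool → ℝ),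
      ∑ k, ‖fderiv ℝ (fun y => ∑ x, s.word zs y x (-x)) y (Pi.single k 1)‖ ^ 2 ≤ C := by
  obtain ⟨C, hC0, hC⟩ := exists_grad_trace_word_mul_le hzs
  refine ⟨C, hC0, fun s n y => ?_⟩
  have h := hC s n (antiMat n) y
  simp only [trace_mul_antiMat, hsNormSq_antiMat] at h
  exact h.trans (mul_le_of_le_one_right hC0 (two_mul_inv_mul_le n))

lemma trace_mul_single_one (M : Matrix (SymIdx n) (SymIdx n) ℂ) (a b : SymIdx n) :
    (M * Matrix.single b a 1).trace = M a b := by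
  rw [Matrix.trace_mul_comm, Matrix.trace_single_mul]
  simp

lemma hsNormSq_single (a b : SymIdx n) : hsNormSq (Matrix.single a b (1 : ℂ)) = 1 := by
  unfold hsNormSq
  rw [Fintype.sum_eq_single a, Fintype.sum_eq_single b]
  · simp
  · intro k hk; simp [hk.symm]
  · intro k hk
    exact Finset.sum_eq_zero fun l _ => by simp [Matrix.single_apply_of_row_ne hk.symm]

lemma bddC1_word_entry {zs : List ℂ} (hzs : ∀ z ∈ zs, 0 < z.im) (a b : SymIdx n) :
    BddC1 fun y : FreePos n × Bool → ℝ => s.word zs y a b := by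
  simpa only [trace_mul_single_one] using s.bddC1_trace_word_mul hzs (Matrix.single b a 1)

lemma exists_grad_word_entry_le {zs : List ℂ} (hzs : ∀ z ∈ zs, 0 < z.im) :
    ∃ C, 0 ≤ C ∧ ∀ (s : AddSymm) (n : ℕ) (a b : SymIdx n) (y : FreePos n × Bool → ℝ),
      ∑ k, ‖fderiv ℝ (fun y => s.word zs y a b) y (Pi.single k 1)‖ ^ 2 ≤ C * (2 * n : ℝ)⁻¹ := by
  obtain ⟨C, hC0, hC⟩ := exists_grad_trace_word_mul_le hzs
  refine ⟨C, hC0, fun s n a b y => ?_⟩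
  have h := hC s n (Matrix.single b a 1) y
  simpa only [trace_mul_single_one, hsNormSq_single, mul_one] using h

/-- The law is invariant under conjugation by signs, while the entry at (x, -x) changes sign, since
x and -x have opposite signs. -/
lemma integral_word_anti {zs : List ℂ} (hzs : ∀ z ∈ zs, 0 < z.im) (x : SymIdx n) :
    ∫ y, s.word zs y x (-x) ∂(gaussPi (FreePos n × Bool)) = 0 := by
  have h := integral_gaussPi_sign (K := FreePos n × Bool) basisSign basisSign_eq
    (s.bddC1_word_entry hzs x (-x)).continuous
  have e : ∀ y : FreePos n × Bool → ℝ, s.word zs (fun k => basisSign k * y k) x (-x)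
      = -(s.word zs y x (-x)) := by
    intro y
    rw [s.word_sign hzs, sgnMat, Matrix.mul_diagonal, Matrix.diagonal_mul, SymIdx.sgn_neg]
    have := SymIdx.sgn_mul_self x
    have h2 : (x.sgn : ℂ) * (x.sgn : ℂ) = 1 := by rw [← Complex.ofReal_mul, this, Complex.ofReal_one]
    push_cast
    linear_combination -(s.word zs y x (-x)) * h2
  simp_rw [e] at h
  rw [integral_neg] at h
  linear_combination (-1 / 2 : ℂ) * h

lemma integral_anti_word {zs : List ℂ} (hzs : ∀ z ∈ zs, 0 < z.im) :
    ∫ y, ∑ x, s.word zs y x (-x) ∂(gaussPi (FreePos n × Bool)) = 0 := by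
  rw [integral_finsetSum _ fun x _ => (s.bddC1_word_entry hzs x (-x)).integrable _]
  exact Finset.sum_eq_zero fun x _ => s.integral_word_anti hzs x

lemma norm_trace_le (M : Matrix (SymIdx n) (SymIdx n) ℂ) : ‖M.trace‖ ≤ 2 * n * ‖M‖ := by
  refine (norm_sum_le _ _).trans ?_
  refine (Finset.sum_le_sum fun x _ => norm_entry_le M x x).trans (le_of_eq ?_)
  rw [Finset.sum_const, Finset.card_univ, card_symIdx]
  simp

/-! Contractions in expectation -/

lemma bddC1_contractErr {us vs : List ℂ} (hus : ∀ z ∈ us, 0 < z.im)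
    (hvs : ∀ z ∈ vs, 0 < z.im) :
    BddC1 fun y : FreePos n × Bool → ℝ => s.contractErr (s.word us y) (s.word vs y) := by
  cases s
  · have h : ∀ y : FreePos n × Bool → ℝ, flip.contractErr (flip.word us y) (flip.word vs y)
        = (flip.word (us ++ vs) y).trace - ∑ x, flip.word us y x x * flip.word vs y x x := by
      intro y
      rw [contractErr_flip _ (flip.inv_word hvs y), word_append]
    simp_rw [h]
    have hsum : ∀ t : Finset (SymIdx n), BddC1 fun y : FreePos n × Bool → ℝ =>
        ∑ x ∈ t, flip.word us y x x * flip.word vs y x x := by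
      intro t
      classical
      induction t using Finset.induction_on with
      | empty => simpa using BddC1.const _
      | insert a t ha ih =>
        simp_rw [Finset.sum_insert ha]
        exact ((flip.bddC1_word_entry hus a a).mul (flip.bddC1_word_entry hvs a a)).add ih
    exact (flip.bddC1_trace_word (by simpa [or_imp, forall_and] using ⟨hus, hvs⟩)).sub (hsum _)
  · simp_rw [contractErr_central]
    exact (central.bddC1_anti_word hus).mul (central.bddC1_anti_word hvs)

/-- For the flip the bound holds pointwise. In the central case the integral is a covariance of two
centred antidiagonal sums, so it is even O(1). -/
lemma exists_norm_integral_contractErr_le {us vs : List ℂ} (hus : ∀ z ∈ us, 0 < z.im)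
    (hvs : ∀ z ∈ vs, 0 < z.im) : ∃ C, 0 ≤ C ∧ ∀ (s : AddSymm) (n : ℕ), 1 ≤ n →
      ‖∫ y, s.contractErr (s.word us y) (s.word vs y) ∂(gaussPi (FreePos n × Bool))‖
        ≤ C * (2 * n) := by
  obtain ⟨A, hA0, hA⟩ := exists_norm_word_le hus
  obtain ⟨B, hB0, hB⟩ := exists_norm_word_le hvs
  obtain ⟨A', hA0', hA'⟩ := exists_grad_anti_word_le hus
  obtain ⟨B', hB0', hB'⟩ := exists_grad_anti_word_le hvs
  refine ⟨2 * (A * B) + √(4 * A') * √(4 * B'), by positivity, fun s n hn => ?_⟩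
  have hn' : (1 : ℝ) ≤ n := by exact_mod_cast hn
  cases s
  · have key : ∀ y : FreePos n × Bool → ℝ,
        ‖flip.contractErr (flip.word us y) (flip.word vs y)‖ ≤ 2 * (A * B) * (2 * n) := by
      intro y
      rw [contractErr_flip _ (flip.inv_word hvs y)]
      have h1 : ‖(flip.word us y * flip.word vs y).trace‖ ≤ 2 * n * (A * B) :=
        (norm_trace_le _).trans (by
          gcongr
          exact (norm_mul_le _ _).trans (mul_le_mul (hA _ _ y) (hB _ _ y) (norm_nonneg _) hA0))
      have h2 : ‖∑ x, flip.word us y x x * flip.word vs y x x‖ ≤ 2 * n * (A * B) := by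
        refine (norm_sum_le _ _).trans ?_
        refine (Finset.sum_le_sum (g := fun _ => A * B) fun x _ => ?_).trans (le_of_eq ?_)
        · rw [norm_mul]
          exact mul_le_mul ((norm_entry_le _ _ _).trans (hA _ _ y))
            ((norm_entry_le _ _ _).trans (hB _ _ y)) (norm_nonneg _) hA0
        · rw [Finset.sum_const, Finset.card_univ, card_symIdx]
          simp
      refine (norm_sub_le _ _).trans ?_
      linarith
    refine (norm_integral_le_of_norm_le_const (ae_of_all _ key)).trans ?_
    simp only [probReal_univ, mul_one]
    have : 0 ≤ √(4 * A') * √(4 * B') := by positivity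
    nlinarith
  · simp_rw [contractErr_central]
    have h := norm_gaussCov_le (central.bddC1_anti_word (n := n) hus)
      (central.bddC1_anti_word (n := n) hvs)
    rw [central.integral_anti_word hvs] at h
    simp only [sub_zero] at h
    refine h.trans ?_
    have h1 := gaussVar_le (central.bddC1_anti_word (n := n) hus) (hA' central n)
    have h2 := gaussVar_le (central.bddC1_anti_word (n := n) hvs) (hB' central n)
    have h3 : √(gaussVar fun y : FreePos n × Bool → ℝ => ∑ x, central.word us y x (-x)) *
        √(gaussVar fun y : FreePos n × Bool → ℝ => ∑ x, central.word vs y x (-x))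
        ≤ √(4 * A') * √(4 * B') := by gcongr
    have : 0 ≤ √(4 * A') * √(4 * B') := by positivity
    have : 0 ≤ A * B := by positivity
    nlinarith

/-- The normalized expected trace of a product of resolvents. -/
def mean (s : AddSymm) (n : ℕ) (zs : List ℂ) : ℂ :=
  (2 * n : ℂ)⁻¹ * ∫ y, (s.word zs y).trace ∂(gaussPi (FreePos n × Bool))

/-- The normalized expectation of a contraction. -/
def pairMean (s : AddSymm) (n : ℕ) (us vs : List ℂ) : ℂ :=
  ((2 * n : ℂ)⁻¹) ^ 2 * ∫ y, ((s.word us y).trace * (s.word vs y).trace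
    + s.contractErr (s.word us y) (s.word vs y)) ∂(gaussPi (FreePos n × Bool))

/-- Approximate factorization: the covariance of the two traces is O(1), the contraction error is
O(n), and the normalization divides by (2n)². -/
lemma exists_norm_pairMean_sub_le {us vs : List ℂ} (hus : ∀ z ∈ us, 0 < z.im)
    (hvs : ∀ z ∈ vs, 0 < z.im) : ∃ C, 0 ≤ C ∧ ∀ (s : AddSymm) (n : ℕ), 1 ≤ n →
      ‖s.pairMean n us vs - s.mean n us * s.mean n vs‖ ≤ C * (2 * n : ℝ)⁻¹ := by
  obtain ⟨E, hE0, hE⟩ := exists_norm_integral_contractErr_le hus hvs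
  obtain ⟨A, hA0, hA⟩ := exists_grad_trace_word_le hus
  obtain ⟨B, hB0, hB⟩ := exists_grad_trace_word_le hvs
  refine ⟨√(4 * A) * √(4 * B) + E, by positivity, fun s n hn => ?_⟩
  have hn' : (1 : ℝ) ≤ n := by exact_mod_cast hn
  set μ := gaussPi (FreePos n × Bool)
  have bu := s.bddC1_trace_word (n := n) hus
  have bv := s.bddC1_trace_word (n := n) hvs
  have h1 := norm_gaussCov_le bu bv
  have h2 : ∫ y, (s.word us y).trace * ((s.word vs y).trace - ∫ y, (s.word vs y).trace ∂μ) ∂μ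
      = ∫ y, (s.word us y).trace * (s.word vs y).trace ∂μ
        - (∫ y, (s.word us y).trace ∂μ) * ∫ y, (s.word vs y).trace ∂μ := by
    simp_rw [mul_sub]
    rw [integral_sub ((bu.mul bv).integrable _) ((bu.integrable _).mul_const _),
      integral_mul_const]
  have h3 : s.pairMean n us vs - s.mean n us * s.mean n vs = ((2 * n : ℂ)⁻¹) ^ 2 *
      (∫ y, (s.word us y).trace * ((s.word vs y).trace - ∫ y, (s.word vs y).trace ∂μ) ∂μ
        + ∫ y, s.contractErr (s.word us y) (s.word vs y) ∂μ) := by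
    rw [pairMean, mean, mean, integral_add ((bu.mul bv).integrable _)
      ((s.bddC1_contractErr hus hvs).integrable _), h2]
    ring
  have h4 : √(gaussVar fun y : FreePos n × Bool → ℝ => (s.word us y).trace) *
      √(gaussVar fun y : FreePos n × Bool → ℝ => (s.word vs y).trace)
      ≤ √(4 * A) * √(4 * B) := by
    gcongr
    exacts [gaussVar_le bu (hA s n), gaussVar_le bv (hB s n)]
  rw [h3, norm_mul]
  have h5 : ‖((2 * n : ℂ)⁻¹) ^ 2‖ = ((2 * n : ℝ)⁻¹) ^ 2 := by
    rw [norm_pow, norm_inv, norm_mul]; simp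
  rw [h5]
  have h6 := (norm_add_le _ _).trans (add_le_add (h1.trans h4) (hE s n hn))
  calc _ ≤ ((2 * n : ℝ)⁻¹) ^ 2 * ((√(4 * A) * √(4 * B) + E) * (2 * n)) := by
        gcongr
        refine h6.trans ?_
        have : 0 ≤ √(4 * A) * √(4 * B) := by positivity
        nlinarith
    _ = _ := by field_simp

/-! Loop equations -/

/-- Integration by parts in each Gaussian coordinate, the derivative falling on M or on h. The
choice h = 1 yields equations for means, a centred trace h those for covariances. -/
lemma integral_trace_model_mul {M : (FreePos n × Bool → ℝ) → Matrix (SymIdx n) (SymIdx n) ℂ}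
    (hM : BddC1 M) {h : (FreePos n × Bool → ℝ) → ℂ} (hh : BddC1 h) :
    ∫ y, (s.model n y * M y).trace * h y ∂(gaussPi (FreePos n × Bool)) =
      ∫ y, (∑ k, (s.basisMat n k * fderiv ℝ M y (Pi.single k 1)).trace) * h y
        ∂(gaussPi (FreePos n × Bool))
      + ∫ y, ∑ k, (s.basisMat n k * M y).trace * fderiv ℝ h y (Pi.single k 1)
        ∂(gaussPi (FreePos n × Bool)) := by
  set μ := gaussPi (FreePos n × Bool)
  have hk : ∀ k, BddC1 fun y => (M y * s.basisMat n k).trace := fun k =>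
    hM.clm_comp (traceMul (s.basisMat n k))
  have e1 : ∀ y, (s.model n y * M y).trace * h y
      = ∑ k, (y k : ℂ) * ((M y * s.basisMat n k).trace * h y) := by
    intro y
    rw [model_apply, Finset.sum_mul, Matrix.trace_sum, Finset.sum_mul]
    refine Finset.sum_congr rfl fun k _ => ?_
    rw [smul_mul_assoc, Matrix.trace_smul, Matrix.trace_mul_comm, Complex.real_smul, mul_assoc]
  have e2 : ∀ k y, fderiv ℝ (fun y => (M y * s.basisMat n k).trace * h y) y (Pi.single k 1)
      = (s.basisMat n k * fderiv ℝ M y (Pi.single k 1)).trace * h y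
        + (s.basisMat n k * M y).trace * fderiv ℝ h y (Pi.single k 1) := by
    intro k y
    rw [BddC1.fderiv_mul (hk k) hh, show fderiv ℝ (fun y => (M y * s.basisMat n k).trace) y
      (Pi.single k 1) = (fderiv ℝ M y (Pi.single k 1) * s.basisMat n k).trace from
        hM.fderiv_clm_comp (traceMul (s.basisMat n k)) y _, Matrix.trace_mul_comm,
      Matrix.trace_mul_comm (fderiv ℝ M y _), add_comm]
  have i1 : ∀ k, Integrable
      (fun y => (s.basisMat n k * fderiv ℝ M y (Pi.single k 1)).trace * h y) μ := by
    intro k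
    obtain ⟨C, hC⟩ := hh.bdd
    refine Integrable.mul_bdd (c := C) ?_ hh.continuous.aestronglyMeasurable (ae_of_all _ hC)
    have h2 := (traceMul (s.basisMat n k)).integrable_comp
      (hM.integrable_fderiv μ (Pi.single k 1))
    refine h2.congr (ae_of_all _ fun y => ?_)
    exact Matrix.trace_mul_comm (fderiv ℝ M y (Pi.single k 1)) (s.basisMat n k)
  have i2 : ∀ k, Integrable
      (fun y => (s.basisMat n k * M y).trace * fderiv ℝ h y (Pi.single k 1)) μ := by
    intro k
    obtain ⟨C, hC⟩ := (hk k).bdd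
    refine Integrable.bdd_mul (c := C) (hh.integrable_fderiv μ (Pi.single k 1)) ?_
      (ae_of_all _ fun y => ?_)
    · simp_rw [Matrix.trace_mul_comm (s.basisMat n k)]
      exact (hk k).continuous.aestronglyMeasurable
    · rw [Matrix.trace_mul_comm]
      exact hC y
  simp_rw [e1]
  rw [integral_finsetSum _ fun k _ => integrable_coord_mul ((hk k).mul hh) k]
  simp_rw [integral_coord_mul ((hk _).mul hh), e2, Finset.sum_mul]
  rw [integral_finsetSum _ fun k _ => i1 k, integral_finsetSum _ fun k _ => i2 k,
    ← Finset.sum_add_distrib]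
  exact Finset.sum_congr rfl fun k _ => integral_add (i1 k) (i2 k)

/-- Differentiating the first resolvent cuts the trace in two; otherwise that resolvent joins the
prefix `L`. Iteration from `L = 1` cuts the word once at each letter. -/
lemma sum_trace_basisMat_fderiv_word_cons (L : Matrix (SymIdx n) (SymIdx n) ℂ) {z : ℂ}
    {zs : List ℂ} (hz : 0 < z.im) (hzs : ∀ z ∈ zs, 0 < z.im) (y : FreePos n × Bool → ℝ) :
    ∑ k, (s.basisMat n k * L * fderiv ℝ (s.word (z :: zs)) y (Pi.single k 1)).trace
      = ∑ k, (s.basisMat n k * (L * s.res z y) * fderiv ℝ (s.word zs) y (Pi.single k 1)).trace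
        - (2 * n : ℂ)⁻¹ * ((L * s.res z y).trace * (s.word (z :: zs) y).trace
          + s.contractErr (L * s.res z y) (s.word (z :: zs) y)) := by
  rw [← sum_trace_basisMat_mul_mul, ← Finset.sum_sub_distrib]
  refine Finset.sum_congr rfl fun k _ => ?_
  rw [s.fderiv_word_cons hz hzs, model_single, mul_sub, Matrix.trace_sub, word_cons]
  simp only [mul_assoc]

end Expectations

end AddSymm

namespace AddSymm

section Loop

open scoped Matrix.Norms.L2Operator

variable {n : ℕ} (s : AddSymm)

lemma trace_model_mul_word_cons {z : ℂ} (hz : 0 < z.im) (zs : List ℂ)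
    (y : FreePos n × Bool → ℝ) :
    (s.model n y * s.word (z :: zs) y).trace
      = (s.word zs y).trace + z * (s.word (z :: zs) y).trace := by
  rw [word_cons, ← mul_assoc, res, mul_resolv (s.model_isHermitian y) hz, add_mul, one_mul,
    smul_mul_assoc, Matrix.trace_add, Matrix.trace_smul, smul_eq_mul]

lemma mean_cons {z : ℂ} {zs : List ℂ} (hz : 0 < z.im) (hzs : ∀ z ∈ zs, 0 < z.im) :
    s.mean n zs + z * s.mean n (z :: zs) = (2 * n : ℂ)⁻¹ * ∫ y,
      ∑ k, (s.basisMat n k * fderiv ℝ (s.word (z :: zs)) y (Pi.single k 1)).trace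
        ∂(gaussPi (FreePos n × Bool)) := by
  have hzs' : ∀ w ∈ z :: zs, 0 < w.im := by simpa using ⟨hz, hzs⟩
  have h := s.integral_trace_model_mul (s.bddC1_word (n := n) hzs') (BddC1.const (1 : ℂ))
  simp only [mul_one, s.trace_model_mul_word_cons hz] at h
  rw [integral_add ((s.bddC1_trace_word hzs).integrable _)
    (((s.bddC1_trace_word hzs').integrable _).const_mul _), integral_const_mul] at h
  simp only [fderiv_fun_const, Pi.zero_apply, FunLike.coe_zero, mul_zero, Finset.sum_const_zero,
    integral_zero, add_zero] at h
  rw [← h, mean, mean]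
  ring

lemma mean_nil (hn : 1 ≤ n) : s.mean n [] = 1 := by
  have : (n : ℂ) ≠ 0 := by exact_mod_cast (by omega : n ≠ 0)
  simp only [mean, word_nil, Matrix.trace_one, card_symIdx]
  simp
  field_simp

lemma integrable_pair {us vs : List ℂ} (hus : ∀ z ∈ us, 0 < z.im) (hvs : ∀ z ∈ vs, 0 < z.im) :
    Integrable (fun y => (s.word us y).trace * (s.word vs y).trace
      + s.contractErr (s.word us y) (s.word vs y)) (gaussPi (FreePos n × Bool)) :=
  (((s.bddC1_trace_word hus).mul (s.bddC1_trace_word hvs)).add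
    (s.bddC1_contractErr hus hvs)).integrable _

lemma sum_trace_fderiv_one {a : ℂ} (ha : 0 < a.im) (y : FreePos n × Bool → ℝ) :
    ∑ k, (s.basisMat n k * fderiv ℝ (s.word [a]) y (Pi.single k 1)).trace
      = -((2 * n : ℂ)⁻¹ * ((s.word [a] y).trace * (s.word [a] y).trace
          + s.contractErr (s.word [a] y) (s.word [a] y))) := by
  have h := s.sum_trace_basisMat_fderiv_word_cons 1 ha (zs := []) (by simp) y
  simp only [mul_one, one_mul, fderiv_word_nil, mul_zero, Matrix.trace_zero, Finset.sum_const_zero,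
    zero_sub] at h
  rw [h]
  simp [word]

lemma mean_one {a : ℂ} (ha : 0 < a.im) (hn : 1 ≤ n) :
    1 + a * s.mean n [a] = -s.pairMean n [a] [a] := by
  rw [← s.mean_nil hn, s.mean_cons ha (by simp)]
  simp_rw [s.sum_trace_fderiv_one ha]
  rw [integral_neg, integral_const_mul, pairMean]
  ring

/-- One term per cut: the letter at the cut ends the left piece and begins the right one. -/
lemma mean_two {a b : ℂ} (ha : 0 < a.im) (hb : 0 < b.im) :
    s.mean n [b] + a * s.mean n [a, b]
      = -(s.pairMean n [a] [a, b] + s.pairMean n [a, b] [b]) := by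
  have h : ∀ y : FreePos n × Bool → ℝ,
      ∑ k, (s.basisMat n k * fderiv ℝ (s.word [a, b]) y (Pi.single k 1)).trace
      = -((2 * n : ℂ)⁻¹ * (((s.word [a] y).trace * (s.word [a, b] y).trace
          + s.contractErr (s.word [a] y) (s.word [a, b] y))
        + ((s.word [a, b] y).trace * (s.word [b] y).trace
          + s.contractErr (s.word [a, b] y) (s.word [b] y)))) := by
    intro y
    have h1 := s.sum_trace_basisMat_fderiv_word_cons 1 ha (zs := [b]) (by simpa using hb) y
    have h2 := s.sum_trace_basisMat_fderiv_word_cons (s.res a y) hb (zs := []) (by simp) y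
    simp only [mul_one, one_mul, fderiv_word_nil, mul_zero, Matrix.trace_zero,
      Finset.sum_const_zero, zero_sub] at h1 h2
    rw [h1, h2]
    simp only [word, List.map_cons, List.map_nil, List.prod_cons, List.prod_nil, mul_one]
    ring
  have ha' : ∀ z ∈ [a], 0 < z.im := by simpa using ha
  have hb' : ∀ z ∈ [b], 0 < z.im := by simpa using hb
  have hab : ∀ z ∈ [a, b], 0 < z.im := by simpa using ⟨ha, hb⟩
  rw [s.mean_cons ha hb']
  simp_rw [h]
  rw [integral_neg, integral_const_mul, integral_add (s.integrable_pair ha' hab)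
    (s.integrable_pair hab hb'), pairMean, pairMean]
  ring

lemma mean_three {a b c : ℂ} (ha : 0 < a.im) (hb : 0 < b.im) (hc : 0 < c.im) :
    s.mean n [b, c] + a * s.mean n [a, b, c]
      = -(s.pairMean n [a] [a, b, c] + s.pairMean n [a, b] [b, c]
        + s.pairMean n [a, b, c] [c]) := by
  have h : ∀ y : FreePos n × Bool → ℝ,
      ∑ k, (s.basisMat n k * fderiv ℝ (s.word [a, b, c]) y (Pi.single k 1)).trace
      = -((2 * n : ℂ)⁻¹ * (((s.word [a] y).trace * (s.word [a, b, c] y).trace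
          + s.contractErr (s.word [a] y) (s.word [a, b, c] y))
        + ((s.word [a, b] y).trace * (s.word [b, c] y).trace
          + s.contractErr (s.word [a, b] y) (s.word [b, c] y))
        + ((s.word [a, b, c] y).trace * (s.word [c] y).trace
          + s.contractErr (s.word [a, b, c] y) (s.word [c] y)))) := by
    intro y
    have h1 := s.sum_trace_basisMat_fderiv_word_cons 1 ha (zs := [b, c])
      (by simpa using ⟨hb, hc⟩) y
    have h2 := s.sum_trace_basisMat_fderiv_word_cons (s.res a y) hb (zs := [c])
      (by simpa using hc) y
    have h3 := s.sum_trace_basisMat_fderiv_word_cons (s.res a y * s.res b y) hc (zs := [])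
      (by simp) y
    simp only [mul_one, one_mul, fderiv_word_nil, mul_zero, Matrix.trace_zero,
      Finset.sum_const_zero, zero_sub] at h1 h2 h3
    rw [h1, h2, h3]
    simp only [word, List.map_cons, List.map_nil, List.prod_cons, List.prod_nil, mul_one, mul_assoc]
    ring
  have ha' : ∀ z ∈ [a], 0 < z.im := by simpa using ha
  have hc' : ∀ z ∈ [c], 0 < z.im := by simpa using hc
  have hab : ∀ z ∈ [a, b], 0 < z.im := by simpa using ⟨ha, hb⟩
  have hbc : ∀ z ∈ [b, c], 0 < z.im := by simpa using ⟨hb, hc⟩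
  have habc : ∀ z ∈ [a, b, c], 0 < z.im := by simpa using ⟨ha, hb, hc⟩
  rw [s.mean_cons ha hbc]
  simp_rw [h]
  have h1 := integral_add ((s.integrable_pair (n := n) ha' habc).add (s.integrable_pair hab hbc))
    (s.integrable_pair habc hc')
  simp only [Pi.add_apply] at h1
  rw [integral_neg, integral_const_mul, h1, integral_add
    (s.integrable_pair ha' habc) (s.integrable_pair hab hbc), pairMean, pairMean, pairMean]
  ring

lemma tendsto_pairMean_sub {us vs : List ℂ} (hus : ∀ z ∈ us, 0 < z.im)
    (hvs : ∀ z ∈ vs, 0 < z.im) :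
    Tendsto (fun n => s.pairMean n us vs - s.mean n us * s.mean n vs) atTop (𝓝 0) := by
  obtain ⟨C, hC0, hC⟩ := exists_norm_pairMean_sub_le hus hvs
  refine squeeze_zero_norm' (a := fun n : ℕ => C * (2 * n : ℝ)⁻¹) ?_ ?_
  · filter_upwards [eventually_ge_atTop 1] with n hn using hC s n hn
  · have h : Tendsto (fun n : ℕ => (2 * n : ℝ)⁻¹) atTop (𝓝 0) :=
      tendsto_inv_atTop_zero.comp
        (tendsto_natCast_atTop_atTop.const_mul_atTop (two_pos : (0 : ℝ) < 2))
    simpa using h.const_mul C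

lemma im_trace_word_nonneg {z : ℂ} (hz : 0 < z.im) (y : FreePos n × Bool → ℝ) :
    0 ≤ (s.word [z] y).trace.im := by
  have : s.word [z] y = resolv (s.model n y) z := by simp [word, res]
  rw [this, trace_resolv (s.model_isHermitian y) hz, Complex.im_sum]
  refine Finset.sum_nonneg fun i _ => ?_
  rw [Complex.inv_im]
  simp only [Complex.sub_im, Complex.ofReal_im, zero_sub, neg_neg]
  exact div_nonneg hz.le (Complex.normSq_nonneg _)

lemma im_mean_nonneg {z : ℂ} (hz : 0 < z.im) (n : ℕ) : 0 ≤ (s.mean n [z]).im := by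
  have e : (2 * n : ℂ)⁻¹ = ((2 * n : ℝ)⁻¹ : ℝ) := by push_cast; rfl
  rw [mean, e, Complex.im_ofReal_mul]
  refine mul_nonneg (by positivity) ?_
  have h := Complex.imCLM.integral_comp_comm
    ((s.bddC1_trace_word (n := n) (zs := [z]) (by simpa using hz)).integrable
      (gaussPi (FreePos n × Bool)))
  simp only [Complex.imCLM_apply] at h
  rw [← h]
  exact integral_nonneg fun y => s.im_trace_word_nonneg hz y

/-- The expected normalized trace of the resolvent tends to the solution of
`1 + z f + f² = 0` in the upper half-plane. -/
lemma tendsto_mean_one {z f : ℂ} (hz : 0 < z.im) (hf : 0 ≤ f.im) (hfz : 1 + z * f + f ^ 2 = 0) :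
    Tendsto (fun n => s.mean n [z]) atTop (𝓝 f) := by
  have hz' : ∀ w ∈ [z], 0 < w.im := by simpa using hz
  have h := (s.tendsto_pairMean_sub hz' hz').norm.mul_const z.im⁻¹
  rw [norm_zero, zero_mul] at h
  rw [tendsto_iff_norm_sub_tendsto_zero]
  refine squeeze_zero' (Eventually.of_forall fun _ => norm_nonneg _) ?_ h
  filter_upwards [eventually_ge_atTop 1] with n hn
  have h1 := s.mean_one hz hn
  set m := s.mean n [z]
  have hm : 0 ≤ m.im := s.im_mean_nonneg hz n
  -- The quadratic has roots f and -z - f. The second has imaginary part at most -Im z, so m, with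
  -- Im m ≥ 0, keeps distance at least Im z from it, and a small defect forces m close to f.
  have h2 : s.pairMean n [z] [z] - m * m = -((m - f) * (m + f + z)) := by
    linear_combination h1 - hfz
  have h3 : z.im ≤ ‖m + f + z‖ := by
    refine le_trans ?_ (Complex.im_le_norm _)
    simp only [Complex.add_im]
    linarith
  rw [h2, norm_neg, norm_mul, ← div_eq_mul_inv, le_div_iff₀ hz]
  gcongr

/-- Once the one-letter means are known, the loop equation is asymptotically linear in the mean of
[a, b]; nonvanishing of the limiting coefficient allows division. -/
lemma tendsto_mean_two {a b fa fb r : ℂ} (ha : 0 < a.im) (hb : 0 < b.im)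
    (hfa : Tendsto (fun n => s.mean n [a]) atTop (𝓝 fa))
    (hfb : Tendsto (fun n => s.mean n [b]) atTop (𝓝 fb))
    (h0 : a + fa + fb ≠ 0) (hr : (a + fa + fb) * r = -fb) :
    Tendsto (fun n => s.mean n [a, b]) atTop (𝓝 r) := by
  have ha' : ∀ z ∈ [a], 0 < z.im := by simpa using ha
  have hb' : ∀ z ∈ [b], 0 < z.im := by simpa using hb
  have hab : ∀ z ∈ [a, b], 0 < z.im := by simpa using ⟨ha, hb⟩
  have hc : Tendsto (fun n => a + s.mean n [a] + s.mean n [b]) atTop (𝓝 (a + fa + fb)) :=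
    (tendsto_const_nhds.add hfa).add hfb
  have hd : Tendsto (fun n => -s.mean n [b]
      - (s.pairMean n [a] [a, b] - s.mean n [a] * s.mean n [a, b])
      - (s.pairMean n [a, b] [b] - s.mean n [a, b] * s.mean n [b])) atTop (𝓝 (-fb)) := by
    simpa using (hfb.neg.sub (s.tendsto_pairMean_sub ha' hab)).sub (s.tendsto_pairMean_sub hab hb')
  have h := hd.div hc h0
  rw [← hr, mul_div_cancel_left₀ _ h0] at h
  refine h.congr' ?_
  filter_upwards [hc.eventually_ne h0] with n hn
  rw [Pi.div_apply, div_eq_iff hn]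
  linear_combination -s.mean_two (n := n) ha hb

lemma tendsto_mean_three {a b c fa fc rab rbc t : ℂ} (ha : 0 < a.im) (hb : 0 < b.im)
    (hc : 0 < c.im) (hfa : Tendsto (fun n => s.mean n [a]) atTop (𝓝 fa))
    (hfc : Tendsto (fun n => s.mean n [c]) atTop (𝓝 fc))
    (hrab : Tendsto (fun n => s.mean n [a, b]) atTop (𝓝 rab))
    (hrbc : Tendsto (fun n => s.mean n [b, c]) atTop (𝓝 rbc))
    (h0 : a + fa + fc ≠ 0) (ht : (a + fa + fc) * t = -((1 + rab) * rbc)) :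
    Tendsto (fun n => s.mean n [a, b, c]) atTop (𝓝 t) := by
  have ha' : ∀ z ∈ [a], 0 < z.im := by simpa using ha
  have hc' : ∀ z ∈ [c], 0 < z.im := by simpa using hc
  have hab : ∀ z ∈ [a, b], 0 < z.im := by simpa using ⟨ha, hb⟩
  have hbc : ∀ z ∈ [b, c], 0 < z.im := by simpa using ⟨hb, hc⟩
  have habc : ∀ z ∈ [a, b, c], 0 < z.im := by simpa using ⟨ha, hb, hc⟩
  have hd : Tendsto (fun n => a + s.mean n [a] + s.mean n [c]) atTop (𝓝 (a + fa + fc)) :=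
    (tendsto_const_nhds.add hfa).add hfc
  have he : Tendsto (fun n => -((1 + s.mean n [a, b]) * s.mean n [b, c])
      - (s.pairMean n [a] [a, b, c] - s.mean n [a] * s.mean n [a, b, c])
      - (s.pairMean n [a, b] [b, c] - s.mean n [a, b] * s.mean n [b, c])
      - (s.pairMean n [a, b, c] [c] - s.mean n [a, b, c] * s.mean n [c])) atTop
      (𝓝 (-((1 + rab) * rbc))) := by
    simpa using ((((tendsto_const_nhds.add hrab).mul hrbc).neg.sub
      (s.tendsto_pairMean_sub ha' habc)).sub (s.tendsto_pairMean_sub hab hbc)).sub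
      (s.tendsto_pairMean_sub habc hc')
  have h := he.div hd h0
  rw [← ht, mul_div_cancel_left₀ _ h0] at h
  refine h.congr' ?_
  filter_upwards [hd.eventually_ne h0] with n hn
  rw [Pi.div_apply, div_eq_iff hn]
  linear_combination -s.mean_three (n := n) ha hb hc

end Loop

end AddSymm

/-! ### Variances of squares -/

section GaussSquares

variable {K : Type*} [Fintype K] [DecidableEq K]

/-- Poincaré with ∇(F²) = 2F∇F and the uniform bound on F. -/
lemma gaussVar_sq_le {F : (K → ℝ) → ℂ} (hF : BddC1 F) {b c : ℝ} (hb : ∀ x, ‖F x‖ ≤ b)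
    (h : ∀ x, ∑ k, ‖fderiv ℝ F x (Pi.single k 1)‖ ^ 2 ≤ c) :
    gaussVar (fun x => F x * F x) ≤ 16 * b ^ 2 * c := by
  have hb0 : 0 ≤ b := (norm_nonneg _).trans (hb 0)
  have hc0 : 0 ≤ c := (Finset.sum_nonneg fun k _ => by positivity).trans (h 0)
  refine (gaussVar_le (hF.mul hF) (c := 4 * b ^ 2 * c) fun x => ?_).trans (le_of_eq (by ring))
  have e : ∀ k, ‖fderiv ℝ (fun x => F x * F x) x (Pi.single k 1)‖ ^ 2
      = 4 * ‖F x‖ ^ 2 * ‖fderiv ℝ F x (Pi.single k 1)‖ ^ 2 := by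
    intro k
    rw [hF.fderiv_mul hF, mul_comm _ (F x), ← two_mul, norm_mul, norm_mul]
    norm_num
    ring
  simp_rw [e, ← Finset.mul_sum]
  gcongr
  exacts [hb x, h x]

/-- Poincaré used twice, so that no uniform bound on F enters the constant: the squared gradient of
(F - m)² is 4|F - m|² times that of F, and the mean of |F - m|² is again a variance, at most 4c. The
first 16 is a crude bound for (π/2)². -/
lemma gaussVar_sub_const_sq_le {F : (K → ℝ) → ℂ} (hF : BddC1 F) {c : ℝ}
    (h : ∀ x, ∑ k, ‖fderiv ℝ F x (Pi.single k 1)‖ ^ 2 ≤ c) :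
    gaussVar (fun x => (F x - ∫ y, F y ∂(gaussPi K)) * (F x - ∫ y, F y ∂(gaussPi K)))
      ≤ 16 * 16 * c ^ 2 := by
  set m := ∫ y, F y ∂(gaussPi K)
  have hc0 : 0 ≤ c := (Finset.sum_nonneg fun k _ => by positivity).trans (h 0)
  have hG := hF.sub (BddC1.const m)
  have hd : ∀ x, fderiv ℝ (fun x => F x - m) x = fderiv ℝ F x := fun x => fderiv_sub_const m
  have e : ∀ x k, ‖fderiv ℝ (fun x => (F x - m) * (F x - m)) x (Pi.single k 1)‖ ^ 2
      = 4 * ‖F x - m‖ ^ 2 * ‖fderiv ℝ F x (Pi.single k 1)‖ ^ 2 := by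
    intro x k
    rw [hG.fderiv_mul hG, hd, mul_comm _ (F x - m), ← two_mul, norm_mul, norm_mul]
    norm_num
    ring
  have hv := gaussVar_le hF h
  have hi : Integrable (fun x => ‖F x - m‖ ^ 2) (gaussPi K) := by
    obtain ⟨C, hC⟩ := hG.bdd
    refine Integrable.of_bound (C := C ^ 2)
      ((hG.continuous.norm.pow 2).aestronglyMeasurable) (ae_of_all _ fun x => ?_)
    rw [Real.norm_of_nonneg (by positivity)]
    exact pow_le_pow_left₀ (norm_nonneg _) (hC x) 2
  have hI : ∫ x, ∑ k, ‖fderiv ℝ (fun x => (F x - m) * (F x - m)) x (Pi.single k 1)‖ ^ 2 ∂(gaussPi K)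
      ≤ 4 * c * gaussVar F := by
    rw [gaussVar, ← integral_const_mul]
    refine integral_mono_of_nonneg (ae_of_all _ fun x => Finset.sum_nonneg fun k _ => by positivity)
      (hi.const_mul _) (ae_of_all _ fun x => ?_)
    simp only [e, ← Finset.mul_sum]
    nlinarith [mul_le_mul_of_nonneg_left (h x) (by positivity : 0 ≤ 4 * ‖F x - m‖ ^ 2)]
  have hp := poincare_gaussPi (hG.mul hG)
  have hpi : (Real.pi / 2) ^ 2 ≤ 16 := by nlinarith [Real.pi_pos, Real.pi_le_four]
  have hn : 0 ≤ ∫ x, ∑ k, ‖fderiv ℝ (fun x => (F x - m) * (F x - m)) x (Pi.single k 1)‖ ^ 2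
      ∂(gaussPi K) := integral_nonneg fun x => Finset.sum_nonneg fun k _ => by positivity
  refine hp.trans ?_
  calc _ ≤ 16 * (4 * c * (4 * c)) := by
        refine mul_le_mul hpi (hI.trans ?_) hn (by norm_num)
        gcongr
    _ = _ := by ring

end GaussSquares

/-! ### Covariance of resolvent traces -/

namespace AddSymm

section Covariance

open scoped Matrix.Norms.L2Operator

variable {n : ℕ} (s : AddSymm)

/-- The trace of the resolvent, centred. -/
def ctr (s : AddSymm) {n : ℕ} (z : ℂ) (y : FreePos n × Bool → ℝ) : ℂ :=
  (s.word [z] y).trace - ∫ y, (s.word [z] y).trace ∂(gaussPi (FreePos n × Bool))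

lemma bddC1_ctr {z : ℂ} (hz : 0 < z.im) : BddC1 (s.ctr z (n := n)) :=
  (s.bddC1_trace_word (by simpa using hz)).sub (BddC1.const _)

lemma integral_ctr {z : ℂ} (hz : 0 < z.im) :
    ∫ y, s.ctr z y ∂(gaussPi (FreePos n × Bool)) = 0 := by
  simp only [ctr]
  rw [integral_sub ((s.bddC1_trace_word (by simpa using hz)).integrable _) (integrable_const _)]
  simp

/-- The covariance of the traces of two resolvents. -/
def trCov (s : AddSymm) (n : ℕ) (a b : ℂ) : ℂ :=
  ∫ y, s.ctr a y * s.ctr b y ∂(gaussPi (FreePos n × Bool))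

lemma integral_trace_mul_ctr {a b : ℂ} (ha : 0 < a.im) (hb : 0 < b.im) :
    ∫ y, (s.word [a] y).trace * s.ctr b y ∂(gaussPi (FreePos n × Bool)) = s.trCov n a b := by
  have ha' : ∀ z ∈ [a], 0 < z.im := by simpa using ha
  have h : ∀ y : FreePos n × Bool → ℝ, (s.word [a] y).trace * s.ctr b y
      = s.ctr a y * s.ctr b y
        + (∫ y, (s.word [a] y).trace ∂(gaussPi (FreePos n × Bool))) * s.ctr b y := by
    intro y
    simp only [ctr]
    ring
  simp_rw [h]
  rw [integral_add (((s.bddC1_ctr ha).mul (s.bddC1_ctr hb)).integrable _)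
    (((s.bddC1_ctr hb).integrable _).const_mul _), integral_const_mul, s.integral_ctr hb,
    mul_zero, add_zero, trCov]

lemma fderiv_ctr {b : ℂ} (hb : 0 < b.im) (y v : FreePos n × Bool → ℝ) :
    fderiv ℝ (s.ctr b) y v = -(s.model n v * s.word [b, b] y).trace := by
  have hb' : ∀ z ∈ [b], 0 < z.im := by simpa using hb
  have h1 : fderiv ℝ (s.ctr b (n := n)) y
      = fderiv ℝ (fun y : FreePos n × Bool → ℝ => (s.word [b] y).trace) y := fderiv_sub_const _
  have h2 := (s.bddC1_word (n := n) hb').fderiv_clm_comp (traceMul 1) y v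
  simp only [traceMul_apply, mul_one] at h2
  rw [h1, h2, s.fderiv_word_cons hb (by simp), fderiv_word_nil, mul_zero, zero_sub,
    Matrix.trace_neg, word_nil, mul_one, mul_assoc, Matrix.trace_mul_comm, mul_assoc]
  simp [word]

/-- The loop equation for the covariance of two resolvent traces. -/
lemma trCov_loop {a b : ℂ} (ha : 0 < a.im) (hb : 0 < b.im) (hn : 1 ≤ n) :
    (a + 2 * s.mean n [a]) * s.trCov n a b =
      (2 * n : ℂ)⁻¹ * (∫ y, s.contractErr' (s.word [a] y) (s.word [b, b] y)
          ∂(gaussPi (FreePos n × Bool))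
        - ∫ y, s.ctr a y * s.ctr a y * s.ctr b y ∂(gaussPi (FreePos n × Bool))
        - ∫ y, s.contractErr (s.word [a] y) (s.word [a] y) * s.ctr b y
          ∂(gaussPi (FreePos n × Bool))) - 2 * s.mean n [a, b, b] := by
  have ha' : ∀ z ∈ [a], 0 < z.im := by simpa using ha
  have hb' : ∀ z ∈ [b], 0 < z.im := by simpa using hb
  have hbb : ∀ z ∈ [b, b], 0 < z.im := by simpa using hb
  have habb : ∀ z ∈ [a, b, b], 0 < z.im := by simpa using ⟨ha, hb⟩
  have hN : (2 * n : ℂ) ≠ 0 := by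
    have : (n : ℂ) ≠ 0 := by exact_mod_cast (by omega : n ≠ 0)
    simpa using this
  set μ := gaussPi (FreePos n × Bool)
  have bc := s.bddC1_ctr (n := n) hb
  have bca := s.bddC1_ctr (n := n) ha
  have bT := s.bddC1_trace_word (n := n) ha'
  have bE := s.bddC1_contractErr (n := n) ha' ha'
  have h := s.integral_trace_model_mul (s.bddC1_word (n := n) ha') bc
  simp_rw [s.trace_model_mul_word_cons ha, s.sum_trace_fderiv_one ha] at h
  have hm : (∫ y, (s.word [a] y).trace ∂μ) = 2 * n * s.mean n [a] := by
    rw [mean, mul_inv_cancel_left₀ hN]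
  have hl : ∫ y, ((s.word [] y).trace + a * (s.word [a] y).trace) * s.ctr b y ∂μ
      = a * s.trCov n a b := by
    have e : ∀ y : FreePos n × Bool → ℝ,
        ((s.word [] y).trace + a * (s.word [a] y).trace) * s.ctr b y
        = (Matrix.trace (1 : Matrix (SymIdx n) (SymIdx n) ℂ)) * s.ctr b y
          + a * ((s.word [a] y).trace * s.ctr b y) := by
      intro y
      rw [word_nil]
      ring
    simp_rw [e]
    rw [integral_add ((bc.integrable _).const_mul _) (((bT.mul bc).integrable _).const_mul _),
      integral_const_mul, integral_const_mul, s.integral_ctr hb, s.integral_trace_mul_ctr ha hb]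
    ring
  have hr1 : ∫ y, -((2 * n : ℂ)⁻¹ * ((s.word [a] y).trace * (s.word [a] y).trace
        + s.contractErr (s.word [a] y) (s.word [a] y))) * s.ctr b y ∂μ
      = -((2 * n : ℂ)⁻¹ * (∫ y, s.ctr a y * s.ctr a y * s.ctr b y ∂μ
        + 2 * (2 * n * s.mean n [a]) * s.trCov n a b
        + ∫ y, s.contractErr (s.word [a] y) (s.word [a] y) * s.ctr b y ∂μ)) := by
    -- With T the trace and m its mean, T² = (T - m)² + 2mT - m². The linear term moves to the left
    -- side of the loop equation, and the constant integrates to zero against the centred trace.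
    have e : ∀ y : FreePos n × Bool → ℝ,
        -((2 * n : ℂ)⁻¹ * ((s.word [a] y).trace * (s.word [a] y).trace
        + s.contractErr (s.word [a] y) (s.word [a] y))) * s.ctr b y
        = -(2 * n : ℂ)⁻¹ * ((s.ctr a y * s.ctr a y * s.ctr b y
          + (2 * (2 * n * s.mean n [a])) * ((s.word [a] y).trace * s.ctr b y))
          + (s.contractErr (s.word [a] y) (s.word [a] y) * s.ctr b y
          - (2 * n * s.mean n [a]) ^ 2 * s.ctr b y)) := by
      intro y
      simp only [ctr.eq_def s a, ← hm]
      ring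
    have i1 : Integrable (fun y => s.ctr a y * s.ctr a y * s.ctr b y) μ :=
      ((bca.mul bca).mul bc).integrable _
    have i2 : Integrable (fun y => (2 * (2 * n * s.mean n [a])) *
        ((s.word [a] y).trace * s.ctr b y)) μ := ((bT.mul bc).integrable _).const_mul _
    have i3 : Integrable (fun y => s.contractErr (s.word [a] y) (s.word [a] y) * s.ctr b y) μ :=
      (bE.mul bc).integrable _
    have i4 : Integrable (fun y => (2 * n * s.mean n [a]) ^ 2 * s.ctr b y) μ :=
      (bc.integrable _).const_mul _
    have i12 : Integrable (fun y => s.ctr a y * s.ctr a y * s.ctr b y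
          + (2 * (2 * n * s.mean n [a])) * ((s.word [a] y).trace * s.ctr b y)) μ := i1.add i2
    have i34 : Integrable (fun y => s.contractErr (s.word [a] y) (s.word [a] y) * s.ctr b y
          - (2 * n * s.mean n [a]) ^ 2 * s.ctr b y) μ := i3.sub i4
    simp_rw [e]
    rw [integral_const_mul, integral_add i12 i34, integral_add i1 i2, integral_sub i3 i4,
      integral_const_mul, integral_const_mul, s.integral_ctr hb, s.integral_trace_mul_ctr ha hb]
    ring
  have hr2 : ∫ y, ∑ k, (s.basisMat n k * s.word [a] y).trace
        * fderiv ℝ (s.ctr b) y (Pi.single k 1) ∂μ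
      = -(2 * s.mean n [a, b, b]) + (2 * n : ℂ)⁻¹ *
        ∫ y, s.contractErr' (s.word [a] y) (s.word [b, b] y) ∂μ := by
    have e : ∀ y : FreePos n × Bool → ℝ, ∑ k, (s.basisMat n k * s.word [a] y).trace
        * fderiv ℝ (s.ctr b) y (Pi.single k 1)
        = (2 * n : ℂ)⁻¹ * (s.contractErr' (s.word [a] y) (s.word [b, b] y)
          - 2 * (s.word [a, b, b] y).trace) := by
      intro y
      simp_rw [s.fderiv_ctr hb, model_single, mul_neg, Finset.sum_neg_distrib]
      rw [s.sum_trace_mul_trace_of_inv _ (s.inv_word hbb y),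
        show s.word [a, b, b] y = s.word [a] y * s.word [b, b] y from s.word_append [a] [b, b] y]
      ring
    have iE : Integrable (fun y => s.contractErr' (s.word [a] y) (s.word [b, b] y)) μ := by
      cases s
      · simp_rw [contractErr'_flip]
        exact integrable_finsetSum _ fun x _ => ((flip.bddC1_word_entry ha' _ _).mul
          (flip.bddC1_word_entry hbb _ _)).integrable _
      · simp_rw [contractErr'_central]
        exact integrable_const _
    simp_rw [e]
    rw [integral_const_mul, integral_sub iE
      (((s.bddC1_trace_word habb).integrable _).const_mul _), integral_const_mul, mean]
    ring
  rw [hl, hr1, hr2] at h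
  linear_combination h - 2 * s.mean n [a] * s.trCov n a b * inv_mul_cancel₀ hN

/-- A covariance between the square of a centred trace and a trace, both of bounded variance. -/
lemma exists_norm_integral_ctr_cube_le {a b : ℂ} (ha : 0 < a.im) (hb : 0 < b.im) :
    ∃ C, 0 ≤ C ∧ ∀ (s : AddSymm) (n : ℕ),
      ‖∫ y, s.ctr a y * s.ctr a y * s.ctr b y ∂(gaussPi (FreePos n × Bool))‖ ≤ C := by
  have ha' : ∀ z ∈ [a], 0 < z.im := by simpa using ha
  have hb' : ∀ z ∈ [b], 0 < z.im := by simpa using hb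
  obtain ⟨A, hA0, hA⟩ := exists_grad_trace_word_le ha'
  obtain ⟨B, hB0, hB⟩ := exists_grad_trace_word_le hb'
  refine ⟨√(16 * 16 * A ^ 2) * √(4 * B), by positivity, fun s n => ?_⟩
  have bca := s.bddC1_ctr (n := n) ha
  refine (norm_gaussCov_le (bca.mul bca) (s.bddC1_trace_word (n := n) hb')).trans ?_
  gcongr
  · exact gaussVar_sub_const_sq_le (s.bddC1_trace_word (n := n) ha') (hA s n)
  · exact gaussVar_le (s.bddC1_trace_word (n := n) hb') (hB s n)

/-- For the flip, a sum of 2n products of antidiagonal entries. These are centred with variance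
O(1/n), so each expectation is O(1/n). -/
lemma exists_norm_integral_contractErr'_le {us vs : List ℂ} (hus : ∀ z ∈ us, 0 < z.im)
    (hvs : ∀ z ∈ vs, 0 < z.im) : ∃ C, 0 ≤ C ∧ ∀ (s : AddSymm) (n : ℕ),
      ‖∫ y, s.contractErr' (s.word us y) (s.word vs y) ∂(gaussPi (FreePos n × Bool))‖ ≤ C := by
  obtain ⟨A, hA0, hA⟩ := exists_grad_word_entry_le hus
  obtain ⟨B, hB0, hB⟩ := exists_grad_word_entry_le hvs
  refine ⟨√(4 * A) * √(4 * B), by positivity, fun s n => ?_⟩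
  cases s
  · simp_rw [contractErr'_flip]
    have bu := fun x y => flip.bddC1_word_entry (n := n) hus x y
    have bv := fun x y => flip.bddC1_word_entry (n := n) hvs x y
    rw [integral_finsetSum _ fun x _ => ((bu _ _).mul (bv _ _)).integrable _]
    have key : ∀ x : SymIdx n, ‖∫ y, flip.word us y (-x) x * flip.word vs y x (-x)
        ∂(gaussPi (FreePos n × Bool))‖ ≤ √(4 * A) * √(4 * B) * (2 * n : ℝ)⁻¹ := by
      intro x
      have h := norm_gaussCov_le (bu (-x) x) (bv x (-x))
      rw [flip.integral_word_anti hvs] at h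
      simp only [sub_zero] at h
      refine h.trans ?_
      have h1 := Real.sqrt_le_sqrt (gaussVar_le (bu (-x) x) (hA flip n (-x) x))
      have h2 := Real.sqrt_le_sqrt (gaussVar_le (bv x (-x)) (hB flip n x (-x)))
      rw [← mul_assoc, Real.sqrt_mul (by positivity)] at h1 h2
      refine (mul_le_mul h1 h2 (Real.sqrt_nonneg _) (by positivity)).trans (le_of_eq ?_)
      have : √((2 * n : ℝ)⁻¹) * √((2 * n : ℝ)⁻¹) = (2 * n : ℝ)⁻¹ :=
        Real.mul_self_sqrt (by positivity)
      linear_combination √(4 * A) * √(4 * B) * this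
    refine (norm_sum_le _ _).trans ((Finset.sum_le_sum fun x _ => key x).trans ?_)
    rw [Finset.sum_const, Finset.card_univ, card_symIdx, nsmul_eq_mul]
    push_cast
    have := two_mul_inv_mul_le n
    have h0 : 0 ≤ √(4 * A) * √(4 * B) := by positivity
    nlinarith [mul_le_mul_of_nonneg_left this h0]
  · simp_rw [contractErr'_central]
    simp only [integral_zero, norm_zero]
    positivity

/-- For the flip, the trace part is a covariance of size O(1), and each of the 2n squared diagonal
entries has standard deviation O(n^(-1/2)), which gives O(√n) in total. In the central case the
error is the square of a centred antidiagonal sum, whose variance is O(1). -/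
lemma exists_norm_integral_contractErr_mul_ctr_le {a b : ℂ} (ha : 0 < a.im) (hb : 0 < b.im) :
    ∃ C, 0 ≤ C ∧ ∀ (s : AddSymm) (n : ℕ), 1 ≤ n →
      ‖∫ y, s.contractErr (s.word [a] y) (s.word [a] y) * s.ctr b y
        ∂(gaussPi (FreePos n × Bool))‖ ≤ C * √(2 * n) := by
  have ha' : ∀ z ∈ [a], 0 < z.im := by simpa using ha
  have haa : ∀ z ∈ [a, a], 0 < z.im := by simpa using ha
  have hb' : ∀ z ∈ [b], 0 < z.im := by simpa using hb
  obtain ⟨B, hB0, hB⟩ := exists_grad_trace_word_le hb'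
  obtain ⟨A, hA0, hA⟩ := exists_grad_trace_word_le haa
  obtain ⟨A', hA0', hA'⟩ := exists_grad_anti_word_le ha'
  obtain ⟨A'', hA0'', hA''⟩ := exists_grad_word_entry_le ha'
  obtain ⟨D, hD0, hD⟩ := exists_norm_word_le ha'
  refine ⟨√(4 * A) * √(4 * B) + √(16 * 16 * A' ^ 2) * √(4 * B)
    + √(16 * D ^ 2 * A'') * √(4 * B), by positivity, fun s n hn => ?_⟩
  have hn' : (1 : ℝ) ≤ n := by exact_mod_cast hn
  have hsq : 1 ≤ √(2 * n : ℝ) := Real.one_le_sqrt.2 (by linarith)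
  have hbv : √(gaussVar fun y : FreePos n × Bool → ℝ => (s.word [b] y).trace) ≤ √(4 * B) :=
    Real.sqrt_le_sqrt (gaussVar_le (s.bddC1_trace_word (n := n) hb') (hB s n))
  have p1 : 0 ≤ √(4 * A) * √(4 * B) := by positivity
  have p2 : 0 ≤ √(16 * 16 * A' ^ 2) * √(4 * B) := by positivity
  have p3 : 0 ≤ √(16 * D ^ 2 * A'') * √(4 * B) := by positivity
  cases s
  · have e : ∀ y : FreePos n × Bool → ℝ,
        flip.contractErr (flip.word [a] y) (flip.word [a] y) * flip.ctr b y
        = (flip.word [a, a] y).trace * flip.ctr b y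
          - ∑ x, flip.word [a] y x x * flip.word [a] y x x * flip.ctr b y := by
      intro y
      rw [contractErr_flip _ (flip.inv_word ha' y), sub_mul, Finset.sum_mul,
        show flip.word [a, a] y = flip.word [a] y * flip.word [a] y from flip.word_append [a] [a] y]
    have bx := fun x => flip.bddC1_word_entry (n := n) ha' x x
    have bc := flip.bddC1_ctr (n := n) hb
    simp_rw [e]
    rw [integral_sub (((flip.bddC1_trace_word haa).mul bc).integrable _)
      (integrable_finsetSum _ fun x _ => (((bx x).mul (bx x)).mul bc).integrable _),
      integral_finsetSum _ fun x _ => (((bx x).mul (bx x)).mul bc).integrable _]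
    have h1 : ‖∫ y, (flip.word [a, a] y).trace * flip.ctr b y ∂(gaussPi (FreePos n × Bool))‖
        ≤ √(4 * A) * √(4 * B) :=
      (norm_gaussCov_le (flip.bddC1_trace_word (n := n) haa)
        (flip.bddC1_trace_word (n := n) hb')).trans
        (mul_le_mul (Real.sqrt_le_sqrt (gaussVar_le (flip.bddC1_trace_word (n := n) haa)
          (hA flip n))) hbv (Real.sqrt_nonneg _) (Real.sqrt_nonneg _))
    have h2 : ∀ x : SymIdx n, ‖∫ y, flip.word [a] y x x * flip.word [a] y x x * flip.ctr b y
        ∂(gaussPi (FreePos n × Bool))‖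
        ≤ √(16 * D ^ 2 * A'') * √(4 * B) * √((2 * n : ℝ)⁻¹) := by
      intro x
      have h3 := Real.sqrt_le_sqrt (gaussVar_sq_le (bx x)
        (fun y => (norm_entry_le _ _ _).trans (hD flip n y)) (hA'' flip n x x))
      rw [← mul_assoc, Real.sqrt_mul (by positivity)] at h3
      refine (norm_gaussCov_le ((bx x).mul (bx x)) (flip.bddC1_trace_word (n := n) hb')).trans
        ((mul_le_mul h3 hbv (Real.sqrt_nonneg _) (by positivity)).trans (le_of_eq (by ring)))
    have h4 : ‖∑ x : SymIdx n, ∫ y, flip.word [a] y x x * flip.word [a] y x x * flip.ctr b y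
        ∂(gaussPi (FreePos n × Bool))‖ ≤ √(16 * D ^ 2 * A'') * √(4 * B) * √(2 * n) := by
      refine (norm_sum_le _ _).trans ((Finset.sum_le_sum fun x _ => h2 x).trans (le_of_eq ?_))
      rw [Finset.sum_const, Finset.card_univ, card_symIdx, nsmul_eq_mul, Real.sqrt_inv]
      push_cast
      have h5 : √(2 * n : ℝ) ≠ 0 := by positivity
      field_simp
      rw [Real.sq_sqrt (by positivity)]
      ring
    refine (norm_sub_le _ _).trans ((add_le_add h1 h4).trans ?_)
    nlinarith
  · simp_rw [contractErr_central]
    have ba := central.bddC1_anti_word (n := n) ha'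
    have h1 := gaussVar_sub_const_sq_le ba (hA' central n)
    rw [central.integral_anti_word ha'] at h1
    simp only [sub_zero] at h1
    have h2 := (norm_gaussCov_le (ba.mul ba) (central.bddC1_trace_word (n := n) hb')).trans
      (mul_le_mul (Real.sqrt_le_sqrt h1) hbv (Real.sqrt_nonneg _) (Real.sqrt_nonneg _))
    refine h2.trans ?_
    nlinarith

/-- The limit of the covariance of two resolvent traces. -/
lemma tendsto_trCov {a b fa t c : ℂ} (ha : 0 < a.im) (hb : 0 < b.im)
    (hfa : Tendsto (fun n => s.mean n [a]) atTop (𝓝 fa))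
    (ht : Tendsto (fun n => s.mean n [a, b, b]) atTop (𝓝 t))
    (h0 : a + 2 * fa ≠ 0) (hc : (a + 2 * fa) * c = -(2 * t)) :
    Tendsto (fun n => s.trCov n a b) atTop (𝓝 c) := by
  obtain ⟨A, hA0, hA⟩ := exists_norm_integral_ctr_cube_le ha hb
  obtain ⟨B, hB0, hB⟩ := exists_norm_integral_contractErr'_le (us := [a]) (vs := [b, b])
    (by simpa using ha) (by simpa using hb)
  obtain ⟨D, hD0, hD⟩ := exists_norm_integral_contractErr_mul_ctr_le ha hb
  have hN : Tendsto (fun n : ℕ => (2 * n : ℝ)) atTop atTop :=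
    tendsto_natCast_atTop_atTop.const_mul_atTop two_pos
  have hs : Tendsto (fun n : ℕ => (√(2 * n : ℝ))⁻¹) atTop (𝓝 0) :=
    tendsto_inv_atTop_zero.comp (Real.tendsto_sqrt_atTop.comp hN)
  -- The bracket is O(√n), the prefactor 1/(2n).
  have herr : Tendsto (fun n : ℕ => (2 * n : ℂ)⁻¹ *
      (∫ y, s.contractErr' (s.word [a] y) (s.word [b, b] y) ∂(gaussPi (FreePos n × Bool))
        - ∫ y, s.ctr a y * s.ctr a y * s.ctr b y ∂(gaussPi (FreePos n × Bool))
        - ∫ y, s.contractErr (s.word [a] y) (s.word [a] y) * s.ctr b y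
          ∂(gaussPi (FreePos n × Bool)))) atTop (𝓝 0) := by
    refine squeeze_zero_norm' (a := fun n : ℕ => (A + B + D) * (√(2 * n : ℝ))⁻¹) ?_
      (by simpa using hs.const_mul (A + B + D))
    filter_upwards [eventually_ge_atTop 1] with n hn
    have hn' : (1 : ℝ) ≤ n := by exact_mod_cast hn
    have hsq : 1 ≤ √(2 * n : ℝ) := Real.one_le_sqrt.2 (by linarith)
    have hbd := (norm_sub_le _ _).trans (add_le_add ((norm_sub_le _ _).trans
      (add_le_add (hB s n) (hA s n))) (hD s n hn))
    have h5 : ‖(2 * n : ℂ)⁻¹‖ = (2 * n : ℝ)⁻¹ := by rw [norm_inv, norm_mul]; simp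
    rw [norm_mul, h5]
    calc _ ≤ (2 * n : ℝ)⁻¹ * ((A + B + D) * √(2 * n)) := by
          gcongr
          refine hbd.trans ?_
          nlinarith
      _ = _ := by
          have h6 : √(2 * n : ℝ) ≠ 0 := by positivity
          have h7 : (2 * n : ℝ)⁻¹ = (√(2 * n))⁻¹ * (√(2 * n))⁻¹ := by
            rw [← mul_inv, Real.mul_self_sqrt (by positivity)]
          rw [h7]
          field_simp
  have hd : Tendsto (fun n => a + 2 * s.mean n [a]) atTop (𝓝 (a + 2 * fa)) :=
    tendsto_const_nhds.add (hfa.const_mul 2)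
  have h := (herr.sub (ht.const_mul 2)).div hd h0
  rw [zero_sub, ← hc, mul_div_cancel_left₀ _ h0] at h
  refine h.congr' ?_
  filter_upwards [hd.eventually_ne h0, eventually_ge_atTop 1] with n hn0 hn
  rw [Pi.div_apply, div_eq_iff hn0]
  linear_combination -s.trCov_loop (n := n) ha hb hn

/-- The variance of a resolvent trace is bounded uniformly in the size of the matrix. -/
lemma exists_gaussVar_trace_le {z : ℂ} (hz : 0 < z.im) : ∃ C, 0 ≤ C ∧ ∀ (s : AddSymm) (n : ℕ),
    gaussVar (fun y : FreePos n × Bool → ℝ => (s.word [z] y).trace) ≤ C := by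
  have hz' : ∀ w ∈ [z], 0 < w.im := by simpa using hz
  obtain ⟨A, hA0, hA⟩ := exists_grad_trace_word_le hz'
  exact ⟨4 * A, by positivity, fun s n => gaussVar_le (s.bddC1_trace_word hz') (hA s n)⟩

end Covariance

end AddSymm

/-! ### The Stieltjes transform of the semicircle law -/

section Semicircle

lemma integral_semicircleLaw {V : Type*} [NormedAddCommGroup V] [NormedSpace ℝ V] (g : ℝ → V) :
    ∫ l, g l ∂semicircleLaw
      = ∫ l in (-2 : ℝ)..2, ((2 * Real.pi)⁻¹ * √(4 - l ^ 2)) • g l := by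
  have hm : Measurable fun l : ℝ =>
      (Set.Icc (-2 : ℝ) 2).indicator (fun l => (2 * Real.pi)⁻¹ * √(4 - l ^ 2)) l := by
    refine Measurable.indicator ?_ measurableSet_Icc
    fun_prop
  have h0 : ∀ l : ℝ, 0 ≤ (Set.Icc (-2 : ℝ) 2).indicator
      (fun l => (2 * Real.pi)⁻¹ * √(4 - l ^ 2)) l := fun l =>
    Set.indicator_nonneg (fun l _ => by have := Real.pi_pos; positivity) l
  rw [semicircleLaw, integral_withDensity_eq_integral_toReal_smul hm.ennreal_ofReal
    (ae_of_all _ fun _ => ENNReal.ofReal_lt_top)]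
  simp_rw [ENNReal.toReal_ofReal (h0 _), ← Set.indicator_smul_apply_left]
  rw [integral_indicator measurableSet_Icc, integral_Icc_eq_integral_Ioc,
    intervalIntegral.integral_of_le (by norm_num)]

/-- The substitution l = 2 cos t rationalizes the density, since √(4 - l²) = 2 sin t on [0, π]. -/
lemma integral_semicircleLaw_eq_cos {V : Type*} [NormedAddCommGroup V] [NormedSpace ℝ V]
    {g : ℝ → V} (hg : Continuous g) :
    ∫ l, g l ∂semicircleLaw
      = ∫ t in (0 : ℝ)..Real.pi, (2 / Real.pi * Real.sin t ^ 2) • g (2 * Real.cos t) := by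
  have h := intervalIntegral.integral_deriv_smul_comp (a := 0) (b := Real.pi)
    (f := fun t => 2 * Real.cos t) (f' := fun t => 2 * -Real.sin t)
    (g := fun l => ((2 * Real.pi)⁻¹ * √(4 - l ^ 2)) • g l)
    (fun t _ => (Real.hasDerivAt_cos t).const_mul 2) (by fun_prop) (by fun_prop)
  simp only [Real.cos_zero, Real.cos_pi, mul_one, mul_neg] at h
  rw [integral_semicircleLaw, intervalIntegral.integral_symm, ← h, ← intervalIntegral.integral_neg]
  refine intervalIntegral.integral_congr fun t ht => ?_
  rw [Set.uIcc_of_le Real.pi_pos.le] at ht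
  have hs := Real.sin_nonneg_of_mem_Icc ht
  have h1 : √(4 - (2 * Real.cos t) ^ 2) = 2 * Real.sin t := by
    rw [show 4 - (2 * Real.cos t) ^ 2 = (2 * Real.sin t) ^ 2 by
      nlinarith [Real.sin_sq_add_cos_sq t], Real.sqrt_sq (by positivity)]
  simp only [Function.comp_apply, h1]
  rw [smul_smul, ← neg_smul]
  congr 1
  have := Real.pi_ne_zero
  field_simp

instance : IsProbabilityMeasure semicircleLaw := by
  have h1 : ∫ _, (1 : ℝ) ∂semicircleLaw = 1 := by
    rw [integral_semicircleLaw_eq_cos continuous_const]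
    simp only [smul_eq_mul, mul_one]
    rw [intervalIntegral.integral_const_mul, integral_sin_sq]
    have := Real.pi_ne_zero
    simp
  rw [integral_const, smul_eq_mul, mul_one] at h1
  refine ⟨?_⟩
  rw [← ENNReal.toReal_eq_one_iff]
  exact h1

/-- The Poisson kernel identity in the form needed for the semicircle law. -/
lemma integral_sin_sq_div {m : ℂ} (hm0 : m ≠ 0) (hm : ‖m‖ < 1) :
    ∫ t in (0 : ℝ)..Real.pi, (Real.sin t : ℂ) ^ 2 / (1 + 2 * m * Real.cos t + m ^ 2)
      = (Real.pi / 2 : ℂ) := by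
  have hne : ∀ w : ℂ, ‖w‖ = 1 → 0 < (1 + m * w).re := by
    intro w hw
    have h1 : |(m * w).re| ≤ ‖m * w‖ := Complex.abs_re_le_norm _
    rw [norm_mul, hw, mul_one] at h1
    have := (abs_le.1 h1).1
    simp only [Complex.add_re, Complex.one_re]
    linarith
  have hslit : ∀ w : ℂ, ‖w‖ = 1 → 1 + m * w ∈ Complex.slitPlane := fun w hw =>
    Or.inl (hne w hw)
  have hn0 : ∀ w : ℂ, ‖w‖ = 1 → 1 + m * w ≠ 0 := fun w hw h => by
    have := hne w hw
    rw [h] at this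
    simp at this
  have hnp : ∀ t : ℝ, ‖Complex.exp (t * Complex.I)‖ = 1 := Complex.norm_exp_ofReal_mul_I
  have hnm : ∀ t : ℝ, ‖Complex.exp (-t * Complex.I)‖ = 1 := fun t => by
    have := Complex.norm_exp_ofReal_mul_I (-t)
    push_cast at this
    exact this
  -- Since ‖m‖ < 1, both factors lie in the right half-plane, so the principal logarithm is
  -- differentiable along them.
  have hfac : ∀ t : ℝ, 1 + 2 * m * Real.cos t + m ^ 2
      = (1 + m * Complex.exp (t * Complex.I)) * (1 + m * Complex.exp (-t * Complex.I)) := by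
    intro t
    have h1 : Complex.exp (t * Complex.I) * Complex.exp (-t * Complex.I) = 1 := by
      rw [← Complex.exp_add]
      simp
    have h2 : (2 * Real.cos t : ℂ) = Complex.exp (t * Complex.I) + Complex.exp (-t * Complex.I) := by
      rw [Complex.ofReal_cos, Complex.two_cos]
    linear_combination m * h2 - m ^ 2 * h1
  have hD : ∀ t : ℝ, 1 + 2 * m * Real.cos t + m ^ 2 ≠ 0 := fun t => by
    rw [hfac]
    exact mul_ne_zero (hn0 _ (hnp t)) (hn0 _ (hnm t))
  -- a primitive of `(1 - m²) / (1 + 2 m cos t + m²)`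
  have hΦ : ∀ t : ℝ, HasDerivAt (fun t : ℝ => (t : ℂ)
      + Complex.I * Complex.log (1 + m * Complex.exp (t * Complex.I))
      - Complex.I * Complex.log (1 + m * Complex.exp (-t * Complex.I)))
      ((1 - m ^ 2) / (1 + 2 * m * Real.cos t + m ^ 2)) t := by
    intro t
    have h0 : HasDerivAt (fun t : ℝ => (t : ℂ)) 1 t := Complex.ofRealCLM.hasDerivAt
    have hp := ((((h0.mul_const Complex.I).cexp).const_mul m).const_add 1).clog_real
      (hslit _ (hnp t))
    have hq := ((((h0.neg.mul_const Complex.I).cexp).const_mul m).const_add 1).clog_real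
      (hslit _ (hnm t))
    refine ((h0.add (hp.const_mul Complex.I)).sub (hq.const_mul Complex.I)).congr_deriv ?_
    rw [hfac]
    have h1 := hn0 _ (hnp t)
    have h2 := hn0 _ (hnm t)
    have h3 : Complex.exp (t * Complex.I) * Complex.exp (-t * Complex.I) = 1 := by
      rw [← Complex.exp_add]
      simp
    simp only [Pi.neg_apply]
    set u := Complex.exp (t * Complex.I)
    set v := Complex.exp (-t * Complex.I)
    field_simp
    have hI := Complex.I_sq
    linear_combination (m * u + m * v + 2 * m ^ 2 * u * v) * hI - m ^ 2 * h3
  -- With D = 1 + 2m cos t + m², one has 4m² sin² t = -(1 - m²)² + (1 + m² - 2m cos t) D; divide by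
  -- D and integrate termwise.
  have hH : ∀ t : ℝ, HasDerivAt (fun t : ℝ => -(1 - m ^ 2) * ((t : ℂ)
      + Complex.I * Complex.log (1 + m * Complex.exp (t * Complex.I))
      - Complex.I * Complex.log (1 + m * Complex.exp (-t * Complex.I)))
      + (1 + m ^ 2) * t - 2 * m * (Real.sin t : ℂ))
      (4 * m ^ 2 * ((Real.sin t : ℂ) ^ 2 / (1 + 2 * m * Real.cos t + m ^ 2))) t := by
    intro t
    have h0 : HasDerivAt (fun t : ℝ => (t : ℂ)) 1 t := Complex.ofRealCLM.hasDerivAt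
    refine ((((hΦ t).const_mul (-(1 - m ^ 2))).add (h0.const_mul (1 + m ^ 2))).sub
      ((Real.hasDerivAt_sin t).ofReal_comp.const_mul (2 * m))).congr_deriv ?_
    have h1 := hD t
    have hsc : (Real.sin t : ℂ) ^ 2 = 1 - (Real.cos t : ℂ) ^ 2 := by
      exact_mod_cast Real.sin_sq t
    rw [hsc]
    have k1 := div_mul_cancel₀ (1 - m ^ 2) h1
    have k2 := div_mul_cancel₀ (1 - (Real.cos t : ℂ) ^ 2) h1
    refine mul_right_cancel₀ h1 ?_
    linear_combination (-(1 - m ^ 2)) * k1 - 4 * m ^ 2 * k2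
  have hcont : Continuous fun t : ℝ =>
      4 * m ^ 2 * ((Real.sin t : ℂ) ^ 2 / (1 + 2 * m * Real.cos t + m ^ 2)) := by
    refine continuous_const.mul (Continuous.div ?_ ?_ hD) <;> fun_prop
  have hF := intervalIntegral.integral_eq_sub_of_hasDerivAt (fun t _ => hH t)
    (hcont.intervalIntegrable 0 Real.pi)
  rw [intervalIntegral.integral_const_mul] at hF
  -- As exp(iπ) = exp(-iπ), the two logarithms cancel at both endpoints. What remains is -(1 - m²)π
  -- + (1 + m²)π = 2m²π.
  have e1 : Complex.exp (-(Real.pi : ℂ) * Complex.I) = -1 := by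
    rw [neg_mul, Complex.exp_neg, Complex.exp_pi_mul_I]
    norm_num
  rw [Complex.exp_pi_mul_I, e1] at hF
  simp only [Real.sin_pi, Real.sin_zero, Complex.ofReal_zero, neg_zero, zero_mul, mul_zero,
    sub_zero, add_sub_cancel_right, add_zero, zero_add, sub_self] at hF
  have h4 : 4 * m ^ 2 ≠ 0 := mul_ne_zero (by norm_num) (pow_ne_zero 2 hm0)
  refine mul_left_cancel₀ h4 ?_
  rw [hF]
  ring

/-- The roots have product 1 and sum -z. If both had modulus 1 they would be conjugate and -z real,
so one lies inside the unit disc. There z = -m - 1/m gives Im z = Im m (1/|m|² - 1), which forces Im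
m > 0. -/
lemma exists_root {z : ℂ} (hz : 0 < z.im) :
    ∃ m : ℂ, 1 + z * m + m ^ 2 = 0 ∧ 0 < m.im ∧ ‖m‖ < 1 := by
  have key : ∀ m : ℂ, 1 + z * m + m ^ 2 = 0 → ‖m‖ < 1 → 0 < m.im := by
    intro m h hm
    have hm0 : m ≠ 0 := by rintro rfl; simp at h
    have h1 : z = -m - m⁻¹ := by field_simp; linear_combination h
    have h2 := congrArg Complex.im h1
    simp only [Complex.sub_im, Complex.neg_im, Complex.inv_im] at h2
    have h3 : 0 < Complex.normSq m := Complex.normSq_pos.2 hm0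
    have h4 : Complex.normSq m < 1 := by
      rw [Complex.normSq_eq_norm_sq]
      nlinarith [norm_nonneg m]
    by_contra hneg
    have h5 : -m.im ≤ -m.im / Complex.normSq m := by
      rw [le_div_iff₀ h3]
      nlinarith
    rw [neg_div] at h5 h2
    linarith
  obtain ⟨d, hd⟩ := IsAlgClosed.exists_pow_nat_eq (z ^ 2 - 4) two_pos
  have r1 : 1 + z * ((-z + d) / 2) + ((-z + d) / 2) ^ 2 = 0 := by linear_combination hd / 4
  have r2 : 1 + z * ((-z - d) / 2) + ((-z - d) / 2) ^ 2 = 0 := by linear_combination hd / 4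
  have hp : ((-z + d) / 2) * ((-z - d) / 2) = 1 := by linear_combination -hd / 4
  have hnp : ‖(-z + d) / 2‖ * ‖(-z - d) / 2‖ = 1 := by rw [← norm_mul, hp, norm_one]
  rcases lt_trichotomy ‖(-z + d) / 2‖ 1 with h | h | h
  · exact ⟨_, r1, key _ r1 h, h⟩
  · exfalso
    have h1 := congrArg Complex.im (show -z = (-z + d) / 2 + (-z - d) / 2 by ring)
    have h2 : (-z - d) / 2 = (starRingEnd ℂ) ((-z + d) / 2) := by
      have h0 : (-z + d) / 2 ≠ 0 := left_ne_zero_of_mul (by rw [hp]; exact one_ne_zero)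
      refine mul_left_cancel₀ h0 ?_
      rw [hp, Complex.mul_conj, Complex.normSq_eq_norm_sq, h]
      simp
    rw [h2, Complex.add_im, Complex.conj_im, Complex.neg_im] at h1
    linarith
  · have h2 : ‖(-z - d) / 2‖ < 1 := by nlinarith [norm_nonneg ((-z - d) / 2)]
    exact ⟨_, r2, key _ r2 h2, h2⟩

lemma continuous_inv_ofReal_sub {z : ℂ} (hz : z.im ≠ 0) :
    Continuous fun l : ℝ => ((l : ℂ) - z)⁻¹ := by
  refine Continuous.inv₀ (by fun_prop) fun l h => hz ?_
  simpa using congrArg Complex.im h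

/-- With l = 2 cos t the equation for m reads m (l - z) = 1 + 2m cos t + m², so the integral is the
Poisson-type one above. -/
lemma fsc_eq_of_root {z m : ℂ} (hz : 0 < z.im) (h : 1 + z * m + m ^ 2 = 0) (hm : ‖m‖ < 1) :
    fsc z = m := by
  have hm0 : m ≠ 0 := by rintro rfl; simp at h
  have hpi : (Real.pi : ℂ) ≠ 0 := by exact_mod_cast Real.pi_ne_zero
  rw [fsc, stieltjes_eq, integral_semicircleLaw_eq_cos (continuous_inv_ofReal_sub hz.ne')]
  have e : ∀ t : ℝ, (2 / Real.pi * Real.sin t ^ 2) • (((2 * Real.cos t : ℝ) : ℂ) - z)⁻¹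
      = (2 * m / Real.pi) * ((Real.sin t : ℂ) ^ 2 / (1 + 2 * m * Real.cos t + m ^ 2)) := by
    intro t
    have h1 : 1 + 2 * m * (Real.cos t : ℂ) + m ^ 2 = m * (((2 * Real.cos t : ℝ) : ℂ) - z) := by
      push_cast
      linear_combination h
    rw [h1, Complex.real_smul]
    push_cast
    rw [div_eq_mul_inv _ (m * _), mul_inv]
    field_simp
  simp_rw [e]
  rw [intervalIntegral.integral_const_mul, integral_sin_sq_div hm0 hm]
  field_simp

lemma fsc_spec {z : ℂ} (hz : 0 < z.im) :
    1 + z * fsc z + fsc z ^ 2 = 0 ∧ 0 < (fsc z).im ∧ ‖fsc z‖ < 1 := by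
  obtain ⟨m, h, him, hm⟩ := exists_root hz
  rw [fsc_eq_of_root hz h hm]
  exact ⟨h, him, hm⟩

lemma fsc_ne_zero {z : ℂ} (hz : 0 < z.im) : fsc z ≠ 0 := fun h => by
  have := (fsc_spec hz).2.1
  simp [h] at this

lemma one_sub_fsc_mul_ne_zero {z w : ℂ} (hz : 0 < z.im) (hw : 0 < w.im) :
    1 - fsc z * fsc w ≠ 0 := by
  intro h
  have h1 : fsc z * fsc w = 1 := by linear_combination -h
  have h2 := congrArg norm h1
  rw [norm_mul, norm_one] at h2
  nlinarith [(fsc_spec hz).2.2, (fsc_spec hw).2.2, norm_nonneg (fsc z), norm_nonneg (fsc w)]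

/-- Multiply each quadratic equation by the value at the other point and subtract. This closed form
of the difference quotient yields continuity and the derivative without differentiating under the
integral. -/
lemma fsc_sub_fsc {z w : ℂ} (hz : 0 < z.im) (hw : 0 < w.im) :
    fsc z - fsc w = (z - w) * (fsc z * fsc w / (1 - fsc z * fsc w)) := by
  have h := one_sub_fsc_mul_ne_zero hz hw
  field_simp
  linear_combination fsc z * (fsc_spec hw).1 - fsc w * (fsc_spec hz).1

lemma continuousAt_fsc {z : ℂ} (hz : 0 < z.im) : ContinuousAt fsc z := by
  have h1 := (fsc_spec hz).2.2
  have hev : ∀ᶠ w in 𝓝 z, 0 < w.im := Complex.continuous_im.continuousAt.eventually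
    (lt_mem_nhds hz)
  rw [ContinuousAt, tendsto_iff_norm_sub_tendsto_zero]
  refine squeeze_zero' (g := fun w => ‖w - z‖ * (1 - ‖fsc z‖)⁻¹)
    (Eventually.of_forall fun _ => norm_nonneg _) ?_ ?_
  · filter_upwards [hev] with w hw
    have h2 := (fsc_spec hw).2.2
    rw [fsc_sub_fsc hw hz, norm_mul]
    gcongr
    rw [norm_div, div_eq_mul_inv, norm_mul]
    have h3 : 1 - ‖fsc z‖ ≤ ‖1 - fsc w * fsc z‖ := by
      have h4 := norm_sub_norm_le (1 : ℂ) (fsc w * fsc z)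
      rw [norm_one, norm_mul] at h4
      nlinarith [norm_nonneg (fsc z)]
    have h5 : ‖fsc w‖ * ‖fsc z‖ ≤ 1 := by nlinarith [norm_nonneg (fsc z), norm_nonneg (fsc w)]
    have h6 : ‖1 - fsc w * fsc z‖⁻¹ ≤ (1 - ‖fsc z‖)⁻¹ := inv_anti₀ (by linarith) h3
    calc _ ≤ 1 * (1 - ‖fsc z‖)⁻¹ := mul_le_mul h5 h6 (by positivity) zero_le_one
      _ = _ := one_mul _
  · have h : Continuous fun w : ℂ => ‖w - z‖ * (1 - ‖fsc z‖)⁻¹ := by fun_prop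
    simpa using h.tendsto z

lemma deriv_fsc {z : ℂ} (hz : 0 < z.im) : deriv fsc z = fsc z * fsc z / (1 - fsc z * fsc z) := by
  refine HasDerivAt.deriv ?_
  rw [hasDerivAt_iff_tendsto_slope]
  have hev : ∀ᶠ w in 𝓝 z, 0 < w.im := Complex.continuous_im.continuousAt.eventually
    (lt_mem_nhds hz)
  have hc : ContinuousAt (fun w => fsc w * fsc z / (1 - fsc w * fsc z)) z :=
    ((continuousAt_fsc hz).mul continuousAt_const).div
      (continuousAt_const.sub ((continuousAt_fsc hz).mul continuousAt_const))
      (one_sub_fsc_mul_ne_zero hz hz)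
  refine (hc.tendsto.mono_left nhdsWithin_le_nhds).congr' ?_
  filter_upwards [nhdsWithin_le_nhds hev, self_mem_nhdsWithin] with w hw hne
  have hne' : w - z ≠ 0 := sub_ne_zero.2 hne
  rw [slope_def_field, fsc_sub_fsc hw hz, mul_div_cancel_left₀ _ hne']

lemma fscQuot_eq {z w : ℂ} (hz : 0 < z.im) (hw : 0 < w.im) :
    fscQuot z w = fsc z * fsc w / (1 - fsc z * fsc w) := by
  rw [fscQuot]
  split_ifs with h
  · rw [← h, deriv_fsc hz]
  · rw [fsc_sub_fsc hz hw, mul_div_cancel_left₀ _ (sub_ne_zero.2 h)]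

end Semicircle

/-! ### Identification of the limits -/

namespace AddSymm

variable (s : AddSymm)

lemma tendsto_mean_fsc {z : ℂ} (hz : 0 < z.im) :
    Tendsto (fun n => s.mean n [z]) atTop (𝓝 (fsc z)) :=
  s.tendsto_mean_one hz (fsc_spec hz).2.1.le (fsc_spec hz).1

/-- The quadratic equation turns each coefficient a + f_a + f_b into -(1 - f_a f_b)/f_a, so the
linear limit equations are solved by rational functions of f_a and f_b. The mean of [a, b] tends to
the difference quotient of `fsc`. -/
lemma tendsto_trCov_goeS {a b : ℂ} (ha : 0 < a.im) (hb : 0 < b.im) :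
    Tendsto (fun n => s.trCov n a b) atTop (𝓝 (goeS a b)) := by
  have fa0 := fsc_ne_zero ha
  have fb0 := fsc_ne_zero hb
  have hab := one_sub_fsc_mul_ne_zero ha hb
  have haa := one_sub_fsc_mul_ne_zero ha ha
  have hbb := one_sub_fsc_mul_ne_zero hb hb
  have haa' : 1 - fsc a ^ 2 ≠ 0 := by rwa [pow_two]
  have hbb' : 1 - fsc b ^ 2 ≠ 0 := by rwa [pow_two]
  have qa := (fsc_spec ha).1
  have qb := (fsc_spec hb).1
  have mab : a + fsc a + fsc b = -(1 - fsc a * fsc b) / fsc a := by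
    field_simp
    linear_combination qa
  have mbb : b + fsc b + fsc b = -(1 - fsc b * fsc b) / fsc b := by
    field_simp
    linear_combination qb
  have maa : a + 2 * fsc a = -(1 - fsc a * fsc a) / fsc a := by
    field_simp
    linear_combination qa
  have nab : a + fsc a + fsc b ≠ 0 := by
    rw [mab]
    exact div_ne_zero (neg_ne_zero.2 hab) fa0
  have nbb : b + fsc b + fsc b ≠ 0 := by
    rw [mbb]
    exact div_ne_zero (neg_ne_zero.2 hbb) fb0
  have naa : a + 2 * fsc a ≠ 0 := by
    rw [maa]
    exact div_ne_zero (neg_ne_zero.2 haa) fa0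
  have lab := s.tendsto_mean_two (r := fsc a * fsc b / (1 - fsc a * fsc b)) ha hb
    (s.tendsto_mean_fsc ha) (s.tendsto_mean_fsc hb) nab (by rw [mab]; field_simp)
  have lbb := s.tendsto_mean_two (r := fsc b * fsc b / (1 - fsc b * fsc b)) hb hb
    (s.tendsto_mean_fsc hb) (s.tendsto_mean_fsc hb) nbb (by rw [mbb]; field_simp)
  have labb := s.tendsto_mean_three
    (t := fsc a * fsc b ^ 2 / ((1 - fsc a * fsc b) ^ 2 * (1 - fsc b * fsc b))) ha hb hb
    (s.tendsto_mean_fsc ha) (s.tendsto_mean_fsc hb) lab lbb nab (by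
      rw [mab]; field_simp; ring)
  refine s.tendsto_trCov ha hb (s.tendsto_mean_fsc ha) labb naa ?_
  rw [maa, goeS, fscQuot_eq ha hb, pow_two (fsc a), pow_two (fsc b)]
  field_simp

end AddSymm

/-! ### From Stieltjes transforms to weak convergence -/

section StieltjesContinuity

lemma norm_inv_ofReal_sub_le_abs {z : ℂ} (hz : z.im ≠ 0) (l : ℝ) :
    ‖((l : ℂ) - z)⁻¹‖ ≤ |z.im|⁻¹ := by
  rw [norm_inv]
  refine inv_anti₀ (abs_pos.2 hz) ?_
  have h := Complex.abs_im_le_norm ((l : ℂ) - z)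
  simpa using h

/-- The function `l ↦ (l - z)⁻¹` as a bounded continuous function on the line. -/
def cauchyKernel (z : {z : ℂ // z.im ≠ 0}) : ℝ →ᵇ ℂ :=
  BoundedContinuousFunction.ofNormedAddCommGroup (fun l : ℝ => ((l : ℂ) - z)⁻¹)
    (continuous_inv_ofReal_sub z.2) (|z.1.im|⁻¹) (norm_inv_ofReal_sub_le_abs z.2)

lemma cauchyKernel_apply (z : {z : ℂ // z.im ≠ 0}) (l : ℝ) :
    cauchyKernel z l = ((l : ℂ) - z)⁻¹ := rfl

/-- The resolvent identity: a product of two distinct kernels is a linear combination of them. -/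
lemma cauchyKernel_sub (z w : {z : ℂ // z.im ≠ 0}) :
    cauchyKernel z - cauchyKernel w = (z.1 - w.1) • (cauchyKernel z * cauchyKernel w) := by
  ext l
  have h : ∀ z : {z : ℂ // z.im ≠ 0}, (l : ℂ) - z ≠ 0 := fun z h => z.2 (by
    simpa using congrArg Complex.im h)
  have h1 := h z
  have h2 := h w
  simp only [BoundedContinuousFunction.coe_sub, Pi.sub_apply, BoundedContinuousFunction.coe_smul,
    BoundedContinuousFunction.coe_mul, Pi.mul_apply, cauchyKernel_apply, smul_eq_mul]
  field_simp
  ring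

lemma norm_cauchyKernel_le (z : {z : ℂ // z.im ≠ 0}) : ‖cauchyKernel z‖ ≤ |z.1.im|⁻¹ :=
  (BoundedContinuousFunction.norm_le (by positivity)).2 (norm_inv_ofReal_sub_le_abs z.2)

lemma norm_cauchyKernel_sub_le (z w : {z : ℂ // z.im ≠ 0}) :
    ‖cauchyKernel z - cauchyKernel w‖ ≤ ‖z.1 - w.1‖ * (|z.1.im|⁻¹ * |w.1.im|⁻¹) := by
  rw [cauchyKernel_sub, norm_smul]
  gcongr
  exact (norm_mul_le _ _).trans (mul_le_mul (norm_cauchyKernel_le z) (norm_cauchyKernel_le w)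
    (norm_nonneg _) (by positivity))

lemma star_cauchyKernel (z : {z : ℂ // z.im ≠ 0}) :
    star (cauchyKernel z) = cauchyKernel ⟨(starRingEnd ℂ) z, by simpa using z.2⟩ := by
  ext l
  simp [cauchyKernel_apply]

/-- The closed linear span of the constants and the Cauchy kernels. -/
def cauchySpan : Submodule ℂ (ℝ →ᵇ ℂ) :=
  (Submodule.span ℂ (insert 1 (Set.range cauchyKernel))).topologicalClosure

lemma one_mem_cauchySpan : 1 ∈ cauchySpan :=
  Submodule.le_topologicalClosure _ (Submodule.subset_span (Set.mem_insert _ _))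

lemma cauchyKernel_mem_cauchySpan (z : {z : ℂ // z.im ≠ 0}) : cauchyKernel z ∈ cauchySpan :=
  Submodule.le_topologicalClosure _ (Submodule.subset_span (Set.mem_insert_of_mem _ ⟨z, rfl⟩))

lemma isClosed_cauchySpan : IsClosed (cauchySpan : Set (ℝ →ᵇ ℂ)) :=
  Submodule.isClosed_topologicalClosure _

lemma cauchyKernel_mul_cauchyKernel_mem_of_ne {z w : {z : ℂ // z.im ≠ 0}} (h : z.1 ≠ w.1) :
    cauchyKernel z * cauchyKernel w ∈ cauchySpan := by
  have e : cauchyKernel z * cauchyKernel w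
      = (z.1 - w.1)⁻¹ • (cauchyKernel z - cauchyKernel w) := by
    rw [cauchyKernel_sub, smul_smul, inv_mul_cancel₀ (sub_ne_zero.2 h), one_smul]
  rw [e]
  exact Submodule.smul_mem _ _
    (Submodule.sub_mem _ (cauchyKernel_mem_cauchySpan z) (cauchyKernel_mem_cauchySpan w))

/-- For equal parameters, approximate one of them by horizontal translates and use closedness of the
span. -/
lemma cauchyKernel_mul_cauchyKernel_mem (z w : {z : ℂ // z.im ≠ 0}) :
    cauchyKernel z * cauchyKernel w ∈ cauchySpan := by
  by_cases h : z.1 = w.1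
  · obtain rfl : z = w := Subtype.ext h
    let u : ℕ → {z : ℂ // z.im ≠ 0} := fun k => ⟨z.1 + ((1 / ((k : ℝ) + 1) : ℝ) : ℂ), by
      simpa using z.2⟩
    have hu : ∀ k, z.1 - (u k).1 = -((1 / ((k : ℝ) + 1) : ℝ) : ℂ) := fun k => by simp [u]
    have him : ∀ k, (u k).1.im = z.1.im := fun k => by simp [u]
    have h0 := (tendsto_one_div_add_atTop_nhds_zero_nat (𝕜 := ℝ)).mul_const
      (|z.1.im|⁻¹ * |z.1.im|⁻¹)
    rw [zero_mul] at h0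
    have hlim : Tendsto (fun k => cauchyKernel (u k)) atTop (𝓝 (cauchyKernel z)) := by
      rw [tendsto_iff_norm_sub_tendsto_zero]
      refine squeeze_zero (g := fun k : ℕ => 1 / ((k : ℝ) + 1) * (|z.1.im|⁻¹ * |z.1.im|⁻¹))
        (fun _ => norm_nonneg _) (fun k => ?_) h0
      rw [norm_sub_rev]
      refine (norm_cauchyKernel_sub_le _ _).trans (le_of_eq ?_)
      rw [hu, him, norm_neg, Complex.norm_real, Real.norm_of_nonneg (by positivity)]
    refine isClosed_cauchySpan.mem_of_tendsto (hlim.const_mul (cauchyKernel z))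
      (Eventually.of_forall fun k => cauchyKernel_mul_cauchyKernel_mem_of_ne fun h => ?_)
    have h1 := hu k
    rw [h, sub_self, eq_comm, neg_eq_zero, Complex.ofReal_eq_zero] at h1
    have : (0 : ℝ) < 1 / ((k : ℝ) + 1) := by positivity
    linarith
  · exact cauchyKernel_mul_cauchyKernel_mem_of_ne h

lemma cauchyKernel_mul_mem (z : {z : ℂ // z.im ≠ 0}) {g : ℝ →ᵇ ℂ} (hg : g ∈ cauchySpan) :
    cauchyKernel z * g ∈ cauchySpan := by
  have hle : Submodule.span ℂ (insert 1 (Set.range cauchyKernel))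
      ≤ cauchySpan.comap (LinearMap.mulLeft ℂ (cauchyKernel z)) := by
    rw [Submodule.span_le]
    rintro _ (rfl | ⟨w, rfl⟩)
    · simpa using cauchyKernel_mem_cauchySpan z
    · exact cauchyKernel_mul_cauchyKernel_mem z w
  have hcl : IsClosed (cauchySpan.comap (LinearMap.mulLeft ℂ (cauchyKernel z)) : Set (ℝ →ᵇ ℂ)) :=
    isClosed_cauchySpan.preimage (continuous_const.mul continuous_id)
  exact Submodule.topologicalClosure_minimal _ hle hcl hg

/-- The star algebra generated by the Cauchy kernels. -/
def cauchyAlgebra : StarSubalgebra ℂ (ℝ →ᵇ ℂ) := StarAlgebra.adjoin ℂ (Set.range cauchyKernel)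

/-- The kernels are closed under conjugation, and multiplication by a kernel preserves the closed
span. So convergence on kernels, a linear condition, suffices for the whole algebra. -/
lemma mem_cauchySpan_of_mem_cauchyAlgebra {g : ℝ →ᵇ ℂ} (hg : g ∈ cauchyAlgebra) :
    g ∈ cauchySpan := by
  have hstar : star (Set.range cauchyKernel) ⊆ Set.range cauchyKernel := by
    rintro g ⟨z, hz⟩
    refine ⟨⟨(starRingEnd ℂ) z, by simpa using z.2⟩, ?_⟩
    rw [← star_cauchyKernel, hz, star_star]
  have h1 : g ∈ Algebra.adjoin ℂ (Set.range cauchyKernel) := by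
    have h2 : g ∈ cauchyAlgebra.toSubalgebra := hg
    rwa [cauchyAlgebra, StarAlgebra.adjoin_toSubalgebra, Set.union_eq_left.2 hstar] at h2
  have h3 : g ∈ Subalgebra.toSubmodule (Algebra.adjoin ℂ (Set.range cauchyKernel)) := h1
  rw [Algebra.adjoin_eq_span] at h3
  refine Submodule.span_le.2 (fun x hx => ?_) h3
  induction hx using Submonoid.closure_induction_left with
  | one => exact one_mem_cauchySpan
  | mul_left x hx y _ ih =>
    obtain ⟨z, rfl⟩ := hx
    exact cauchyKernel_mul_mem z ih

lemma separatesPoints_cauchyAlgebra :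
    (cauchyAlgebra.map (BoundedContinuousFunction.toContinuousMapStarₐ ℂ)).SeparatesPoints := by
  intro x y hxy
  let z : {z : ℂ // z.im ≠ 0} := ⟨Complex.I, by simp⟩
  refine ⟨cauchyKernel z, ⟨(cauchyKernel z : C(ℝ, ℂ)), ⟨cauchyKernel z,
    StarAlgebra.subset_adjoin ℂ _ ⟨z, rfl⟩, rfl⟩, rfl⟩, fun h => hxy ?_⟩
  have h1 : ((x : ℂ) - Complex.I)⁻¹ = ((y : ℂ) - Complex.I)⁻¹ := h
  have h2 := inv_injective h1
  exact_mod_cast sub_left_injective h2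

/-- The bounded continuous functions whose integrals converge along a sequence of measures. -/
def convergenceSubmodule (μ : ℕ → ProbabilityMeasure ℝ) (ν : ProbabilityMeasure ℝ) :
    Submodule ℂ (ℝ →ᵇ ℂ) where
  carrier := {g | Tendsto (fun n => ∫ x, g x ∂(μ n : Measure ℝ)) atTop
    (𝓝 (∫ x, g x ∂(ν : Measure ℝ)))}
  add_mem' {f g} hf hg := by
    simp only [Set.mem_ofPred_eq, BoundedContinuousFunction.coe_add, Pi.add_apply] at *
    rw [integral_add (f.integrable _) (g.integrable _)]
    simp_rw [fun n => integral_add (f.integrable (μ n : Measure ℝ)) (g.integrable _)]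
    exact hf.add hg
  zero_mem' := by simp
  smul_mem' c g hg := by
    simp only [Set.mem_ofPred_eq, BoundedContinuousFunction.coe_smul] at *
    simp_rw [integral_smul]
    exact hg.const_smul c

lemma mem_convergenceSubmodule {μ : ℕ → ProbabilityMeasure ℝ} {ν : ProbabilityMeasure ℝ}
    {g : ℝ →ᵇ ℂ} : g ∈ convergenceSubmodule μ ν ↔
      Tendsto (fun n => ∫ x, g x ∂(μ n : Measure ℝ)) atTop (𝓝 (∫ x, g x ∂(ν : Measure ℝ))) :=
  Iff.rfl

lemma norm_integral_sub_le (μ : ProbabilityMeasure ℝ) (f g : ℝ →ᵇ ℂ) :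
    ‖∫ x, f x ∂(μ : Measure ℝ) - ∫ x, g x ∂(μ : Measure ℝ)‖ ≤ ‖f - g‖ := by
  rw [← integral_sub (f.integrable _) (g.integrable _)]
  refine (norm_integral_le_of_norm_le_const (C := ‖f - g‖)
    (ae_of_all _ fun x => (f - g).norm_coe_le_norm x)).trans ?_
  simp

/-- Probability measures are contractions for the sup norm, uniformly in n, so an ε/3 argument
applies. -/
lemma isClosed_convergenceSubmodule (μ : ℕ → ProbabilityMeasure ℝ) (ν : ProbabilityMeasure ℝ) :
    IsClosed (convergenceSubmodule μ ν : Set (ℝ →ᵇ ℂ)) := by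
  refine isClosed_of_closure_subset fun g hg => ?_
  rw [SetLike.mem_coe, mem_convergenceSubmodule, Metric.tendsto_atTop]
  intro ε hε
  obtain ⟨f, hf, hfg⟩ := Metric.mem_closure_iff.1 hg (ε / 3) (by positivity)
  obtain ⟨N, hN⟩ := Metric.tendsto_atTop.1 (mem_convergenceSubmodule.1 hf) (ε / 3) (by positivity)
  refine ⟨N, fun n hn => ?_⟩
  have h1 := hN n hn
  have h2 := norm_integral_sub_le (μ n) g f
  have h3 := norm_integral_sub_le ν f g
  rw [dist_eq_norm] at h1 hfg ⊢
  rw [norm_sub_rev f g] at h3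
  calc _ = ‖(∫ x, g x ∂(μ n : Measure ℝ) - ∫ x, f x ∂(μ n : Measure ℝ))
        + (∫ x, f x ∂(μ n : Measure ℝ) - ∫ x, f x ∂(ν : Measure ℝ))
        + (∫ x, f x ∂(ν : Measure ℝ) - ∫ x, g x ∂(ν : Measure ℝ))‖ := by congr 1; ring
    _ ≤ _ := norm_add₃_le
    _ < ε := by linarith

lemma star_mem_convergenceSubmodule {μ : ℕ → ProbabilityMeasure ℝ} {ν : ProbabilityMeasure ℝ}
    {g : ℝ →ᵇ ℂ} (hg : g ∈ convergenceSubmodule μ ν) : star g ∈ convergenceSubmodule μ ν := by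
  rw [mem_convergenceSubmodule] at *
  simp only [BoundedContinuousFunction.coe_star, Pi.star_apply, RCLike.star_def, integral_conj]
  exact (Complex.continuous_conj.tendsto _).comp hg

/-- The mass lost by the Poisson kernel at height `y`. -/
def stieltjesDefect (μ : Measure ℝ) (y : ℝ) : ℝ := 1 - y * (stieltjes μ (y * Complex.I)).im

lemma inv_sub_mul_I_im {y : ℝ} (l : ℝ) :
    (((l : ℂ) - y * Complex.I)⁻¹).im = y / (l ^ 2 + y ^ 2) := by
  rw [Complex.inv_im, Complex.normSq_apply]
  simp
  ring

lemma stieltjesDefect_eq (μ : Measure ℝ) [IsProbabilityMeasure μ] {y : ℝ} (hy : 0 < y) :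
    Integrable (fun l : ℝ => l ^ 2 / (l ^ 2 + y ^ 2)) μ ∧
    stieltjesDefect μ y = ∫ l, l ^ 2 / (l ^ 2 + y ^ 2) ∂μ := by
  have hz : (y * Complex.I).im ≠ 0 := by simpa using hy.ne'
  have hi : Integrable (fun l : ℝ => ((l : ℂ) - y * Complex.I)⁻¹) μ :=
    (cauchyKernel ⟨_, hz⟩).integrable μ
  have h1 := Complex.imCLM.integral_comp_comm hi
  have h2 := Complex.imCLM.integrable_comp hi
  simp only [Complex.imCLM_apply, inv_sub_mul_I_im] at h1 h2
  have e : ∀ l : ℝ, l ^ 2 / (l ^ 2 + y ^ 2) = 1 - y * (y / (l ^ 2 + y ^ 2)) := by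
    intro l
    have : l ^ 2 + y ^ 2 ≠ 0 := by positivity
    field_simp
    ring
  simp_rw [e]
  refine ⟨(integrable_const _).sub (h2.const_mul y), ?_⟩
  rw [integral_sub (integrable_const _) (h2.const_mul y), integral_const_mul, h1, stieltjesDefect,
    stieltjes_eq]
  simp

/-- The defect is the integral of l²/(l² + y²), which is at least 1/2 where |l| > y. -/
lemma measure_norm_gt_le_stieltjesDefect (μ : Measure ℝ) [IsProbabilityMeasure μ] {y : ℝ}
    (hy : 0 < y) : μ {x | y < ‖x‖} ≤ ENNReal.ofReal (2 * stieltjesDefect μ y) := by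
  obtain ⟨hi, h⟩ := stieltjesDefect_eq μ hy
  rw [h, ← integral_const_mul, ofReal_integral_eq_lintegral_ofReal (hi.const_mul 2)
    (ae_of_all _ fun l => by positivity)]
  have hms : MeasurableSet {x : ℝ | y < ‖x‖} := measurableSet_lt measurable_const measurable_norm
  rw [← lintegral_indicator_one hms]
  refine lintegral_mono fun l => ?_
  by_cases hl : l ∈ {x : ℝ | y < ‖x‖}
  · rw [Set.indicator_of_mem hl, Pi.one_apply, ENNReal.one_le_ofReal, ← mul_div_assoc,
      le_div_iff₀ (by positivity)]
    have h1 : y ^ 2 ≤ l ^ 2 := by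
      rw [← sq_abs l]
      exact pow_le_pow_left₀ hy.le (le_of_lt hl) 2
    linarith
  · rw [Set.indicator_of_notMem hl]
    exact zero_le

lemma tendsto_stieltjesDefect (μ : Measure ℝ) [IsProbabilityMeasure μ] :
    Tendsto (stieltjesDefect μ) atTop (𝓝 0) := by
  have h : Tendsto (fun y : ℝ => ∫ l, l ^ 2 / (l ^ 2 + y ^ 2) ∂μ) atTop (𝓝 (∫ _, (0 : ℝ) ∂μ)) := by
    refine tendsto_integral_filter_of_dominated_convergence (fun _ => 1) ?_ ?_
      (integrable_const _) (ae_of_all _ fun l => ?_)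
    · exact Eventually.of_forall fun y => Measurable.aestronglyMeasurable (by fun_prop)
    · refine Eventually.of_forall fun y => ae_of_all _ fun l => ?_
      rw [Real.norm_of_nonneg (by positivity)]
      exact div_le_one_of_le₀ (by nlinarith [sq_nonneg y]) (by positivity)
    · exact tendsto_const_nhds.div_atTop (tendsto_atTop_add_const_left _ _
        (tendsto_pow_atTop two_ne_zero))
  rw [integral_zero] at h
  refine h.congr' ?_
  filter_upwards [eventually_gt_atTop 0] with y hy
  exact (stieltjesDefect_eq μ hy).2.symm

/-- Convergence of Stieltjes transforms on a dense set implies weak convergence. -/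
theorem tendsto_of_tendsto_stieltjes {μ : ℕ → ProbabilityMeasure ℝ} {ν : ProbabilityMeasure ℝ}
    {D : Set ℂ} (hD : Dense D)
    (h : ∀ z ∈ D, 0 < z.im → Tendsto (fun n => stieltjes (μ n : Measure ℝ) z) atTop
      (𝓝 (stieltjes (ν : Measure ℝ) z))) :
    Tendsto μ atTop (𝓝 ν) := by
  have hpos : ∀ (z : ℂ) (hz : 0 < z.im),
      cauchyKernel ⟨z, hz.ne'⟩ ∈ convergenceSubmodule μ ν := by
    intro z hz
    refine (isClosed_convergenceSubmodule μ ν).closure_subset (Metric.mem_closure_iff.2 ?_)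
    intro ε hε
    -- The first radius ensures Im w ≥ Im z / 2; the kernels then differ by at most 2‖w - z‖/(Im
    -- z)², which the second radius makes less than ε.
    obtain ⟨w, hwD, hw⟩ := hD.exists_mem_open (U := Metric.ball z (min (z.im / 2)
      (ε * z.im ^ 2 / 2))) Metric.isOpen_ball ⟨z, Metric.mem_ball_self (by positivity)⟩
    rw [Metric.mem_ball, dist_eq_norm, lt_min_iff] at hw
    have h1 : z.im / 2 ≤ w.im := by
      have := (abs_le.1 (Complex.abs_im_le_norm (w - z))).1
      rw [Complex.sub_im] at this
      linarith
    have hw0 : 0 < w.im := by linarith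
    refine ⟨cauchyKernel ⟨w, hw0.ne'⟩, ?_, ?_⟩
    · have h2 := h w hwD hw0
      simp_rw [stieltjes_eq] at h2
      exact h2
    · rw [dist_eq_norm]
      refine (norm_cauchyKernel_sub_le _ _).trans_lt ?_
      simp only [abs_of_pos hz, abs_of_pos hw0]
      rw [norm_sub_rev]
      have h3 : w.im⁻¹ ≤ 2 * z.im⁻¹ := by
        rw [← inv_inv (2 : ℝ), ← mul_inv]
        exact inv_anti₀ (by positivity) (by linarith)
      calc _ ≤ ‖w - z‖ * (z.im⁻¹ * (2 * z.im⁻¹)) := by gcongr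
        _ < ε * z.im ^ 2 / 2 * (z.im⁻¹ * (2 * z.im⁻¹)) := by
          have : 0 < z.im⁻¹ * (2 * z.im⁻¹) := by positivity
          exact mul_lt_mul_of_pos_right hw.2 this
        _ = ε := by field_simp
  have hall : ∀ z, cauchyKernel z ∈ convergenceSubmodule μ ν := by
    rintro ⟨z, hz⟩
    rcases lt_or_gt_of_ne hz with h0 | h0
    · have h1 := star_mem_convergenceSubmodule (hpos ((starRingEnd ℂ) z) (by simpa using h0))
      rw [star_cauchyKernel] at h1
      simpa using h1
    · exact hpos z h0
  have hspan : cauchySpan ≤ convergenceSubmodule μ ν := by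
    refine Submodule.topologicalClosure_minimal _ (Submodule.span_le.2 ?_)
      (isClosed_convergenceSubmodule μ ν)
    rintro _ (rfl | ⟨z, rfl⟩)
    · rw [SetLike.mem_coe, mem_convergenceSubmodule]
      simp
    · exact hall z
  -- Tail masses beyond y have limsup at most twice the defect of ν at height y, and this vanishes
  -- as y grows because ν has mass 1.
  have htight : IsTightMeasureSet (Set.range fun n => (μ n : Measure ℝ)) := by
    refine isTightMeasureSet_range_of_tendsto_limsup_measure_norm_gt ?_
    have hν := ((tendsto_stieltjesDefect (ν : Measure ℝ)).const_mul 2)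
    have hν' := (ENNReal.continuous_ofReal.tendsto _).comp hν
    rw [mul_zero, ENNReal.ofReal_zero] at hν'
    refine tendsto_of_tendsto_of_tendsto_of_le_of_le' tendsto_const_nhds hν'
      (Eventually.of_forall fun _ => zero_le) ?_
    filter_upwards [eventually_gt_atTop 0] with y hy
    have hz : (y * Complex.I).im ≠ 0 := by simpa using hy.ne'
    have h1 : Tendsto (fun n => stieltjes (μ n : Measure ℝ) (y * Complex.I)) atTop
        (𝓝 (stieltjes (ν : Measure ℝ) (y * Complex.I))) := by
      have h2 := mem_convergenceSubmodule.1 (hall ⟨_, hz⟩)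
      simp_rw [stieltjes_eq]
      exact h2
    have h3 : Tendsto (fun n => ENNReal.ofReal (2 * stieltjesDefect (μ n : Measure ℝ) y)) atTop
        (𝓝 (ENNReal.ofReal (2 * stieltjesDefect (ν : Measure ℝ) y))) := by
      refine (ENNReal.continuous_ofReal.tendsto _).comp (Tendsto.const_mul 2 ?_)
      exact tendsto_const_nhds.sub
        (((Complex.continuous_im.tendsto _).comp h1).const_mul y)
    rw [Function.comp_apply, ← h3.limsup_eq]
    exact limsup_le_limsup (Eventually.of_forall fun n =>
      measure_norm_gt_le_stieltjesDefect (μ n : Measure ℝ) hy)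
  exact ProbabilityMeasure.tendsto_of_tight_of_separatesPoints ℂ htight
    separatesPoints_cauchyAlgebra fun g hg => hspan (mem_cauchySpan_of_mem_cauchyAlgebra hg)

end StieltjesContinuity

/-! ### Transfer from the Gaussian model to the given matrices -/

section Transfer

variable {n : ℕ}

lemma isProbabilityMeasure_ncm (hn : 1 ≤ n) {A : Matrix (SymIdx n) (SymIdx n) ℂ}
    (hA : A.IsHermitian) : IsProbabilityMeasure (ncm hA) := by
  have h0 : ((2 * n : ℕ) : ℝ≥0∞) ≠ 0 := by
    rw [Nat.cast_ne_zero]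
    omega
  refine ⟨?_⟩
  simp only [ncm, Measure.smul_apply, Measure.coe_finsetSum, Finset.sum_apply, measure_univ,
    Finset.sum_const, Finset.card_univ, card_symIdx, smul_eq_mul, nsmul_eq_mul, mul_one]
  exact ENNReal.inv_mul_cancel h0 (ENNReal.natCast_ne_top _)

lemma stieltjes_ncm {A : Matrix (SymIdx n) (SymIdx n) ℂ} (hA : A.IsHermitian) {z : ℂ}
    (hz : 0 < z.im) : stieltjes (ncm hA) z = (2 * n : ℂ)⁻¹ * (resolv A z).trace := by
  have hi : ∀ i ∈ Finset.univ, Integrable (fun l : ℝ => ((l : ℂ) - z)⁻¹)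
      (Measure.dirac (hA.eigenvalues i)) := fun i _ => (cauchyKernel ⟨z, hz.ne'⟩).integrable _
  rw [stieltjes_eq, ncm, integral_smul_measure, integral_finsetSum_measure hi, trace_resolv hA hz]
  simp only [integral_dirac, ENNReal.toReal_inv, ENNReal.toReal_natCast, Complex.real_smul]
  push_cast
  rfl

namespace AddSymm

variable (s : AddSymm)

/-- The real and imaginary parts of the entries at the free positions. -/
def entryVec (W : Matrix (SymIdx n) (SymIdx n) ℂ) (k : FreePos n × Bool) : ℝ :=
  if k.2 then (W k.1.1.1 k.1.1.2).re else (W k.1.1.1 k.1.1.2).im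

/-- The matrix with given real and imaginary parts of the entries at the free positions. -/
def ofEntryVec (e : FreePos n × Bool → ℝ) : Matrix (SymIdx n) (SymIdx n) ℂ :=
  Matrix.of fun x y => ∑ k : FreePos n × Bool,
    ((e k * s.coeff k.1.1 k.2 (x, y) : ℝ) : ℂ) * (if k.2 then 1 else Complex.I)

/-- The standard deviations of the entries. -/
def scale (n : ℕ) (k : FreePos n × Bool) : ℝ := (√(2 * n))⁻¹ * √(s.entryVar k.1.1 k.2)

lemma ofEntryVec_scale (y : FreePos n × Bool → ℝ) :
    s.ofEntryVec (fun k => s.scale n k * y k) = s.model n y := by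
  ext i j
  simp only [ofEntryVec, Matrix.of_apply, model_apply, Matrix.sum_apply, Matrix.smul_apply,
    basisMat, scale, Complex.real_smul]
  refine Finset.sum_congr rfl fun k _ => ?_
  push_cast
  ring

/-- Every position is equivalent to exactly one free position, so the free entries determine the
matrix. -/
lemma ofEntryVec_entryVec {W : Matrix (SymIdx n) (SymIdx n) ℂ} (hW : W.IsHermitian)
    (hs : ∀ x y, W x y = W (s.act (x, y)).1 (s.act (x, y)).2) :
    s.ofEntryVec (entryVec W) = W := by
  ext x y
  obtain ⟨p, hp⟩ := exists_freePos s (x, y)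
  have hsame : ∀ q r : SymIdx n × SymIdx n, s.Same q r → W r.1 r.2 = W q.1 q.2 := by
    rintro q r (rfl | rfl)
    · rfl
    · exact (hs q.1 q.2).symm
  have hopp : ∀ q r : SymIdx n × SymIdx n, s.Opp q r → W r.1 r.2 = star (W q.1 q.2) := by
    intro q r h
    have h1 : s.Same q.swap r := h
    rw [hsame _ _ h1]
    exact (hW.apply q.1 q.2).symm ▸ (by simp)
  simp only [ofEntryVec, Matrix.of_apply]
  rw [Fintype.sum_prod_type, Fintype.sum_eq_single p]
  · rw [Fintype.sum_bool]
    by_cases h : s.Same p.1 (x, y)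
    · rw [show W x y = W p.1.1 p.1.2 from hsame _ _ h]
      simp only [coeff, if_pos h, entryVec, if_true, mul_one, Bool.false_eq_true, if_false]
      exact Complex.re_add_im _
    · have h' := hp.resolve_left h
      rw [show W x y = star (W p.1.1 p.1.2) from hopp _ _ h']
      simp only [coeff, if_neg h, if_pos h', entryVec, if_true, mul_one, Bool.false_eq_true,
        if_false]
      apply Complex.ext <;> simp
  · intro p' hp'
    have h1 : ¬ (s.Same p'.1 (x, y) ∨ s.Opp p'.1 (x, y)) := fun h =>
      hp' (freePos_unique (same_or_opp_trans h hp))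
    have h2 := not_or.1 h1
    simp [coeff, h2.1, h2.2]

/-- The normalized trace of the resolvent as a function of the free entries. -/
def entryStieltjes (n : ℕ) (z : ℂ) (e : FreePos n × Bool → ℝ) : ℂ :=
  (2 * n : ℂ)⁻¹ * (resolv (s.ofEntryVec e) z).trace

lemma continuous_ofEntryVec : Continuous (s.ofEntryVec (n := n)) := by
  refine continuous_matrix fun x y => ?_
  simp only [ofEntryVec, Matrix.of_apply]
  fun_prop

/-- An arbitrary vector of entries need not give a Hermitian matrix, so the resolvent may be
singular. The cofactor formula still gives measurability. -/
lemma measurable_entryStieltjes (z : ℂ) : Measurable (s.entryStieltjes n z) := by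
  have hc : Continuous fun e : FreePos n × Bool → ℝ => s.ofEntryVec e - z • 1 :=
    s.continuous_ofEntryVec.sub continuous_const
  have h : s.entryStieltjes n z = fun e => (2 * n : ℂ)⁻¹ *
      (((s.ofEntryVec e - z • 1).det)⁻¹ * (s.ofEntryVec e - z • 1).adjugate.trace) := by
    funext e
    rw [entryStieltjes, resolv, Matrix.inv_def, Matrix.trace_smul, smul_eq_mul,
      Ring.inverse_eq_inv']
  rw [h]
  exact measurable_const.mul (hc.matrix_det.measurable.inv.mul
    hc.matrix_adjugate.matrix_trace.measurable)

lemma entryStieltjes_scale (z : ℂ) (y : FreePos n × Bool → ℝ) :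
    s.entryStieltjes n z (fun k => s.scale n k * y k)
      = (2 * n : ℂ)⁻¹ * (s.word [z] y).trace := by
  rw [entryStieltjes, ofEntryVec_scale]
  simp [word, res]

end AddSymm

lemma map_of_map_const_mul {Ω : Type*} [MeasurableSpace Ω] {P : Measure Ω} {X : Ω → ℝ} {c : ℝ}
    (hc : c ≠ 0) {v : ℝ≥0} (h : HasLaw (fun ω => c * X ω) (gaussianReal 0 v) P) :
    AEMeasurable X P ∧ P.map X = (gaussianReal 0 1).map (fun x => c⁻¹ * √v * x) := by
  have e : X = fun ω => c⁻¹ * (c * X ω) := by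
    funext ω
    rw [inv_mul_cancel_left₀ hc]
  have hm : AEMeasurable X P := by
    rw [e]
    exact h.aemeasurable.const_mul _
  refine ⟨hm, ?_⟩
  have h1 : P.map X = (P.map fun ω => c * X ω).map (fun x => c⁻¹ * x) := by
    rw [AEMeasurable.map_map_of_aemeasurable (by fun_prop) h.aemeasurable]
    congr 1
  rw [h1, h.map_eq, gaussianReal_map_const_mul, gaussianReal_map_const_mul]
  congr 1
  · simp
  · ext
    push_cast
    rw [mul_pow, Real.sq_sqrt (NNReal.coe_nonneg v), mul_one]

variable {Ω : Type*} [MeasurableSpace Ω] {P : Measure Ω} {s : AddSymm}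
  {W : Ω → Matrix (SymIdx n) (SymIdx n) ℂ}

/-- Random variables with summable second moments tend to zero almost surely. -/
lemma ae_tendsto_zero_of_summable {X : ℕ → Ω → ℂ} (hX : ∀ n, AEMeasurable (X n) P) {c : ℕ → ℝ}
    (hc : Summable c) (h : ∀ n, ∫⁻ ω, ‖X n ω‖ₑ ^ 2 ∂P ≤ ENNReal.ofReal (c n)) :
    ∀ᵐ ω ∂P, Tendsto (fun n => X n ω) atTop (𝓝 0) := by
  have hm : ∀ n, AEMeasurable (fun ω => ‖X n ω‖ₑ ^ 2) P := fun n => (hX n).enorm.pow_const 2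
  have h1 : ∫⁻ ω, ∑' n, ‖X n ω‖ₑ ^ 2 ∂P ≠ ∞ := by
    rw [lintegral_tsum hm]
    exact ne_top_of_le_ne_top hc.tsum_ofReal_ne_top (ENNReal.tsum_le_tsum h)
  filter_upwards [ae_lt_top' (AEMeasurable.tsum hm) h1] with ω hω
  have h2 := ENNReal.tendsto_atTop_zero_of_tsum_ne_top hω.ne
  have h3 := (ENNReal.tendsto_toReal ENNReal.zero_ne_top).comp h2
  simp only [Function.comp_def, ENNReal.toReal_pow, toReal_enorm, ENNReal.toReal_zero] at h3
  have h4 := h3.sqrt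
  simp only [Real.sqrt_sq (norm_nonneg _), Real.sqrt_zero] at h4
  exact tendsto_zero_iff_norm_tendsto_zero.2 h4

namespace IsSymmetricGUE

lemma stieltjes_eq_entryStieltjes (hW : IsSymmetricGUE P s n W) {z : ℂ} (hz : 0 < z.im) (ω : Ω) :
    stieltjes (ncm (hW.isHermitian ω)) z = s.entryStieltjes n z (AddSymm.entryVec (W ω)) := by
  rw [stieltjes_ncm _ hz, AddSymm.entryStieltjes,
    s.ofEntryVec_entryVec (hW.isHermitian ω) (hW.symm ω)]

variable [IsProbabilityMeasure P]

lemma map_entryVec (hW : IsSymmetricGUE P s n W) (hn : 1 ≤ n) (k : FreePos n × Bool) :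
    AEMeasurable (fun ω => AddSymm.entryVec (W ω) k) P ∧
    P.map (fun ω => AddSymm.entryVec (W ω) k)
      = (gaussianReal 0 1).map (fun x => s.scale n k * x) := by
  have hN : √(2 * n : ℝ) ≠ 0 := by
    have : (1 : ℝ) ≤ n := by exact_mod_cast hn
    positivity
  obtain ⟨p, b⟩ := k
  by_cases hf : s.ForcedReal p.1.1 p.1.2
  · cases b
    · have h0 : ∀ ω, AddSymm.entryVec (W ω) (p, false) = 0 := by
        intro ω
        have h1 := (AddSymm.forcedReal_iff_opp p.1).1 hf
        have h2 : W ω p.1.1 p.1.2 = W ω p.1.2 p.1.1 := by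
          rcases h1 with h1 | h1
          · have h3 := congrArg Prod.fst h1
            have h4 := congrArg Prod.snd h1
            simp only [Prod.fst_swap, Prod.snd_swap] at h3 h4
            rw [h3]
          · have h3 := hW.symm ω p.1.2 p.1.1
            rw [h3]
            change _ = W ω (s.act p.1.swap).1 (s.act p.1.swap).2
            rw [← h1]
        have h5 := (hW.isHermitian ω).apply p.1.1 p.1.2
        rw [← h2] at h5
        simp only [AddSymm.entryVec, Bool.false_eq_true, if_false]
        exact Complex.conj_eq_iff_im.1 h5
      simp only [h0, AddSymm.scale, AddSymm.entryVar, if_pos hf, Bool.false_eq_true, if_false,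
        NNReal.coe_zero, Real.sqrt_zero, mul_zero, zero_mul, Measure.map_const, measure_univ,
        and_true]
      exact aemeasurable_const
    · have h := map_of_map_const_mul hN (hW.law_real p.1.1 p.1.2 hf)
      simpa [AddSymm.entryVec, AddSymm.scale, AddSymm.entryVar, hf] using h
  · cases b
    · have h := map_of_map_const_mul hN (hW.law_im p.1.1 p.1.2 hf)
      simpa [AddSymm.entryVec, AddSymm.scale, AddSymm.entryVar, hf] using h
    · have h := map_of_map_const_mul hN (hW.law_re p.1.1 p.1.2 hf)
      simpa [AddSymm.entryVec, AddSymm.scale, AddSymm.entryVar, hf] using h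

/-- The free entries are distributed like scaled independent standard Gaussian variables. -/
lemma identDistrib_entryVec (hW : IsSymmetricGUE P s n W) (hn : 1 ≤ n) :
    IdentDistrib (fun ω => AddSymm.entryVec (W ω)) (fun y k => s.scale n k * y k) P
      (gaussPi (FreePos n × Bool)) where
  aemeasurable_fst := aemeasurable_pi_lambda _ fun k => (hW.map_entryVec hn k).1
  aemeasurable_snd := (measurable_pi_lambda _ fun k =>
    (measurable_pi_apply k).const_mul (s.scale n k)).aemeasurable
  map_eq := by
    have h1 := (iIndepFun_iff_map_fun_eq_pi_map fun k => (hW.map_entryVec hn k).1).1 hW.indep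
    have h2 := Measure.pi_map_pi (μ := fun _ : FreePos n × Bool => gaussianReal 0 1)
      (f := fun k x => s.scale n k * x)
      (hμ := fun k => by rw [← (hW.map_entryVec hn k).2]; infer_instance) (by fun_prop)
    rw [h2]
    refine h1.trans ?_
    congr 1
    funext k
    exact (hW.map_entryVec hn k).2

lemma integral_stieltjes (hW : IsSymmetricGUE P s n W) (hn : 1 ≤ n) {z : ℂ} (hz : 0 < z.im) :
    ∫ ω, stieltjes (ncm (hW.isHermitian ω)) z ∂P = s.mean n [z] := by
  simp_rw [hW.stieltjes_eq_entryStieltjes hz]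
  have h := ((hW.identDistrib_entryVec hn).comp (s.measurable_entryStieltjes z)).integral_eq
  simp only [Function.comp_def, s.entryStieltjes_scale] at h
  rw [h, integral_const_mul, AddSymm.mean]

lemma corr_eq (hW : IsSymmetricGUE P s n W) (hn : 1 ≤ n) {z w : ℂ} (hz : 0 < z.im)
    (hw : 0 < w.im) :
    corr P (fun ω z => stieltjes (ncm (hW.isHermitian ω)) z) z w
      = ((2 * (n : ℂ)) ^ 2)⁻¹ * s.trCov n z w := by
  simp only [corr, hW.integral_stieltjes hn hz, hW.integral_stieltjes hn hw]
  simp_rw [hW.stieltjes_eq_entryStieltjes hz, hW.stieltjes_eq_entryStieltjes hw]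
  have h := ((hW.identDistrib_entryVec hn).comp
    (((s.measurable_entryStieltjes z).sub_const (s.mean n [z])).mul
      ((s.measurable_entryStieltjes w).sub_const (s.mean n [w])))).integral_eq
  simp only [Function.comp_def, s.entryStieltjes_scale, Pi.mul_apply] at h
  rw [h, AddSymm.trCov, ← integral_const_mul]
  refine integral_congr_ae (ae_of_all _ fun y => ?_)
  simp only [AddSymm.ctr, AddSymm.mean]
  ring

lemma lintegral_stieltjes_sub_mean (hW : IsSymmetricGUE P s n W) (hn : 1 ≤ n) {z : ℂ}
    (hz : 0 < z.im) :
    ∫⁻ ω, ‖stieltjes (ncm (hW.isHermitian ω)) z - s.mean n [z]‖ₑ ^ 2 ∂P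
      = ENNReal.ofReal (((2 * n : ℝ) ^ 2)⁻¹ *
        gaussVar (fun y : FreePos n × Bool → ℝ => (s.word [z] y).trace)) := by
  simp_rw [hW.stieltjes_eq_entryStieltjes hz]
  have h := ((hW.identDistrib_entryVec hn).comp
    (((s.measurable_entryStieltjes z).sub_const (s.mean n [z])).enorm.pow_const 2)).lintegral_eq
  simp only [Function.comp_def, s.entryStieltjes_scale] at h
  rw [h, gaussVar, ← integral_const_mul, ofReal_integral_eq_lintegral_ofReal]
  · refine lintegral_congr fun y => ?_
    rw [AddSymm.mean, ← mul_sub, enorm_mul, mul_pow, ← ofReal_norm, ← ofReal_norm,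
      ← ENNReal.ofReal_pow (norm_nonneg _), ← ENNReal.ofReal_pow (norm_nonneg _),
      ← ENNReal.ofReal_mul (by positivity)]
    congr 2
    rw [norm_inv, norm_mul, inv_pow]
    simp
  · obtain ⟨C, hC⟩ := (s.bddC1_ctr (n := n) hz).bdd
    refine Integrable.const_mul (Integrable.of_bound (C := C ^ 2)
      (((s.bddC1_ctr hz).continuous.norm.pow 2).aestronglyMeasurable) (ae_of_all _ fun x => ?_)) _
    rw [Pi.pow_apply, Real.norm_of_nonneg (sq_nonneg _)]
    exact pow_le_pow_left₀ (norm_nonneg _) (hC x) 2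
  · exact ae_of_all _ fun y => mul_nonneg (by positivity) (sq_nonneg _)

lemma aemeasurable_stieltjes (hW : IsSymmetricGUE P s n W) (hn : 1 ≤ n) {z : ℂ} (hz : 0 < z.im) :
    AEMeasurable (fun ω => stieltjes (ncm (hW.isHermitian ω)) z) P := by
  simp_rw [hW.stieltjes_eq_entryStieltjes hz]
  exact (s.measurable_entryStieltjes z).comp_aemeasurable
    (hW.identDistrib_entryVec hn).aemeasurable_fst

end IsSymmetricGUE

variable [IsProbabilityMeasure P]

/-- The variances of the normalized traces are at most C/(n+1)², hence summable, so no assumption on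
the joint law is needed. -/
lemma ae_tendsto_stieltjes {W : (n : ℕ) → Ω → Matrix (SymIdx n) (SymIdx n) ℂ}
    (hW : ∀ n, IsSymmetricGUE P s n (W n)) {z : ℂ} (hz : 0 < z.im) :
    ∀ᵐ ω ∂P, Tendsto (fun n => stieltjes (ncm ((hW (n + 1)).isHermitian ω)) z) atTop
      (𝓝 (fsc z)) := by
  obtain ⟨C, hC0, hC⟩ := AddSymm.exists_gaussVar_trace_le hz
  have hs : Summable fun n : ℕ => C * (((n + 1 : ℕ) : ℝ) ^ 2)⁻¹ :=
    ((summable_nat_add_iff 1).2 (Real.summable_nat_pow_inv.2 one_lt_two)).mul_left C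
  have h := ae_tendsto_zero_of_summable (P := P)
    (X := fun n ω => stieltjes (ncm ((hW (n + 1)).isHermitian ω)) z - s.mean (n + 1) [z])
    (fun n => ((hW (n + 1)).aemeasurable_stieltjes (by omega) hz).sub_const _) hs (fun n => by
      rw [(hW (n + 1)).lintegral_stieltjes_sub_mean (by omega) hz]
      refine ENNReal.ofReal_le_ofReal ?_
      rw [mul_comm C]
      have h0 : (0 : ℝ) < ((n + 1 : ℕ) : ℝ) := by positivity
      gcongr
      · exact gaussVar_nonneg _
      · linarith
      · exact hC s (n + 1))
  have hm := (tendsto_add_atTop_iff_nat 1).2 (s.tendsto_mean_fsc hz)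
  filter_upwards [h] with ω hω
  simpa using hω.add hm

lemma ae_tendsto_ncm {W : (n : ℕ) → Ω → Matrix (SymIdx n) (SymIdx n) ℂ}
    (hW : ∀ n, IsSymmetricGUE P s n (W n)) :
    ∀ᵐ ω ∂P, ∀ φ : ℝ →ᵇ ℝ, Tendsto (fun n => ∫ l, φ l ∂(ncm ((hW n).isHermitian ω))) atTop
      (𝓝 (∫ l, φ l ∂semicircleLaw)) := by
  -- Countability provides one null set for all z in D.
  obtain ⟨D, hDc, hD⟩ := TopologicalSpace.exists_countable_dense ℂ
  have h : ∀ᵐ ω ∂P, ∀ z ∈ D, 0 < z.im →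
      Tendsto (fun n => stieltjes (ncm ((hW (n + 1)).isHermitian ω)) z) atTop (𝓝 (fsc z)) := by
    rw [ae_ball_iff hDc]
    intro z _
    by_cases hz : 0 < z.im
    · filter_upwards [ae_tendsto_stieltjes hW hz] with ω hω _ using hω
    · exact ae_of_all _ fun _ h => absurd h hz
  filter_upwards [h] with ω hω φ
  -- The shift by one avoids n = 0, where the counting measure is zero and not a probability
  -- measure.
  let μ : ℕ → ProbabilityMeasure ℝ := fun n => ⟨ncm ((hW (n + 1)).isHermitian ω),
    isProbabilityMeasure_ncm (by omega) _⟩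
  let ν : ProbabilityMeasure ℝ := ⟨semicircleLaw, inferInstance⟩
  have h1 : Tendsto μ atTop (𝓝 ν) := tendsto_of_tendsto_stieltjes hD hω
  rw [ProbabilityMeasure.tendsto_iff_forall_integral_tendsto] at h1
  exact (tendsto_add_atTop_iff_nat 1).1 (h1 φ)

lemma isLittleO_corr {W : (n : ℕ) → Ω → Matrix (SymIdx n) (SymIdx n) ℂ}
    (hW : ∀ n, IsSymmetricGUE P s n (W n)) {z w : ℂ} (hz : 0 < z.im) (hw : 0 < w.im) :
    (fun n : ℕ => corr P (fun ω z => stieltjes (ncm ((hW n).isHermitian ω)) z) z w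
        - ((2 * (n : ℂ)) ^ 2)⁻¹ * goeS z w) =o[atTop] (fun n : ℕ => ((n : ℝ) ^ 2)⁻¹) := by
  have h1 : (fun n : ℕ => s.trCov n z w - goeS z w) =o[atTop] (fun _ => (1 : ℝ)) := by
    rw [isLittleO_one_iff]
    simpa using (s.tendsto_trCov_goeS hz hw).sub_const (goeS z w)
  have h2 : (fun n : ℕ => ((2 * (n : ℂ)) ^ 2)⁻¹) =O[atTop] (fun n : ℕ => ((n : ℝ) ^ 2)⁻¹) := by
    refine IsBigO.of_bound 1 (Eventually.of_forall fun n => ?_)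
    rw [norm_inv, norm_inv, norm_pow, norm_pow, norm_mul, mul_pow, mul_inv]
    simp only [Complex.norm_ofNat, Complex.norm_natCast, Real.norm_natCast]
    gcongr
    norm_num
  have h3 := h2.mul_isLittleO h1
  simp only [mul_one] at h3
  refine h3.congr' ?_ EventuallyEq.rfl
  filter_upwards [eventually_ge_atTop 1] with n hn
  rw [(hW n).corr_eq hn hz hw, mul_sub]

end Transfer

end

theorem proposition1 {Ω : Type*} [MeasurableSpace Ω] (P : Measure Ω) [IsProbabilityMeasure P]
    (s : AddSymm) (W : (n : ℕ) → Ω → Matrix (SymIdx n) (SymIdx n) ℂ)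
    (hW : ∀ n, IsSymmetricGUE P s n (W n)) :
    (∀ᵐ ω ∂P, ∀ φ : ℝ →ᵇ ℝ,
      Tendsto (fun n => ∫ l, φ l ∂(ncm ((hW n).isHermitian ω))) atTop
        (𝓝 (∫ l, φ l ∂semicircleLaw))) ∧
    ∀ z₁ z₂ : ℂ, 0 < z₁.im → 0 < z₂.im →
      (fun n : ℕ => corr P (fun ω z => stieltjes (ncm ((hW n).isHermitian ω)) z) z₁ z₂
          - ((2 * (n : ℂ)) ^ 2)⁻¹ * goeS z₁ z₂)
        =o[atTop] (fun n : ℕ => ((n : ℝ) ^ 2)⁻¹) := by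
  exact ⟨ae_tendsto_ncm hW, fun _ _ h₁ h₂ => isLittleO_corr hW h₁ h₂⟩
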